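/- Let $c\ge 1$ be an integer and let $\hbar,\mu,\nu\in\mathbf R$. Let $\mathbf T=\mathbf R/\mathbf Z$ and $H=L^2(\mathbf R\times\mathbf T\times\mathbf Z)$. Let $S^c$ be the space of $C^\infty$ functions $\Phi$ on $\mathbf R\times\mathbf T\times\mathbf Z$ such that $\Phi(x+k,y,p)=e^{ickpy}\Phi(x,y,p)$ for all $k\in2\pi\mathbf Z$ and such that, for every polynomial $P$ and all $m,n\ge 0$, the function $P(p)\,\partial_x^m\partial_y^n\Phi(x,y,p)$ is bounded on $K\times\mathbf Z$ for every compact $K\subset\mathbf R\times\mathbf T$. Let $\Phi\in S^c$ act on $H$ by $$(\Phi\xi)(x,y,p)=\sum_q\Phi(x-\hbar(q-2p)\mu,\;y-\hbar(q-2p)\nu,\;q)\,\xi(x,y,p-q).$$ Let $D_\hbar$ and $N_\hbar$ be the norm closure and the weak operator closure of $S^c$ in $B(H)$. Let $$(U_{(r,s,t)}\xi)(x,y,p)=e^{ip(t+cs(x+\hbar p\mu-r))}\xi(x-r,y-s,p),$$ and let $\alpha_r,\beta_s,\gamma_t$ be conjugation $T\mapsto UTU^*$ by $U=U_{(r,0,0)},U_{(0,s,0)},U_{(0,0,t)}$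 respectively. For $A,B,C\in(0,1]$ let $\mathcal L=\mathcal L_\hbar^{A,B,C}$ be the set of $x\in N_\hbar$ for which there is a $K\ge0$ with $\|x-\alpha_r(x)\|\le Kr^A$, $\|x-\beta_s(x)\|\le Ks^B$ and $\|x-\gamma_t(x)\|\le Kt^C$ for all $r,s,t>0$. Let $L(x)$ be the smallest such $K$ and put $\|x\|_{A,B,C}=\max(\|x\|,L(x))$. Let $F$ be the $l^\infty$ direct sum over $t>0$ of copies of $N_\hbar\oplus N_\hbar\oplus N_\hbar$. Let $N_\hbar$ act on $F$ from the left diagonally, and from the right through $x\mapsto\bigoplus_{t>0}(\alpha_t(x)\oplus\beta_t(x)\oplus\gamma_t(x))$. Define $d:\mathcal L\to F$ by $$d(x)=\bigoplus_{t>0}\Bigl(\frac{x-\alpha_t(x)}{t^A}\oplus\frac{x-\beta_t(x)}{t^B}\oplus\frac{x-\gamma_t(x)}{t^C}\Bigr).$$ Then $N_\hbar$ does act on $F$ from both sides as described, $d$ is well defined, and the following hold. (a) $d$ is an unbounded derivation: it is linear, $d(xy)=x\,d(y)+d(x)\,y$ for $x,y\in\mathcal L$, and there is no constant $M$ with $\|d(x)\|\le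 M\|x\|$ for all $x\in\mathcal L$. Its graph is weak*-closed in $N_\hbar\oplus F$. (b) $\mathcal L$ is a dual Banach algebra. That is, it is closed under the operator product, it is complete for $\|\cdot\|_{A,B,C}$, $\|xy\|_{A,B,C}\le2\|x\|_{A,B,C}\|y\|_{A,B,C}$, and $(\mathcal L,\|\cdot\|_{A,B,C})$ is isometrically isomorphic to the dual of a Banach space in such a way that multiplication is separately weak*-continuous. Moreover $\mathcal L$ is contained and norm dense in $D_\hbar$, and if $C<1$ then $\mathcal L$ contains $S^c$ (as operators on $H$). (c) The unit ball $\{x\in\mathcal L:\|x\|_{A,B,C}\le1\}$ is compact in operator norm. -/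

import Mathlib

open MeasureTheory Topology
open scoped ContDiff ENNReal

noncomputable section

namespace QHM

/-- The space `ℝ × 𝕋 × ℤ`, with `𝕋 = ℝ / ℤ`. -/
abbrev Pt : Type := ℝ × UnitAddCircle × ℤ

/-- Lebesgue measure on `ℝ`, Haar measure on `𝕋`, counting measure on `ℤ`. -/
def ptMeasure : Measure Pt :=
  (volume : Measure ℝ).prod ((volume : Measure UnitAddCircle).prod (Measure.count : Measure ℤ))

/-- The Hilbert space `H = L²(ℝ × 𝕋 × ℤ)`. -/
abbrev Hil : Type := Lp ℂ 2 ptMeasure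

/-- The bounded operators `B(H)`. -/
abbrev BH : Type := Hil →L[ℂ] Hil

/-! ### The function space `S^c` and its action on `H` -/

/-- For fixed `p`, a function on `ℝ × 𝕋` viewed as a function on `ℝ × ℝ`, one-periodic in the second
variable. -/
def lift (Φ : ℝ → UnitAddCircle → ℤ → ℂ) (p : ℤ) : ℝ × ℝ → ℂ :=
  fun z => Φ z.1 (z.2 : UnitAddCircle) p

/-- The mixed partial derivative `∂^{m+n} f / ∂x^m ∂y^n`. -/
def partialDeriv (m n : ℕ) (f : ℝ × ℝ → ℂ) (z : ℝ × ℝ) : ℂ :=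
  iteratedFDeriv ℝ (m + n) f z
    (fun i : Fin (m + n) => if (i : ℕ) < m then ((1 : ℝ), (0 : ℝ)) else ((0 : ℝ), (1 : ℝ)))

/-- The space `S^c` of smooth functions on `ℝ × 𝕋 × ℤ`, quasi-periodic in the first variable, all
of whose partial derivatives decay rapidly in `p`, uniformly on compact sets. -/
def schwartz (c : ℕ) : Submodule ℂ (ℝ → UnitAddCircle → ℤ → ℂ) where
  carrier := {Φ |
    (∀ p, ContDiff ℝ ∞ (lift Φ p)) ∧
    (∀ (m : ℤ) (x y : ℝ) (p : ℤ),
      Φ (x + 2 * Real.pi * m) (y : UnitAddCircle) p =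
        Complex.exp (Complex.I * ((c * (2 * Real.pi * m) * p * y : ℝ) : ℂ)) *
          Φ x (y : UnitAddCircle) p) ∧
    (∀ (P : Polynomial ℂ) (m n : ℕ) (K : Set (ℝ × ℝ)), IsCompact K →
      ∃ M : ℝ, ∀ z ∈ K, ∀ p : ℤ, ‖P.eval (p : ℂ) * partialDeriv m n (lift Φ p) z‖ ≤ M)}
  add_mem' := by
    rintro Φ Ψ ⟨h1, h2, h3⟩ ⟨k1, k2, k3⟩
    have hl : ∀ p, lift (Φ + Ψ) p = lift Φ p + lift Ψ p := fun p => rfl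
    refine ⟨fun p => ?_, fun m x y p => ?_, fun P m n K hK => ?_⟩
    · rw [hl]; exact (h1 p).add (k1 p)
    · simp only [Pi.add_apply, h2, k2]; ring
    · obtain ⟨M, hM⟩ := h3 P m n K hK
      obtain ⟨M', hM'⟩ := k3 P m n K hK
      refine ⟨M + M', fun z hz p => ?_⟩
      have : partialDeriv m n (lift (Φ + Ψ) p) z =
          partialDeriv m n (lift Φ p) z + partialDeriv m n (lift Ψ p) z := by
        unfold partialDeriv
        rw [hl, iteratedFDeriv_add_apply ((h1 p).contDiffAt.of_le (by exact_mod_cast le_top))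
          ((k1 p).contDiffAt.of_le (by exact_mod_cast le_top))]
        rfl
      rw [this, mul_add]
      exact (norm_add_le _ _).trans (add_le_add (hM z hz p) (hM' z hz p))
  zero_mem' := by
    have hl : ∀ p, lift 0 p = fun _ => (0 : ℂ) := fun p => rfl
    refine ⟨fun p => ?_, fun m x y p => by simp, fun P m n K hK => ⟨0, fun z hz p => ?_⟩⟩
    · rw [hl]; exact contDiff_const
    · have : partialDeriv m n (lift 0 p) z = 0 := by
        unfold partialDeriv
        rw [hl, iteratedFDeriv_fun_zero]
        rfl
      simp [this]
  smul_mem' := by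
    rintro a Φ ⟨h1, h2, h3⟩
    have hl : ∀ p, lift (a • Φ) p = a • lift Φ p := fun p => rfl
    refine ⟨fun p => ?_, fun m x y p => ?_, fun P m n K hK => ?_⟩
    · rw [hl]; exact (h1 p).const_smul a
    · simp only [Pi.smul_apply, h2, smul_eq_mul]; ring
    · obtain ⟨M, hM⟩ := h3 P m n K hK
      refine ⟨‖a‖ * M, fun z hz p => ?_⟩
      have : partialDeriv m n (lift (a • Φ) p) z = a * partialDeriv m n (lift Φ p) z := by
        unfold partialDeriv
        rw [hl, iteratedFDeriv_const_smul_apply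
          ((h1 p).contDiffAt.of_le (by exact_mod_cast le_top))]
        rfl
      rw [this, mul_left_comm, norm_mul]
      exact mul_le_mul_of_nonneg_left (hM z hz p) (norm_nonneg a)

/-- `T` is the operator through which `Φ` acts on `H`:
`(T ξ)(x, y, p) = ∑_q Φ (x - ħ (q - 2p) μ, y - ħ (q - 2p) ν, q) ξ (x, y, p - q)`
for almost every `(x, y, p)`. -/
def IsActionOf (ħ μ ν : ℝ) (Φ : ℝ → UnitAddCircle → ℤ → ℂ) (T : BH) : Prop :=
  ∀ ξ : Hil, ∀ᵐ z ∂ptMeasure,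
    HasSum (fun q : ℤ =>
      Φ (z.1 - ħ * (q - 2 * z.2.2) * μ)
          (z.2.1 - ((ħ * (q - 2 * z.2.2) * ν : ℝ) : UnitAddCircle)) q *
        ξ (z.1, z.2.1, z.2.2 - q))
      (T ξ z)

/-- The operators on `H` given by the elements of `S^c`. -/
def schwartzOps (c : ℕ) (ħ μ ν : ℝ) : Submodule ℂ BH where
  carrier := {T | ∃ Φ ∈ schwartz c, IsActionOf ħ μ ν Φ T}
  add_mem' := by
    rintro S T ⟨Φ, hΦ, hS⟩ ⟨Ψ, hΨ, hT⟩
    refine ⟨Φ + Ψ, add_mem hΦ hΨ, fun ξ => ?_⟩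
    filter_upwards [hS ξ, hT ξ, Lp.coeFn_add (S ξ) (T ξ)] with z h1 h2 h3
    rw [_root_.add_apply, h3]
    simpa only [Pi.add_apply, add_mul] using h1.add h2
  zero_mem' := by
    refine ⟨0, zero_mem _, fun ξ => ?_⟩
    filter_upwards [Lp.coeFn_zero ℂ 2 ptMeasure] with z h
    rw [_root_.zero_apply, h]
    simp
  smul_mem' := by
    rintro a T ⟨Φ, hΦ, hT⟩
    refine ⟨a • Φ, Submodule.smul_mem _ a hΦ, fun ξ => ?_⟩
    filter_upwards [hT ξ, Lp.coeFn_smul a (T ξ)] with z h1 h2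
    rw [_root_.smul_apply, h2]
    simpa only [Pi.smul_apply, smul_eq_mul, mul_assoc] using h1.mul_left a

/-- `D_ħ`: the norm closure of `S^c` in `B(H)`. -/
def D (c : ℕ) (ħ μ ν : ℝ) : Submodule ℂ BH :=
  (schwartzOps c ħ μ ν).topologicalClosure

/-- `N_ħ`: the closure of `S^c` in `B(H)` for the weak operator topology. -/
def N (c : ℕ) (ħ μ ν : ℝ) : Submodule ℂ BH :=
  (((schwartzOps c ħ μ ν).map
      (ContinuousLinearMap.WOTofCLM : BH →L[ℂ] (Hil →WOT[ℂ] Hil)).toLinearMap).topologicalClosure).comap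
    (ContinuousLinearMap.WOTofCLM : BH →L[ℂ] (Hil →WOT[ℂ] Hil)).toLinearMap

/-! ### The unitaries `U_{(r,s,t)}` and the three one-parameter actions -/

/-- The translation `(x, y, p) ↦ (x - r, y - s, p)`. -/
def shift (r s : ℝ) (z : Pt) : Pt := (z.1 - r, z.2.1 - (s : UnitAddCircle), z.2.2)

/-- The phase `e^{ip(t + cs(x + ħpμ - r))}`. -/
def phase (c : ℕ) (ħ μ r s t : ℝ) (z : Pt) : ℂ :=
  Complex.exp (Complex.I *
    ((z.2.2 * (t + c * s * (z.1 + ħ * z.2.2 * μ - r)) : ℝ) : ℂ))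

lemma measurePreserving_shift (r s : ℝ) :
    MeasurePreserving (shift r s) ptMeasure ptMeasure :=
  (measurePreserving_sub_right volume r).prod
    ((measurePreserving_sub_right volume (s : UnitAddCircle)).prod (MeasurePreserving.id _))

lemma norm_phase (c : ℕ) (ħ μ r s t : ℝ) (z : Pt) : ‖phase c ħ μ r s t z‖ = 1 := by
  unfold phase
  rw [mul_comm, Complex.norm_exp_ofReal_mul_I]

lemma measurable_phase (c : ℕ) (ħ μ r s t : ℝ) : Measurable (phase c ħ μ r s t) := by
  have hp : Measurable (fun z : Pt => ((z.2.2 : ℤ) : ℝ)) :=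
    (measurable_of_countable (fun n : ℤ => (n : ℝ))).comp (measurable_snd.comp measurable_snd)
  unfold phase
  refine Complex.measurable_exp.comp (measurable_const.mul (Complex.measurable_ofReal.comp ?_))
  exact hp.mul (measurable_const.add (measurable_const.mul
    ((measurable_fst.add ((measurable_const.mul hp).mul measurable_const)).sub measurable_const)))

lemma memLp_phase_mul_shift (c : ℕ) (ħ μ r s t : ℝ) (ξ : Hil) :
    MemLp (fun z => phase c ħ μ r s t z * ξ (shift r s z)) 2 ptMeasure := by
  have h := (Lp.memLp ξ).comp_measurePreserving (measurePreserving_shift r s)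
  refine h.of_le ((measurable_phase c ħ μ r s t).aestronglyMeasurable.mul h.1) ?_
  filter_upwards with z
  simp [norm_phase]

/-- The unitary `U_{(r,s,t)}` on `H`:
`(U ξ)(x, y, p) = e^{ip(t + cs(x + ħpμ - r))} ξ(x - r, y - s, p)`. -/
def U (c : ℕ) (ħ μ r s t : ℝ) : BH :=
  LinearMap.mkContinuous
    { toFun := fun ξ => (memLp_phase_mul_shift c ħ μ r s t ξ).toLp _
      map_add' := fun ξ η => by
        rw [← MemLp.toLp_add]
        apply MemLp.toLp_congr
        filter_upwards [(measurePreserving_shift r s).quasiMeasurePreserving.ae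
          (Lp.coeFn_add ξ η)] with z hz
        simp only [hz, Pi.add_apply, mul_add]
      map_smul' := fun a ξ => by
        rw [RingHom.id_apply, ← MemLp.toLp_const_smul]
        apply MemLp.toLp_congr
        filter_upwards [(measurePreserving_shift r s).quasiMeasurePreserving.ae
          (Lp.coeFn_smul a ξ)] with z hz
        simp only [hz, Pi.smul_apply, smul_eq_mul]
        ring }
    1 (fun ξ => by
      have h := (Lp.memLp ξ).comp_measurePreserving (measurePreserving_shift r s)
      have e : eLpNorm (fun z => phase c ħ μ r s t z * ξ (shift r s z)) 2 ptMeasure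
          = eLpNorm ξ 2 ptMeasure := by
        rw [← eLpNorm_comp_measurePreserving (Lp.aestronglyMeasurable ξ)
          (measurePreserving_shift r s)]
        apply eLpNorm_congr_norm_ae
        filter_upwards with z
        simp [norm_phase]
      rw [one_mul]
      change ‖(memLp_phase_mul_shift c ħ μ r s t ξ).toLp _‖ ≤ ‖ξ‖
      rw [Lp.norm_toLp, e, Lp.norm_def])

/-- `α_r(T) = U_{(r,0,0)} T U_{(r,0,0)}^*`. -/
def alpha (c : ℕ) (ħ μ r : ℝ) (T : BH) : BH :=
  U c ħ μ r 0 0 * T * ContinuousLinearMap.adjoint (U c ħ μ r 0 0)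

/-- `β_s(T) = U_{(0,s,0)} T U_{(0,s,0)}^*`. -/
def beta (c : ℕ) (ħ μ s : ℝ) (T : BH) : BH :=
  U c ħ μ 0 s 0 * T * ContinuousLinearMap.adjoint (U c ħ μ 0 s 0)

/-- `γ_t(T) = U_{(0,0,t)} T U_{(0,0,t)}^*`. -/
def gamma (c : ℕ) (ħ μ t : ℝ) (T : BH) : BH :=
  U c ħ μ 0 0 t * T * ContinuousLinearMap.adjoint (U c ħ μ 0 0 t)

/-- The three actions listed as a family. -/
def act (c : ℕ) (ħ μ : ℝ) : Fin 3 → ℝ → BH → BH :=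
  ![alpha c ħ μ, beta c ħ μ, gamma c ħ μ]

lemma act_add (c : ℕ) (ħ μ : ℝ) (i : Fin 3) (t : ℝ) (S T : BH) :
    act c ħ μ i t (S + T) = act c ħ μ i t S + act c ħ μ i t T := by
  fin_cases i <;> simp [act, alpha, beta, gamma, mul_add, add_mul]

lemma act_smul (c : ℕ) (ħ μ : ℝ) (i : Fin 3) (t : ℝ) (a : ℂ) (T : BH) :
    act c ħ μ i t (a • T) = a • act c ħ μ i t T := by
  fin_cases i <;> simp [act, alpha, beta, gamma]

/-! ### The Hölder algebra -/

/-- `K` is an `(A, B, C)`-Hölder constant of `x`. -/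
def IsHolderConst (c : ℕ) (ħ μ A B C : ℝ) (x : BH) (K : ℝ) : Prop :=
  0 ≤ K ∧
  (∀ r > 0, ‖x - alpha c ħ μ r x‖ ≤ K * r ^ A) ∧
  (∀ s > 0, ‖x - beta c ħ μ s x‖ ≤ K * s ^ B) ∧
  (∀ t > 0, ‖x - gamma c ħ μ t x‖ ≤ K * t ^ C)

lemma isHolderConst_iff (c : ℕ) (ħ μ A B C : ℝ) (x : BH) (K : ℝ) :
    IsHolderConst c ħ μ A B C x K ↔
      0 ≤ K ∧ ∀ i : Fin 3, ∀ t > 0, ‖x - act c ħ μ i t x‖ ≤ K * t ^ (![A, B, C] i) := by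
  constructor
  · rintro ⟨h0, h1, h2, h3⟩
    refine ⟨h0, fun i => ?_⟩
    fin_cases i
    · exact h1
    · exact h2
    · exact h3
  · rintro ⟨h0, h⟩
    exact ⟨h0, h 0, h 1, h 2⟩

lemma IsHolderConst.add {c : ℕ} {ħ μ A B C : ℝ} {x y : BH} {K M : ℝ}
    (hx : IsHolderConst c ħ μ A B C x K) (hy : IsHolderConst c ħ μ A B C y M) :
    IsHolderConst c ħ μ A B C (x + y) (K + M) := by
  rw [isHolderConst_iff] at *
  refine ⟨add_nonneg hx.1 hy.1, fun i t ht => ?_⟩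
  rw [act_add, add_sub_add_comm, add_mul]
  exact (norm_add_le _ _).trans (add_le_add (hx.2 i t ht) (hy.2 i t ht))

lemma IsHolderConst.smul {c : ℕ} {ħ μ A B C : ℝ} {x : BH} {K : ℝ}
    (hx : IsHolderConst c ħ μ A B C x K) (a : ℂ) :
    IsHolderConst c ħ μ A B C (a • x) (‖a‖ * K) := by
  rw [isHolderConst_iff] at *
  refine ⟨mul_nonneg (norm_nonneg a) hx.1, fun i t ht => ?_⟩
  rw [act_smul, ← smul_sub, norm_smul, mul_assoc]
  exact mul_le_mul_of_nonneg_left (hx.2 i t ht) (norm_nonneg a)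

lemma isHolderConst_zero (c : ℕ) (ħ μ A B C : ℝ) : IsHolderConst c ħ μ A B C 0 0 := by
  simp [IsHolderConst, alpha, beta, gamma]

/-- The elements of the Hölder algebra `𝓛_ħ^{A,B,C}`. -/
def holder (c : ℕ) (ħ μ ν A B C : ℝ) : Submodule ℂ BH where
  carrier := {x | x ∈ N c ħ μ ν ∧ ∃ K, IsHolderConst c ħ μ A B C x K}
  add_mem' := by
    rintro x y ⟨hx, K, hK⟩ ⟨hy, M, hM⟩
    exact ⟨add_mem hx hy, K + M, hK.add hM⟩
  zero_mem' := ⟨zero_mem _, 0, isHolderConst_zero c ħ μ A B C⟩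
  smul_mem' := by
    rintro a x ⟨hx, K, hK⟩
    exact ⟨Submodule.smul_mem _ a hx, _, hK.smul a⟩

/-- `L^{A,B,C}(x)`, the smallest Hölder constant of `x`. -/
def holderConst (c : ℕ) (ħ μ A B C : ℝ) (x : BH) : ℝ :=
  sInf {K | IsHolderConst c ħ μ A B C x K}

lemma bddBelow_holderConst (c : ℕ) (ħ μ A B C : ℝ) (x : BH) :
    BddBelow {K | IsHolderConst c ħ μ A B C x K} := ⟨0, fun _ h => h.1⟩

lemma holderConst_le {c : ℕ} {ħ μ A B C : ℝ} {x : BH} {K : ℝ}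
    (h : IsHolderConst c ħ μ A B C x K) : holderConst c ħ μ A B C x ≤ K :=
  csInf_le (bddBelow_holderConst c ħ μ A B C x) h

/-- The smallest Hölder constant is attained. -/
lemma isHolderConst_holderConst {c : ℕ} {ħ μ A B C : ℝ} {x : BH}
    (h : ∃ K, IsHolderConst c ħ μ A B C x K) :
    IsHolderConst c ħ μ A B C x (holderConst c ħ μ A B C x) := by
  rw [isHolderConst_iff]
  refine ⟨le_csInf h fun _ hK => hK.1, fun i t ht => ?_⟩
  have hpos : 0 < t ^ (![A, B, C] i) := Real.rpow_pos_of_pos ht _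
  rw [← div_le_iff₀ hpos]
  refine le_csInf h fun K hK => ?_
  rw [div_le_iff₀ hpos]
  exact ((isHolderConst_iff c ħ μ A B C x K).1 hK).2 i t ht

/-- The Hölder algebra as a vector space in its own right, so that it can carry its own norm. -/
def Holder (c : ℕ) (ħ μ ν A B C : ℝ) : Type := holder c ħ μ ν A B C

instance (c : ℕ) (ħ μ ν A B C : ℝ) : AddCommGroup (Holder c ħ μ ν A B C) :=
  inferInstanceAs (AddCommGroup (holder c ħ μ ν A B C))

instance (c : ℕ) (ħ μ ν A B C : ℝ) : Module ℂ (Holder c ħ μ ν A B C) :=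
  inferInstanceAs (Module ℂ (holder c ħ μ ν A B C))

/-- The inclusion of the Hölder algebra in `B(H)`. -/
def Holder.incl (c : ℕ) (ħ μ ν A B C : ℝ) : Holder c ħ μ ν A B C →ₗ[ℂ] BH :=
  (holder c ħ μ ν A B C).subtype

/-- The inclusion of the Hölder algebra in `N_ħ`. -/
def Holder.toN (c : ℕ) (ħ μ ν A B C : ℝ) : Holder c ħ μ ν A B C →ₗ[ℂ] N c ħ μ ν :=
  Submodule.inclusion (fun _ hx => hx.1 : holder c ħ μ ν A B C ≤ N c ħ μ ν)

/-- The norm `‖x‖_{A,B,C} = max (‖x‖, L(x))`. -/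
instance (c : ℕ) (ħ μ ν A B C : ℝ) : Norm (Holder c ħ μ ν A B C) where
  norm x := max ‖Holder.incl c ħ μ ν A B C x‖
    (holderConst c ħ μ A B C (Holder.incl c ħ μ ν A B C x))

lemma Holder.norm_def {c : ℕ} {ħ μ ν A B C : ℝ} (x : Holder c ħ μ ν A B C) :
    ‖x‖ = max ‖Holder.incl c ħ μ ν A B C x‖
      (holderConst c ħ μ A B C (Holder.incl c ħ μ ν A B C x)) := rfl

lemma Holder.isHolderConst {c : ℕ} {ħ μ ν A B C : ℝ} (x : Holder c ħ μ ν A B C) :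
    IsHolderConst c ħ μ A B C (Holder.incl c ħ μ ν A B C x)
      (holderConst c ħ μ A B C (Holder.incl c ħ μ ν A B C x)) :=
  isHolderConst_holderConst x.2.2

lemma Holder.norm_smul_le {c : ℕ} {ħ μ ν A B C : ℝ} (a : ℂ) (x : Holder c ħ μ ν A B C) :
    ‖a • x‖ ≤ ‖a‖ * ‖x‖ := by
  rw [Holder.norm_def, Holder.norm_def, map_smul, mul_max_of_nonneg _ _ (norm_nonneg a), norm_smul]
  exact max_le_max le_rfl (holderConst_le (x.isHolderConst.smul a))

lemma Holder.normCore (c : ℕ) (ħ μ ν A B C : ℝ) :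
    NormedSpace.Core ℂ (Holder c ħ μ ν A B C) where
  norm_nonneg x := (norm_nonneg _).trans (le_max_left _ _)
  norm_smul a x := by
    refine le_antisymm (Holder.norm_smul_le a x) ?_
    by_cases ha : a = 0
    · subst ha
      rw [norm_zero, zero_mul]
      exact (norm_nonneg _).trans (le_max_left _ _)
    · have h := Holder.norm_smul_le a⁻¹ (a • x)
      rw [inv_smul_smul₀ ha, norm_inv, ← div_eq_inv_mul, le_div_iff₀ (norm_pos_iff.2 ha)] at h
      rwa [mul_comm]
  norm_triangle x y := by
    rw [Holder.norm_def, Holder.norm_def, Holder.norm_def, map_add]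
    refine max_le ((norm_add_le _ _).trans (add_le_add (le_max_left _ _) (le_max_left _ _))) ?_
    exact (holderConst_le (x.isHolderConst.add y.isHolderConst)).trans
      (add_le_add (le_max_right _ _) (le_max_right _ _))
  norm_eq_zero_iff x := by
    constructor
    · intro h
      have h1 : ‖Holder.incl c ħ μ ν A B C x‖ ≤ 0 := h ▸ le_max_left _ _
      exact Subtype.ext (norm_le_zero_iff.1 h1)
    · rintro rfl
      rw [Holder.norm_def, map_zero, norm_zero]
      exact max_eq_left (holderConst_le (isHolderConst_zero c ħ μ A B C))

instance (c : ℕ) (ħ μ ν A B C : ℝ) : NormedAddCommGroup (Holder c ħ μ ν A B C) :=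
  NormedAddCommGroup.ofCore (Holder.normCore c ħ μ ν A B C)

instance (c : ℕ) (ħ μ ν A B C : ℝ) : NormedSpace ℂ (Holder c ħ μ ν A B C) :=
  NormedSpace.ofCore (Holder.normCore c ħ μ ν A B C)

/-! ### The bimodule `F` and the weak* topologies -/

/-- `F`, the `l^∞` direct sum over `t > 0` of copies of `N_ħ ⊕ N_ħ ⊕ N_ħ`. -/
abbrev F (c : ℕ) (ħ μ ν : ℝ) : Type :=
  lp (fun _ : {t : ℝ // 0 < t} => Fin 3 → N c ħ μ ν) ∞

/-- The weak* topology of the von Neumann algebra `N_ħ`: the coarsest topology for which the normal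
functionals `x ↦ ∑ₙ ⟨x ξₙ, ηₙ⟩` are continuous, where `∑ₙ ‖ξₙ‖²` and `∑ₙ ‖ηₙ‖²` are finite. -/
@[reducible] def weakStarN (c : ℕ) (ħ μ ν : ℝ) : TopologicalSpace (N c ħ μ ν) :=
  ⨅ (ξ : lp (fun _ : ℕ => Hil) 2) (η : lp (fun _ : ℕ => Hil) 2),
    TopologicalSpace.induced
      (fun x : N c ħ μ ν => ∑' n, inner ℂ (η n) ((x : BH) (ξ n))) inferInstance

/-- The weak* topology of the von Neumann algebra `F`: the coarsest topology for which the
functionals `f ↦ ∑ₙ ⟨f_{tₙ,iₙ} ξₙ, ηₙ⟩` are continuous, where `(tₙ, iₙ)` is a sequence of summands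
and `∑ₙ ‖ξₙ‖²` and `∑ₙ ‖ηₙ‖²` are finite. These functionals make up the predual of `F`, the
`l¹` direct sum of the preduals of the summands. -/
@[reducible] def weakStarF (c : ℕ) (ħ μ ν : ℝ) : TopologicalSpace (F c ħ μ ν) :=
  ⨅ (t : ℕ → {t : ℝ // 0 < t}) (i : ℕ → Fin 3)
    (ξ : lp (fun _ : ℕ => Hil) 2) (η : lp (fun _ : ℕ => Hil) 2),
    TopologicalSpace.induced
      (fun f : F c ħ μ ν => ∑' n, inner ℂ (η n) ((f (t n) (i n) : BH) (ξ n))) inferInstance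

/-- The weak* topology of `N_ħ ⊕ F`. -/
@[reducible] def weakStarNF (c : ℕ) (ħ μ ν : ℝ) : TopologicalSpace (N c ħ μ ν × F c ħ μ ν) :=
  (weakStarN c ħ μ ν).induced Prod.fst ⊓ (weakStarF c ħ μ ν).induced Prod.snd

end QHM

end

/-! Everything rests on the grading of `N` by the central action `γ`, which has period `2π`. An
operator of degree `n` is a weighted shift of the level `p` by `n`, and its weight is read off from
one symbol on `ℝ × 𝕋` (`IsOp`). Products and the three actions have explicit symbols (`IsOp.mul`,
`IsOp.act`). An element of `S^c` is a norm convergent series of such monomials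
(`exists_series_of_mem_schwartz`), so `N` is the weak operator closure of their span, and `N_le`
transfers from monomials to `N` whatever survives weak limits: stability under products and actions,
and commutation relations.

The heart is the compactness of the unit ball in operator norm. Averaging the `γ`-orbit of `X`
against the normalised kernel `(1 + cos t)^j` replaces `X` by a finite combination of its Fourier
components, with an error controlled only by the `C`-Hölder bound (`exists_component_approx`). A
component of degree `n` lies in `N`, hence commutes with the evident operators commuting with all
monomials; this forces it to be a monomial with a bounded measurable quasi-periodic symbol
(`exists_symbol_of_degree`). Averaging the symbol over small `α`- and `β`-translations makes it
smooth, at a cost of `δ^A + δ^B`. For a fixed kernel the averaged symbols are uniformly bounded and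
equicontinuous, so Arzelà–Ascoli on a fundamental domain gives total boundedness
(`exists_degree_approx`). The approximants are finite sums of smooth monomials, whence also the
inclusion of the Hölder algebra in `D`.

A normed space whose unit ball is compact in a weaker norm is a dual space: its predual consists of
the functionals that are continuous on the ball for the weaker norm (`dualEquiv`, by Hahn–Banach).
Multiplication by a fixed element is bounded in both norms, so it is weak*-continuous. Completeness
follows from duality.

The inclusion of `S^c` comes from the mean value inequality on symbols, the factor `|n|` it produces
being absorbed by the rapid decay. The derivation law is the twisted Leibniz identity
`mul_sub_act_mul`. The symbols `e^{inx}`, whose sign `α_{π/n}` reverses, show that `d` is unbounded.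
Its graph is cut out by linear equations between matrix coefficients, so it is weak*-closed. -/

noncomputable section

namespace QHM

/-! ### Weighted composition operators -/

/-- `T` is the weighted composition operator `ξ ↦ w · (ξ ∘ τ)`. -/
def IsWC (w : Pt → ℂ) (τ : Pt → Pt) (T : BH) : Prop :=
  ∀ ξ : Hil, ∀ᵐ z ∂ptMeasure, T ξ z = w z * ξ (τ z)

lemma memLp_weightedComp {w : Pt → ℂ} {τ : Pt → Pt} (hw : Measurable w)
    (hτ : MeasurePreserving τ ptMeasure ptMeasure) {M : ℝ} (hM : ∀ᵐ z ∂ptMeasure, ‖w z‖ ≤ M)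
    (ξ : Hil) : MemLp (fun z => w z * ξ (τ z)) 2 ptMeasure := by
  have h := (Lp.memLp ξ).comp_measurePreserving hτ
  refine h.of_le_mul (c := M) (hw.aestronglyMeasurable.mul h.1) ?_
  filter_upwards [hM] with z hz
  rw [norm_mul]
  exact mul_le_mul_of_nonneg_right hz (norm_nonneg _)

lemma IsWC.norm_apply_le {w : Pt → ℂ} {τ : Pt → Pt} {T : BH}
    (hT : IsWC w τ T) (hτ : MeasurePreserving τ ptMeasure ptMeasure) {M : ℝ}
    (hM : ∀ᵐ z ∂ptMeasure, ‖w z‖ ≤ M) (ξ : Hil) : ‖T ξ‖ ≤ M * ‖ξ‖ := by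
  have h := (Lp.memLp ξ).comp_measurePreserving hτ
  have hle : ∀ᵐ z ∂ptMeasure, ‖T ξ z‖ ≤ M * ‖(ξ ∘ τ) z‖ := by
    filter_upwards [hT ξ, hM] with z h1 h2
    rw [h1, norm_mul]
    exact mul_le_mul_of_nonneg_right h2 (norm_nonneg _)
  have hle' : ∀ᵐ z ∂ptMeasure, ‖T ξ z‖ ≤ M * ‖h.toLp (ξ ∘ τ) z‖ := by
    filter_upwards [hle, h.coeFn_toLp] with z h1 h2
    rwa [h2]
  refine (Lp.norm_le_mul_norm_of_ae_le_mul hle').trans (le_of_eq ?_)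
  rw [Lp.norm_toLp, eLpNorm_comp_measurePreserving (Lp.aestronglyMeasurable ξ) hτ, Lp.norm_def]

lemma exists_isWC {w : Pt → ℂ} {τ : Pt → Pt} (hw : Measurable w)
    (hτ : MeasurePreserving τ ptMeasure ptMeasure) {M : ℝ} (hM : ∀ᵐ z ∂ptMeasure, ‖w z‖ ≤ M) :
    ∃ T : BH, IsWC w τ T := by
  let T₀ : Hil →ₗ[ℂ] Hil :=
    { toFun := fun ξ => (memLp_weightedComp hw hτ hM ξ).toLp _
      map_add' := fun ξ η => by
        rw [← MemLp.toLp_add]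
        apply MemLp.toLp_congr
        filter_upwards [hτ.quasiMeasurePreserving.ae (Lp.coeFn_add ξ η)] with z hz
        simp only [hz, Pi.add_apply, mul_add]
      map_smul' := fun a ξ => by
        rw [RingHom.id_apply, ← MemLp.toLp_const_smul]
        apply MemLp.toLp_congr
        filter_upwards [hτ.quasiMeasurePreserving.ae (Lp.coeFn_smul a ξ)] with z hz
        simp only [hz, Pi.smul_apply, smul_eq_mul]
        ring }
  have hT₀ : ∀ ξ, ∀ᵐ z ∂ptMeasure, T₀ ξ z = w z * ξ (τ z) :=
    fun ξ => (memLp_weightedComp hw hτ hM ξ).coeFn_toLp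
  refine ⟨T₀.mkContinuous M fun ξ => ?_, hT₀⟩
  have h := (Lp.memLp ξ).comp_measurePreserving hτ
  have hle' : ∀ᵐ z ∂ptMeasure, ‖T₀ ξ z‖ ≤ M * ‖h.toLp (ξ ∘ τ) z‖ := by
    filter_upwards [hT₀ ξ, hM, h.coeFn_toLp] with z h1 h2 h3
    rw [h1, norm_mul, h3]
    exact mul_le_mul_of_nonneg_right h2 (norm_nonneg _)
  refine (Lp.norm_le_mul_norm_of_ae_le_mul hle').trans (le_of_eq ?_)
  rw [Lp.norm_toLp, eLpNorm_comp_measurePreserving (Lp.aestronglyMeasurable ξ) hτ, Lp.norm_def]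

lemma IsWC.norm_le {w : Pt → ℂ} {τ : Pt → Pt} {T : BH}
    (hT : IsWC w τ T) (hτ : MeasurePreserving τ ptMeasure ptMeasure) {M : ℝ} (h0 : 0 ≤ M)
    (hM : ∀ᵐ z ∂ptMeasure, ‖w z‖ ≤ M) : ‖T‖ ≤ M :=
  T.opNorm_le_bound h0 (hT.norm_apply_le hτ hM)

lemma IsWC.unique {w : Pt → ℂ} {τ : Pt → Pt} {S T : BH} (hS : IsWC w τ S) (hT : IsWC w τ T) :
    S = T := by
  ext1 ξ
  apply Lp.ext
  filter_upwards [hS ξ, hT ξ] with z h1 h2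
  rw [h1, h2]

lemma IsWC.congr {w w' : Pt → ℂ} {τ : Pt → Pt} {T : BH} (hT : IsWC w τ T)
    (h : ∀ᵐ z ∂ptMeasure, w z = w' z) : IsWC w' τ T := fun ξ => by
  filter_upwards [hT ξ, h] with z h1 h2
  rw [h1, h2]

lemma IsWC.mul {w w' : Pt → ℂ} {τ τ' : Pt → Pt} {S T : BH} (hS : IsWC w τ S) (hT : IsWC w' τ' T)
    (hτ : MeasurePreserving τ ptMeasure ptMeasure) :
    IsWC (fun z => w z * w' (τ z)) (fun z => τ' (τ z)) (S * T) := fun ξ => by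
  filter_upwards [hS (T ξ), hτ.quasiMeasurePreserving.ae (hT ξ)] with z h1 h2
  rw [mul_apply_eq_comp, h1, h2, mul_assoc]

lemma IsWC.sub {w w' : Pt → ℂ} {τ : Pt → Pt} {S T : BH} (hS : IsWC w τ S) (hT : IsWC w' τ T) :
    IsWC (fun z => w z - w' z) τ (S - T) := fun ξ => by
  filter_upwards [hS ξ, hT ξ, Lp.coeFn_sub (S ξ) (T ξ)] with z h1 h2 h3
  rw [_root_.sub_apply, h3, Pi.sub_apply, h1, h2, sub_mul]

lemma IsWC.smul {w : Pt → ℂ} {τ : Pt → Pt} {S : BH} (hS : IsWC w τ S) (a : ℂ) :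
    IsWC (fun z => a * w z) τ (a • S) := fun ξ => by
  filter_upwards [hS ξ, Lp.coeFn_smul a (S ξ)] with z h1 h2
  rw [_root_.smul_apply, h2, Pi.smul_apply, h1, smul_eq_mul, mul_assoc]

lemma isWC_one : IsWC (fun _ => 1) id (1 : BH) := fun ξ => by
  filter_upwards with z
  simp

lemma isWC_U (c : ℕ) (ħ μ r s t : ℝ) : IsWC (phase c ħ μ r s t) (shift r s) (U c ħ μ r s t) :=
  fun ξ => (memLp_phase_mul_shift c ħ μ r s t ξ).coeFn_toLp

/-! ### The one-parameter unitary groups -/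

/-- The three one-parameter unitary groups implementing the actions. -/
def oneParam (c : ℕ) (ħ μ : ℝ) (i : Fin 3) (t : ℝ) : BH :=
  ![U c ħ μ t 0 0, U c ħ μ 0 t 0, U c ħ μ 0 0 t] i

/-- The weights of the three one-parameter unitary groups. -/
def oneParamPhase (c : ℕ) (ħ μ : ℝ) (i : Fin 3) (t : ℝ) : Pt → ℂ :=
  ![phase c ħ μ t 0 0, phase c ħ μ 0 t 0, phase c ħ μ 0 0 t] i

/-- The translations of the three one-parameter unitary groups. -/
def oneParamShift (i : Fin 3) (t : ℝ) : Pt → Pt :=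
  ![shift t 0, shift 0 t, shift 0 0] i

lemma isWC_oneParam (c : ℕ) (ħ μ : ℝ) (i : Fin 3) (t : ℝ) :
    IsWC (oneParamPhase c ħ μ i t) (oneParamShift i t) (oneParam c ħ μ i t) := by
  fin_cases i
  · exact isWC_U c ħ μ t 0 0
  · exact isWC_U c ħ μ 0 t 0
  · exact isWC_U c ħ μ 0 0 t

lemma measurePreserving_oneParamShift (i : Fin 3) (t : ℝ) :
    MeasurePreserving (oneParamShift i t) ptMeasure ptMeasure := by
  fin_cases i <;> exact measurePreserving_shift _ _

lemma norm_oneParamPhase (c : ℕ) (ħ μ : ℝ) (i : Fin 3) (t : ℝ) (z : Pt) :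
    ‖oneParamPhase c ħ μ i t z‖ = 1 := by
  fin_cases i <;> exact norm_phase _ _ _ _ _ _ _

lemma oneParam_zero (c : ℕ) (ħ μ : ℝ) (i : Fin 3) : oneParam c ħ μ i 0 = 1 := by
  have h : oneParam c ħ μ i 0 = U c ħ μ 0 0 0 := by fin_cases i <;> rfl
  rw [h]
  refine (isWC_U c ħ μ 0 0 0).unique fun ξ => ?_
  filter_upwards with z
  simp [phase, shift]

/-- The translation of each group leaves the phase of that same group unchanged: `β` moves only `y`,
while its phase depends on `x` and `p`. So the phases simply multiply. -/
lemma oneParam_add (c : ℕ) (ħ μ : ℝ) (i : Fin 3) (s t : ℝ) :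
    oneParam c ħ μ i (s + t) = oneParam c ħ μ i s * oneParam c ħ μ i t := by
  refine (isWC_oneParam c ħ μ i (s + t)).unique ?_
  have h := (isWC_oneParam c ħ μ i s).mul (isWC_oneParam c ħ μ i t)
    (measurePreserving_oneParamShift i s)
  have h1 : (fun z => oneParamShift i t (oneParamShift i s z)) = oneParamShift i (s + t) := by
    funext z
    fin_cases i <;> simp [oneParamShift, shift, sub_sub]
  rw [h1] at h
  refine h.congr (Filter.Eventually.of_forall fun z => ?_)
  fin_cases i <;> simp only [oneParamPhase, oneParamShift, phase, shift, Fin.zero_eta,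
    Fin.mk_one, Fin.reduceFinMk, Matrix.cons_val, ← Complex.exp_add, ← mul_add, ← Complex.ofReal_add]
    <;> congr 3 <;> ring

lemma oneParam_neg_mul (c : ℕ) (ħ μ : ℝ) (i : Fin 3) (t : ℝ) :
    oneParam c ħ μ i (-t) * oneParam c ħ μ i t = 1 := by
  rw [← oneParam_add, neg_add_cancel, oneParam_zero]

lemma oneParam_mul_neg (c : ℕ) (ħ μ : ℝ) (i : Fin 3) (t : ℝ) :
    oneParam c ħ μ i t * oneParam c ħ μ i (-t) = 1 := by
  rw [← oneParam_add, add_neg_cancel, oneParam_zero]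

lemma norm_oneParam_apply_le (c : ℕ) (ħ μ : ℝ) (i : Fin 3) (t : ℝ) (ξ : Hil) :
    ‖oneParam c ħ μ i t ξ‖ ≤ ‖ξ‖ := by
  simpa using (isWC_oneParam c ħ μ i t).norm_apply_le (measurePreserving_oneParamShift i t) (M := 1)
    (Filter.Eventually.of_forall fun z => (norm_oneParamPhase c ħ μ i t z).le) ξ

lemma norm_oneParam_le (c : ℕ) (ħ μ : ℝ) (i : Fin 3) (t : ℝ) : ‖oneParam c ħ μ i t‖ ≤ 1 :=
  ContinuousLinearMap.opNorm_le_bound _ zero_le_one fun ξ => by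
    simpa using norm_oneParam_apply_le c ħ μ i t ξ

lemma norm_oneParam_apply (c : ℕ) (ħ μ : ℝ) (i : Fin 3) (t : ℝ) (ξ : Hil) :
    ‖oneParam c ħ μ i t ξ‖ = ‖ξ‖ := by
  refine le_antisymm (norm_oneParam_apply_le c ħ μ i t ξ) ?_
  have h := norm_oneParam_apply_le c ħ μ i (-t) (oneParam c ħ μ i t ξ)
  rwa [← mul_apply_eq_comp, oneParam_neg_mul, one_apply_eq_self] at h

/-- An isometry satisfies `U* U = 1`, and the group law provides a right inverse, which must then be
the adjoint. -/
lemma adjoint_oneParam (c : ℕ) (ħ μ : ℝ) (i : Fin 3) (t : ℝ) :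
    ContinuousLinearMap.adjoint (oneParam c ħ μ i t) = oneParam c ħ μ i (-t) := by
  have h : ContinuousLinearMap.adjoint (oneParam c ħ μ i t) * oneParam c ħ μ i t = 1 :=
    (ContinuousLinearMap.norm_map_iff_adjoint_comp_self _).1 (norm_oneParam_apply c ħ μ i t)
  calc _ = ContinuousLinearMap.adjoint (oneParam c ħ μ i t) *
        (oneParam c ħ μ i t * oneParam c ħ μ i (-t)) := by rw [oneParam_mul_neg, mul_one]
    _ = _ := by rw [← mul_assoc, h, one_mul]

lemma act_eq (c : ℕ) (ħ μ : ℝ) (i : Fin 3) (t : ℝ) (T : BH) :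
    act c ħ μ i t T = oneParam c ħ μ i t * T * oneParam c ħ μ i (-t) := by
  rw [← adjoint_oneParam]
  fin_cases i <;> rfl

lemma act_mul (c : ℕ) (ħ μ : ℝ) (i : Fin 3) (t : ℝ) (S T : BH) :
    act c ħ μ i t (S * T) = act c ħ μ i t S * act c ħ μ i t T := by
  simp only [act_eq]
  calc _ = oneParam c ħ μ i t * S * (oneParam c ħ μ i (-t) * oneParam c ħ μ i t) * T *
        oneParam c ħ μ i (-t) := by rw [oneParam_neg_mul]; simp only [mul_assoc, one_mul]
    _ = _ := by simp only [mul_assoc]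

lemma act_act (c : ℕ) (ħ μ : ℝ) (i : Fin 3) (s t : ℝ) (T : BH) :
    act c ħ μ i s (act c ħ μ i t T) = act c ħ μ i (s + t) T := by
  simp only [act_eq]
  rw [oneParam_add, neg_add_rev, oneParam_add]
  simp only [mul_assoc]

lemma act_zero_time (c : ℕ) (ħ μ : ℝ) (i : Fin 3) (T : BH) : act c ħ μ i 0 T = T := by
  rw [act_eq, neg_zero, oneParam_zero, one_mul, mul_one]

lemma act_sub (c : ℕ) (ħ μ : ℝ) (i : Fin 3) (t : ℝ) (S T : BH) :
    act c ħ μ i t (S - T) = act c ħ μ i t S - act c ħ μ i t T := by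
  simp only [act_eq, mul_sub, sub_mul]

lemma norm_act_le (c : ℕ) (ħ μ : ℝ) (i : Fin 3) (t : ℝ) (T : BH) :
    ‖act c ħ μ i t T‖ ≤ ‖T‖ := by
  rw [act_eq]
  calc _ ≤ ‖oneParam c ħ μ i t‖ * ‖T‖ * ‖oneParam c ħ μ i (-t)‖ :=
        (norm_mul_le _ _).trans (mul_le_mul_of_nonneg_right (norm_mul_le _ _) (norm_nonneg _))
    _ ≤ 1 * ‖T‖ * 1 := by
        gcongr <;> exact norm_oneParam_le _ _ _ _ _
    _ = ‖T‖ := by ring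

lemma norm_act (c : ℕ) (ħ μ : ℝ) (i : Fin 3) (t : ℝ) (T : BH) :
    ‖act c ħ μ i t T‖ = ‖T‖ := by
  refine le_antisymm (norm_act_le c ħ μ i t T) ?_
  have h := norm_act_le c ħ μ i (-t) (act c ħ μ i t T)
  rwa [act_act, neg_add_cancel, act_zero_time] at h

/-- Each automorphism of the action, as a continuous linear map. -/
def actL (c : ℕ) (ħ μ : ℝ) (i : Fin 3) (t : ℝ) : BH →L[ℂ] BH :=
  LinearMap.mkContinuous
    { toFun := act c ħ μ i t
      map_add' := act_add c ħ μ i t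
      map_smul' := act_smul c ħ μ i t } 1 fun T => by simpa using norm_act_le c ħ μ i t T

lemma actL_apply (c : ℕ) (ħ μ : ℝ) (i : Fin 3) (t : ℝ) (T : BH) :
    actL c ħ μ i t T = act c ħ μ i t T := rfl

/-- The central action commutes with the other two. -/
lemma oneParam_comm_central (c : ℕ) (ħ μ : ℝ) (i : Fin 3) (s t : ℝ) :
    oneParam c ħ μ i s * oneParam c ħ μ 2 t = oneParam c ħ μ 2 t * oneParam c ħ μ i s := by
  have h1 := (isWC_oneParam c ħ μ i s).mul (isWC_oneParam c ħ μ 2 t)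
    (measurePreserving_oneParamShift i s)
  have h2 := (isWC_oneParam c ħ μ 2 t).mul (isWC_oneParam c ħ μ i s)
    (measurePreserving_oneParamShift 2 t)
  have h : (fun z => oneParamShift i s (oneParamShift 2 t z)) =
      fun z => oneParamShift 2 t (oneParamShift i s z) := by
    funext z
    fin_cases i <;> simp [oneParamShift, shift]
  rw [h] at h2
  refine h1.unique (h2.congr (Filter.Eventually.of_forall fun z => ?_))
  fin_cases i <;> simp [oneParamPhase, oneParamShift, phase, shift, mul_comm]

/-- This lets averages over the central action inherit the Hölder estimates for `α` and `β`. -/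
lemma act_comm_central (c : ℕ) (ħ μ : ℝ) (i : Fin 3) (s t : ℝ) (T : BH) :
    act c ħ μ i s (act c ħ μ 2 t T) = act c ħ μ 2 t (act c ħ μ i s T) := by
  simp only [act_eq]
  calc _ = (oneParam c ħ μ i s * oneParam c ħ μ 2 t) * T *
        (oneParam c ħ μ 2 (-t) * oneParam c ħ μ i (-s)) := by simp only [mul_assoc]
    _ = (oneParam c ħ μ 2 t * oneParam c ħ μ i s) * T *
        (oneParam c ħ μ i (-s) * oneParam c ħ μ 2 (-t)) := by
        rw [oneParam_comm_central, oneParam_comm_central]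
    _ = _ := by simp only [mul_assoc]

/-! ### Monomial operators -/

/-- The weight of the monomial operator of degree `n` and symbol `φ`. -/
def opWeight (ħ μ ν : ℝ) (n : ℤ) (φ : ℝ → UnitAddCircle → ℂ) (z : Pt) : ℂ :=
  φ (z.1 - ħ * (n - 2 * z.2.2) * μ) (z.2.1 - ((ħ * (n - 2 * z.2.2) * ν : ℝ) : UnitAddCircle))

/-- The translation by which a monomial operator of degree `n` acts. -/
def opShift (n : ℤ) (z : Pt) : Pt := (z.1, z.2.1, z.2.2 - n)

/-- `T` is the monomial operator of degree `n` and symbol `φ`. -/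
def IsOp (ħ μ ν : ℝ) (n : ℤ) (φ : ℝ → UnitAddCircle → ℂ) (T : BH) : Prop :=
  IsWC (opWeight ħ μ ν n φ) (opShift n) T

lemma measurePreserving_opShift (n : ℤ) : MeasurePreserving (opShift n) ptMeasure ptMeasure :=
  (MeasurePreserving.id _).prod
    ((MeasurePreserving.id _).prod (measurePreserving_sub_right Measure.count n))

lemma measurable_opWeight {ħ μ ν : ℝ} {n : ℤ} {φ : ℝ → UnitAddCircle → ℂ}
    (hφ : Measurable (Function.uncurry φ)) : Measurable (opWeight ħ μ ν n φ) := by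
  have hp : ∀ f : ℤ → ℝ, Measurable (fun z : Pt => f z.2.2) := fun f =>
    (measurable_of_countable f).comp (measurable_snd.comp measurable_snd)
  have hq : ∀ f : ℤ → UnitAddCircle, Measurable (fun z : Pt => f z.2.2) := fun f =>
    (measurable_of_countable f).comp (measurable_snd.comp measurable_snd)
  exact hφ.comp ((measurable_fst.sub (hp fun p => ħ * (n - 2 * p) * μ)).prodMk
    ((measurable_fst.comp measurable_snd).sub
      (hq fun p => ((ħ * (n - 2 * p) * ν : ℝ) : UnitAddCircle))))

lemma exists_isOp {ħ μ ν : ℝ} {n : ℤ} {φ : ℝ → UnitAddCircle → ℂ}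
    (hφ : Measurable (Function.uncurry φ)) {M : ℝ} (hM : ∀ x y, ‖φ x y‖ ≤ M) :
    ∃ T, IsOp ħ μ ν n φ T :=
  exists_isWC (measurable_opWeight hφ) (measurePreserving_opShift n)
    (Filter.Eventually.of_forall fun _ => hM _ _)

lemma IsOp.norm_le {ħ μ ν : ℝ} {n : ℤ} {φ : ℝ → UnitAddCircle → ℂ} {T : BH}
    (hT : IsOp ħ μ ν n φ T) {M : ℝ} (hM : ∀ x y, ‖φ x y‖ ≤ M) : ‖T‖ ≤ M :=
  IsWC.norm_le hT (measurePreserving_opShift n) ((norm_nonneg _).trans (hM 0 0))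
    (Filter.Eventually.of_forall fun _ => hM _ _)

lemma IsOp.sub {ħ μ ν : ℝ} {n : ℤ} {φ ψ : ℝ → UnitAddCircle → ℂ} {S T : BH}
    (hS : IsOp ħ μ ν n φ S) (hT : IsOp ħ μ ν n ψ T) :
    IsOp ħ μ ν n (fun x y => φ x y - ψ x y) (S - T) :=
  IsWC.sub hS hT

lemma IsOp.smul {ħ μ ν : ℝ} {n : ℤ} {φ : ℝ → UnitAddCircle → ℂ} {S : BH}
    (hS : IsOp ħ μ ν n φ S) (a : ℂ) : IsOp ħ μ ν n (fun x y => a * φ x y) (a • S) :=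
  IsWC.smul hS a

/-- The symbol of the product of two monomial operators. -/
def symbolMul (ħ μ ν : ℝ) (n m : ℤ) (φ ψ : ℝ → UnitAddCircle → ℂ) : ℝ → UnitAddCircle → ℂ :=
  fun x y => φ (x + ħ * m * μ) (y + ((ħ * m * ν : ℝ) : UnitAddCircle)) *
    ψ (x - ħ * n * μ) (y - ((ħ * n * ν : ℝ) : UnitAddCircle))

/-- With `x' = x - ħ(n + m - 2p)μ`, the base point of a degree `n + m` operator, the first weight is
evaluated at `x' + ħmμ`. The second, taken at level `p - n`, is evaluated at `x' - ħnμ`. The same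
holds in `y`. -/
lemma IsOp.mul {ħ μ ν : ℝ} {n m : ℤ} {φ ψ : ℝ → UnitAddCircle → ℂ} {S T : BH}
    (hS : IsOp ħ μ ν n φ S) (hT : IsOp ħ μ ν m ψ T) :
    IsOp ħ μ ν (n + m) (symbolMul ħ μ ν n m φ ψ) (S * T) := by
  have h := IsWC.mul hS hT (measurePreserving_opShift n)
  have h1 : (fun z => opShift m (opShift n z)) = opShift (n + m) := by
    funext z
    simp [opShift, sub_sub]
  rw [h1] at h
  refine h.congr (Filter.Eventually.of_forall fun z => ?_)
  simp only [opWeight, opShift, symbolMul]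
  congr 2
  · push_cast; ring
  · rw [sub_add, ← AddCircle.coe_sub]; congr 2; push_cast; ring
  · push_cast; ring
  · rw [sub_sub, ← AddCircle.coe_add]; congr 2; push_cast; ring

/-- The effect of the actions on symbols of degree `n`. -/
def twist (c : ℕ) (n : ℤ) (i : Fin 3) (t : ℝ) (φ : ℝ → UnitAddCircle → ℂ) :
    ℝ → UnitAddCircle → ℂ :=
  ![fun x y => φ (x - t) y,
    fun x y => Complex.exp (Complex.I * ((c * t * n * x : ℝ) : ℂ)) * φ x (y - (t : UnitAddCircle)),
    fun x y => Complex.exp (Complex.I * ((n * t : ℝ) : ℂ)) * φ x y] i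

/-- For `β` the phases at levels `p` and `p - n` leave the exponent `ct(p(x + ħpμ) - (p - n)(x + ħ(p
- n)μ)) = ctn(x - ħ(n - 2p)μ)`. This is a function of the base point of the symbol alone, thanks to
the term `ħpμ` in the phase. -/
lemma IsOp.act {c : ℕ} {ħ μ ν : ℝ} {n : ℤ} {φ : ℝ → UnitAddCircle → ℂ} {T : BH}
    (hT : IsOp ħ μ ν n φ T) (i : Fin 3) (t : ℝ) :
    IsOp ħ μ ν n (twist c n i t φ) (act c ħ μ i t T) := by
  rw [act_eq]
  have h := ((isWC_oneParam c ħ μ i t).mul hT (measurePreserving_oneParamShift i t)).mul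
    (isWC_oneParam c ħ μ i (-t))
    ((measurePreserving_opShift n).comp (measurePreserving_oneParamShift i t))
  have h1 : (fun z => oneParamShift i (-t) (opShift n (oneParamShift i t z))) = opShift n := by
    funext z
    fin_cases i <;> simp [oneParamShift, shift, opShift]
  rw [h1] at h
  refine h.congr (Filter.Eventually.of_forall fun z => ?_)
  fin_cases i
  · simp [oneParamPhase, oneParamShift, phase, opWeight, opShift, shift, twist]
    congr 1
    ring
  · simp only [oneParamPhase, oneParamShift, phase, opWeight, opShift, shift, twist,
      Matrix.cons_val, Fin.mk_one, sub_zero]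
    rw [mul_right_comm, ← Complex.exp_add]
    congr 1
    · congr 1
      push_cast
      ring
    · congr 1
      abel
  · simp only [oneParamPhase, oneParamShift, phase, opWeight, opShift, shift, twist,
      Matrix.cons_val, Fin.reduceFinMk, sub_zero, QuotientAddGroup.mk_zero]
    rw [mul_right_comm, ← Complex.exp_add]
    congr 1
    congr 1
    push_cast
    ring

/-! ### Sections -/

/-- `φ` is a smooth symbol of degree `n`: a smooth function on `ℝ × 𝕋` with the quasi-periodicity
of the `n`-th Fourier coefficient of a function in `S^c`. -/
structure IsSection (c : ℕ) (n : ℤ) (φ : ℝ → UnitAddCircle → ℂ) : Prop where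
  smooth : ContDiff ℝ ∞ (fun z : ℝ × ℝ => φ z.1 (z.2 : UnitAddCircle))
  quasi : ∀ (m : ℤ) (x y : ℝ), φ (x + 2 * Real.pi * m) (y : UnitAddCircle) =
    Complex.exp (Complex.I * ((c * (2 * Real.pi * m) * n * y : ℝ) : ℂ)) * φ x (y : UnitAddCircle)

lemma norm_exp_I_mul (a : ℝ) : ‖Complex.exp (Complex.I * (a : ℂ))‖ = 1 := by
  rw [mul_comm, Complex.norm_exp_ofReal_mul_I]

lemma isOpenQuotientMap_prodMap_coe :
    IsOpenQuotientMap (Prod.map id ((↑) : ℝ → UnitAddCircle) : ℝ × ℝ → ℝ × UnitAddCircle) :=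
  IsOpenQuotientMap.id.prodMap QuotientAddGroup.isOpenQuotientMap_mk

lemma continuous_of_lift {φ : ℝ → UnitAddCircle → ℂ}
    (h : Continuous (fun z : ℝ × ℝ => φ z.1 (z.2 : UnitAddCircle))) :
    Continuous (Function.uncurry φ) :=
  isOpenQuotientMap_prodMap_coe.isQuotientMap.continuous_iff.2 h

/-- A representative of the position modulo `2πℤ × ℤ`. -/
lemma exists_fundamental (x : ℝ) (y : UnitAddCircle) :
    ∃ (m : ℤ) (x₀ y₀ : ℝ), x = x₀ + 2 * Real.pi * m ∧ y = (y₀ : UnitAddCircle) ∧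
      (x₀, y₀) ∈ Set.Icc (0 : ℝ) (2 * Real.pi) ×ˢ Set.Icc (0 : ℝ) 1 := by
  obtain ⟨m, hm, -⟩ := existsUnique_sub_zsmul_mem_Ico Real.two_pi_pos x 0
  obtain ⟨b, rfl⟩ := QuotientAddGroup.mk_surjective y
  obtain ⟨k, hk, -⟩ := existsUnique_sub_zsmul_mem_Ico (zero_lt_one (α := ℝ)) b 0
  refine ⟨m, x - m • (2 * Real.pi), b - k • (1 : ℝ), ?_, ?_, ⟨hm.1, ?_⟩, ⟨hk.1, ?_⟩⟩
  · simp [mul_comm]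
  · have : ((k • (1 : ℝ) : ℝ) : UnitAddCircle) = 0 := by
      rw [AddCircle.coe_zsmul, AddCircle.coe_period, smul_zero]
    rw [AddCircle.coe_sub, this, sub_zero]
  · simpa using hm.2.le
  · simpa using hk.2.le

/-- The compact fundamental domain for `2πℤ × ℤ`. -/
def fundDom : Set (ℝ × ℝ) := Set.Icc (0 : ℝ) (2 * Real.pi) ×ˢ Set.Icc (0 : ℝ) 1

lemma isCompact_fundDom : IsCompact fundDom := isCompact_Icc.prod isCompact_Icc

/-- The factors of quasi-periodicity have modulus one, so `‖φ‖` descends to a compact torus. All sup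
estimates on symbols reduce to `fundDom` in this way. -/
lemma norm_le_of_quasi {c : ℕ} {n : ℤ} {φ : ℝ → UnitAddCircle → ℂ} {M : ℝ}
    (hq : ∀ (m : ℤ) (x y : ℝ), φ (x + 2 * Real.pi * m) (y : UnitAddCircle) =
      Complex.exp (Complex.I * ((c * (2 * Real.pi * m) * n * y : ℝ) : ℂ)) *
        φ x (y : UnitAddCircle))
    (h : ∀ z ∈ fundDom, ‖φ z.1 (z.2 : UnitAddCircle)‖ ≤ M) (x : ℝ) (y : UnitAddCircle) :
    ‖φ x y‖ ≤ M := by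
  obtain ⟨m, x₀, y₀, rfl, rfl, hz⟩ := exists_fundamental x y
  rw [hq, norm_mul, norm_exp_I_mul, one_mul]
  exact h _ hz

namespace IsSection

variable {c : ℕ} {n m : ℤ} {φ ψ : ℝ → UnitAddCircle → ℂ}

lemma continuous (h : IsSection c n φ) : Continuous (Function.uncurry φ) :=
  continuous_of_lift h.smooth.continuous

lemma measurable (h : IsSection c n φ) : Measurable (Function.uncurry φ) := h.continuous.measurable

lemma norm_le (h : IsSection c n φ) {M : ℝ}
    (hM : ∀ z ∈ fundDom, ‖φ z.1 (z.2 : UnitAddCircle)‖ ≤ M) (x : ℝ) (y : UnitAddCircle) :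
    ‖φ x y‖ ≤ M :=
  norm_le_of_quasi h.quasi hM x y

lemma bounded (h : IsSection c n φ) : ∃ M, ∀ x y, ‖φ x y‖ ≤ M := by
  obtain ⟨M, hM⟩ := isCompact_fundDom.exists_bound_of_continuousOn h.smooth.continuous.continuousOn
  exact ⟨M, h.norm_le hM⟩

lemma exists_isOp (h : IsSection c n φ) (ħ μ ν : ℝ) : ∃ T, IsOp ħ μ ν n φ T :=
  let ⟨_, hM⟩ := h.bounded
  QHM.exists_isOp h.measurable hM

lemma sub (h : IsSection c n φ) (k : IsSection c n ψ) :
    IsSection c n (fun x y => φ x y - ψ x y) :=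
  ⟨h.smooth.sub k.smooth, fun m x y => by rw [h.quasi, k.quasi, mul_sub]⟩

/-- In the quasi-period exponent the shifts contribute `n · ħmν` and `-m · ħnν`, which cancel and
leave `(n + m)y`. -/
lemma symbolMul (h : IsSection c n φ) (k : IsSection c m ψ) (ħ μ ν : ℝ) :
    IsSection c (n + m) (symbolMul ħ μ ν n m φ ψ) where
  smooth := by
    have h1 := h.smooth.comp (f := fun z : ℝ × ℝ => (z.1 + ħ * m * μ, z.2 + ħ * m * ν))
      (by fun_prop)
    have h2 := k.smooth.comp (f := fun z : ℝ × ℝ => (z.1 - ħ * n * μ, z.2 - ħ * n * ν))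
      (by fun_prop)
    exact h1.mul h2
  quasi := fun l x y => by
    simp only [QHM.symbolMul, ← AddCircle.coe_add, ← AddCircle.coe_sub]
    rw [add_right_comm, add_sub_right_comm, h.quasi, k.quasi, mul_mul_mul_comm, ← Complex.exp_add]
    congr 2
    push_cast
    ring

/-- For `β` the prefactor `e^{ictnx}` picks up `e^{ictn · 2πm}` over a period, which compensates the
shift `y - t` in the quasi-period phase. -/
lemma twist (h : IsSection c n φ) (i : Fin 3) (t : ℝ) : IsSection c n (twist c n i t φ) := by
  fin_cases i
  · refine ⟨?_, fun m x y => ?_⟩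
    · exact h.smooth.comp (f := fun z : ℝ × ℝ => (z.1 - t, z.2)) (by fun_prop)
    · simp only [QHM.twist, Fin.zero_eta, Matrix.cons_val]
      rw [add_sub_right_comm, h.quasi]
  · refine ⟨?_, fun m x y => ?_⟩
    · have h1 := h.smooth.comp (f := fun z : ℝ × ℝ => (z.1, z.2 - t)) (by fun_prop)
      have h2 : ContDiff ℝ ∞ fun z : ℝ × ℝ =>
          Complex.exp (Complex.I * ((c * t * n * z.1 : ℝ) : ℂ)) :=
        (contDiff_const.mul (Complex.ofRealCLM.contDiff.comp
          (contDiff_const.mul contDiff_fst))).cexp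
      exact h2.mul h1
    · simp only [QHM.twist, Fin.mk_one, Matrix.cons_val, ← AddCircle.coe_sub]
      rw [h.quasi, ← mul_assoc (Complex.exp _), ← mul_assoc (Complex.exp _), ← Complex.exp_add,
        ← Complex.exp_add]
      congr 2
      push_cast
      ring
  · refine ⟨contDiff_const.mul h.smooth, fun m x y => ?_⟩
    simp only [QHM.twist, Fin.reduceFinMk, Matrix.cons_val]
    rw [h.quasi]
    ring

end IsSection

/-- A function on `ℝ × 𝕋 × ℤ` supported on a single level. -/
def single (n : ℤ) (φ : ℝ → UnitAddCircle → ℂ) : ℝ → UnitAddCircle → ℤ → ℂ :=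
  fun x y p => if p = n then φ x y else 0

lemma single_mem_schwartz {c : ℕ} {n : ℤ} {φ : ℝ → UnitAddCircle → ℂ} (h : IsSection c n φ) :
    single n φ ∈ schwartz c := by
  have e1 : lift (single n φ) n = fun z : ℝ × ℝ => φ z.1 (z.2 : UnitAddCircle) := by
    funext z; simp [lift, single]
  have e2 : ∀ p, p ≠ n → lift (single n φ) p = fun _ => (0 : ℂ) := fun p hp => by
    funext z; simp [lift, single, hp]
  refine ⟨fun p => ?_, fun m x y p => ?_, fun P k l K hK => ?_⟩
  · by_cases hp : p = n
    · subst hp; rw [e1]; exact h.smooth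
    · rw [e2 p hp]; exact contDiff_const
  · by_cases hp : p = n
    · subst hp; simpa [single] using h.quasi m x y
    · simp [single, hp]
  · have hc : Continuous fun z => P.eval (n : ℂ) * partialDeriv k l (lift (single n φ) n) z := by
      refine continuous_const.mul ?_
      unfold partialDeriv
      rw [e1]
      exact (ContinuousMultilinearMap.apply ℝ (fun _ : Fin (k + l) => ℝ × ℝ) ℂ _).continuous.comp
        (h.smooth.continuous_iteratedFDeriv (by exact_mod_cast le_top))
    obtain ⟨M, hM⟩ := hK.exists_bound_of_continuousOn hc.continuousOn
    refine ⟨max M 0, fun z hz p => ?_⟩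
    by_cases hp : p = n
    · subst hp; exact (hM z hz).trans (le_max_left _ _)
    · have : partialDeriv k l (lift (single n φ) p) z = 0 := by
        unfold partialDeriv
        rw [e2 p hp, iteratedFDeriv_fun_zero]
        rfl
      simp [this]

lemma IsOp.isActionOf_single {ħ μ ν : ℝ} {n : ℤ} {φ : ℝ → UnitAddCircle → ℂ} {T : BH}
    (hT : IsOp ħ μ ν n φ T) : IsActionOf ħ μ ν (single n φ) T := fun ξ => by
  filter_upwards [hT ξ] with z hz
  rw [hz]
  convert hasSum_single n fun q hq => ?_ using 1
  · simp [single, opWeight, opShift]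
  · simp [single, hq]

lemma IsOp.mem_schwartzOps {c : ℕ} {ħ μ ν : ℝ} {n : ℤ} {φ : ℝ → UnitAddCircle → ℂ} {T : BH}
    (hT : IsOp ħ μ ν n φ T) (h : IsSection c n φ) : T ∈ schwartzOps c ħ μ ν :=
  ⟨_, single_mem_schwartz h, hT.isActionOf_single⟩

/-- The operators given by finitely supported elements of `S^c`. -/
def monomialSpan (c : ℕ) (ħ μ ν : ℝ) : Submodule ℂ BH :=
  Submodule.span ℂ {T | ∃ n φ, IsSection c n φ ∧ IsOp ħ μ ν n φ T}

lemma monomialSpan_le_schwartzOps (c : ℕ) (ħ μ ν : ℝ) :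
    monomialSpan c ħ μ ν ≤ schwartzOps c ħ μ ν :=
  Submodule.span_le.2 fun _ ⟨_, _, h, hT⟩ => hT.mem_schwartzOps h

/-! ### Hölder estimates for symbols -/

/-- A Lipschitz bound for small `t` and a trivial bound for large `t` thus give a Hölder bound for
every exponent in `(0, 1]` at once. -/
lemma min_one_le_rpow {t a : ℝ} (ht : 0 < t) (ha : a ∈ Set.Ioc (0 : ℝ) 1) : min t 1 ≤ t ^ a := by
  rcases le_total t 1 with h | h
  · rw [min_eq_left h]
    simpa using Real.rpow_le_rpow_of_exponent_ge ht h ha.2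
  · rw [min_eq_right h]
    exact Real.one_le_rpow h ha.1.le

lemma norm_one_sub_exp_le (a : ℝ) : ‖1 - Complex.exp (Complex.I * (a : ℂ))‖ ≤ |a| := by
  rw [norm_sub_rev]
  exact Real.norm_exp_I_mul_ofReal_sub_one_le

/-- A compact convex neighbourhood of the fundamental domain towards the lower left. -/
def wideDom : Set (ℝ × ℝ) := Set.Icc (-1 : ℝ) (2 * Real.pi) ×ˢ Set.Icc (-1 : ℝ) 1

lemma isCompact_wideDom : IsCompact wideDom := isCompact_Icc.prod isCompact_Icc

lemma fundDom_subset_wideDom : fundDom ⊆ wideDom :=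
  Set.prod_mono (Set.Icc_subset_Icc (by norm_num) le_rfl) (Set.Icc_subset_Icc (by norm_num) le_rfl)

lemma norm_sub_le_of_partial_le {f : ℝ × ℝ → ℂ} (hf : ContDiff ℝ ∞ f) {M : ℝ} (v z : ℝ × ℝ)
    {t : ℝ} (ht : 0 ≤ t) (hM : ∀ s ∈ Set.Icc 0 t, ‖fderiv ℝ f (z - s • v) v‖ ≤ M) :
    ‖f (z - t • v) - f z‖ ≤ M * t := by
  have hd : ∀ s ∈ Set.Icc 0 t,
      HasDerivWithinAt (fun s : ℝ => f (z - s • v)) (-(fderiv ℝ f (z - s • v) v)) (Set.Icc 0 t) s := by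
    intro s _
    have h1 : HasDerivAt (fun s : ℝ => z - s • v) (-v) s := by
      simpa using ((hasDerivAt_id s).smul_const v).const_sub z
    have h2 := ((hf.differentiable (by simp)) (z - s • v)).hasFDerivAt.comp_hasDerivAt s h1
    rw [map_neg] at h2
    exact h2.hasDerivWithinAt
  have h := norm_image_sub_le_of_norm_deriv_le_segment' (C := M) hd
    (fun s hs => by rw [norm_neg]; exact hM s ⟨hs.1, hs.2.le⟩) t ⟨ht, le_rfl⟩
  simpa using h

/-- The difference is again a section, so it suffices to bound it on `fundDom`. For `t ≤ 1` the
segment from the point to its translate stays in `wideDom`, and the mean value inequality applies.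
The phases cost `c|n|t · x` with `x ≤ 2π < 7` for `β`, and `|n|t` for `γ`. For `t ≥ 1` the bound
`2M` is enough. -/
lemma IsSection.norm_sub_twist_le {c : ℕ} {n : ℤ} {φ : ℝ → UnitAddCircle → ℂ}
    (h : IsSection c n φ) {M : ℝ}
    (hM : ∀ z ∈ wideDom, ‖φ z.1 (z.2 : UnitAddCircle)‖ ≤ M ∧
      ‖fderiv ℝ (fun z : ℝ × ℝ => φ z.1 (z.2 : UnitAddCircle)) z (1, 0)‖ ≤ M ∧
      ‖fderiv ℝ (fun z : ℝ × ℝ => φ z.1 (z.2 : UnitAddCircle)) z (0, 1)‖ ≤ M)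
    (i : Fin 3) {t a : ℝ} (ht : 0 < t) (ha : a ∈ Set.Ioc (0 : ℝ) 1) (x : ℝ) (y : UnitAddCircle) :
    ‖φ x y - QHM.twist c n i t φ x y‖ ≤ (3 + (7 * c + 1) * |(n : ℝ)|) * M * t ^ a := by
  have hM0 : 0 ≤ M := (norm_nonneg _).trans
    (hM (0, 0) ⟨⟨by norm_num, by positivity⟩, ⟨by norm_num, by norm_num⟩⟩).1
  have hb := h.norm_le fun z hz => (hM z (fundDom_subset_wideDom hz)).1
  have hb' := (h.twist i t)
  have hK : (3 : ℝ) ≤ 3 + (7 * c + 1) * |(n : ℝ)| := le_add_of_nonneg_right (by positivity)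
  suffices hs : ‖φ x y - QHM.twist c n i t φ x y‖ ≤ (3 + (7 * c + 1) * |(n : ℝ)|) * M * min t 1 from
    hs.trans (mul_le_mul_of_nonneg_left (min_one_le_rpow ht ha) (by positivity))
  rcases le_total 1 t with h1 | h1
  · rw [min_eq_right h1, mul_one]
    have : ‖QHM.twist c n i t φ x y‖ ≤ M := by
      fin_cases i <;> simp only [QHM.twist, Fin.zero_eta, Fin.mk_one, Fin.reduceFinMk, Matrix.cons_val,
        norm_mul, norm_exp_I_mul, one_mul] <;> exact hb _ _
    calc _ ≤ M + M := (norm_sub_le _ _).trans (add_le_add (hb _ _) this)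
      _ ≤ 3 * M := by linarith
      _ ≤ _ := by gcongr
  · rw [min_eq_left h1]
    refine (h.sub (h.twist i t)).norm_le (fun z hz => ?_) x y
    obtain ⟨⟨hz1, hz2⟩, hz3, hz4⟩ := hz
    fin_cases i
    · have h2 := norm_sub_le_of_partial_le h.smooth (M := M) (1, 0) z ht.le fun s hs =>
        (hM _ ⟨⟨by simp; linarith [hs.2], by simp; linarith [hs.1]⟩, by simpa using by linarith,
          by simpa using hz4⟩).2.1
      simp only [Prod.fst_sub, Prod.snd_sub, Prod.smul_fst, Prod.smul_snd, smul_eq_mul, mul_one,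
        mul_zero, sub_zero] at h2
      simp only [QHM.twist, Fin.zero_eta, Matrix.cons_val]
      rw [norm_sub_rev]
      refine h2.trans ?_
      gcongr
      nlinarith
    · have h2 := norm_sub_le_of_partial_le h.smooth (M := M) (0, 1) z ht.le fun s hs =>
        (hM _ ⟨⟨by simpa using by linarith, by simpa using hz2⟩, by simp; linarith [hs.2],
          by simp; linarith [hs.1]⟩).2.2
      simp only [Prod.fst_sub, Prod.snd_sub, Prod.smul_fst, Prod.smul_snd, smul_eq_mul, mul_one,
        mul_zero, sub_zero] at h2
      rw [norm_sub_rev] at h2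
      simp only [QHM.twist, Fin.mk_one, Matrix.cons_val, ← AddCircle.coe_sub]
      set e := Complex.exp (Complex.I * ((c * t * n * z.1 : ℝ) : ℂ))
      have he : ‖1 - e‖ ≤ 7 * c * |(n : ℝ)| * t := by
        refine (norm_one_sub_exp_le _).trans ?_
        rw [abs_mul, abs_mul, abs_mul, Nat.abs_cast, abs_of_pos ht, abs_of_nonneg hz1]
        have : z.1 ≤ 7 := hz2.trans (by linarith [Real.pi_lt_d2])
        calc (c : ℝ) * t * |(n : ℝ)| * z.1 ≤ c * t * |(n : ℝ)| * 7 := by gcongr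
          _ = _ := by ring
      calc _ = ‖(φ z.1 ↑z.2 - φ z.1 ↑(z.2 - t)) + (1 - e) * φ z.1 ↑(z.2 - t)‖ := by
            congr 1; ring
        _ ≤ M * t + (7 * c * |(n : ℝ)| * t) * M := by
            refine (norm_add_le _ _).trans (add_le_add h2 ?_)
            rw [norm_mul]
            exact mul_le_mul he (hb _ _) (norm_nonneg _) (by positivity)
        _ ≤ _ := by nlinarith [mul_nonneg (mul_nonneg (abs_nonneg (n : ℝ)) hM0) ht.le,
            mul_nonneg hM0 ht.le]
    · simp only [QHM.twist, Fin.reduceFinMk, Matrix.cons_val]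
      set e := Complex.exp (Complex.I * ((n * t : ℝ) : ℂ))
      have he : ‖1 - e‖ ≤ |(n : ℝ)| * t := by
        refine (norm_one_sub_exp_le _).trans ?_
        rw [abs_mul, abs_of_pos ht]
      calc _ = ‖(1 - e) * φ z.1 ↑z.2‖ := by
            congr 1; ring
        _ ≤ (|(n : ℝ)| * t) * M := by
            rw [norm_mul]
            exact mul_le_mul he (hb _ _) (norm_nonneg _) (by positivity)
        _ ≤ _ := by
          have h3 : 0 ≤ (c : ℝ) * (|(n : ℝ)| * M * t) := by positivity
          nlinarith [mul_nonneg hM0 ht.le]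

/-! ### The operators given by `S^c` as norm convergent series -/

lemma summable_inv_one_add_sq : Summable fun n : ℤ => ((1 + (n : ℝ) ^ 2)⁻¹ : ℝ) := by
  have h : Summable fun n : ℤ => 1 / (n : ℝ) ^ 2 := Real.summable_one_div_int_pow.2 one_lt_two
  refine Summable.of_norm_bounded_eventually h ?_
  have : {0}ᶜ ∈ (Filter.cofinite : Filter ℤ) := (Set.finite_singleton 0).compl_mem_cofinite
  filter_upwards [this] with n hn
  have hn' : (0 : ℝ) < (n : ℝ) ^ 2 := by
    have : (n : ℝ) ≠ 0 := by exact_mod_cast hn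
    positivity
  rw [Real.norm_of_nonneg (by positivity), one_div]
  exact inv_anti₀ hn' (by linarith)

lemma IsActionOf.unique {ħ μ ν : ℝ} {Φ : ℝ → UnitAddCircle → ℤ → ℂ} {S T : BH}
    (hS : IsActionOf ħ μ ν Φ S) (hT : IsActionOf ħ μ ν Φ T) : S = T := by
  ext1 ξ
  apply Lp.ext
  filter_upwards [hS ξ, hT ξ] with z h1 h2
  exact h1.unique h2

/-- A series in `L²` with rapidly decreasing terms converges almost everywhere to its sum. -/
lemma ae_hasSum_of_norm_le {v : ℤ → Hil} {f : Hil} (hv : HasSum v f) {M : ℝ}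
    (hM : ∀ n : ℤ, ‖v n‖ ≤ M * (1 + (n : ℝ) ^ 2)⁻¹) :
    ∀ᵐ z ∂ptMeasure, HasSum (fun n => v n z) (f z) := by
  have hpos : ∀ n : ℤ, (0 : ℝ) < 1 + (n : ℝ) ^ 2 := fun n => by positivity
  have hM0 : 0 ≤ M := by simpa using (norm_nonneg _).trans (hM 0)
  -- the weighted sum of squares is finite almost everywhere
  have hfin : ∀ᵐ z ∂ptMeasure,
      ∑' n : ℤ, ENNReal.ofReal (1 + (n : ℝ) ^ 2) * ‖v n z‖ₑ ^ (2 : ℝ) < ⊤ := by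
    have hmeas : ∀ n : ℤ, AEMeasurable
        (fun z => ENNReal.ofReal (1 + (n : ℝ) ^ 2) * ‖v n z‖ₑ ^ (2 : ℝ)) ptMeasure := fun n =>
      ((Lp.aestronglyMeasurable (v n)).enorm.pow_const _).const_mul _
    refine ae_lt_top' (AEMeasurable.tsum hmeas) ?_
    rw [lintegral_tsum hmeas]
    have hterm : ∀ n : ℤ, ∫⁻ z, ENNReal.ofReal (1 + (n : ℝ) ^ 2) * ‖v n z‖ₑ ^ (2 : ℝ) ∂ptMeasure ≤
        ENNReal.ofReal (M ^ 2 * (1 + (n : ℝ) ^ 2)⁻¹) := fun n => by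
      rw [lintegral_const_mul' _ _ ENNReal.ofReal_ne_top]
      have e : ∫⁻ z, ‖v n z‖ₑ ^ (2 : ℝ) ∂ptMeasure = ENNReal.ofReal (‖v n‖ ^ 2) := by
        have h1 := eLpNorm_eq_lintegral_rpow_enorm_toReal (p := 2) (μ := ptMeasure)
          (f := fun z => v n z) (by norm_num) (by norm_num)
        have h2 : ENNReal.ofReal ‖v n‖ = eLpNorm (v n) 2 ptMeasure := by
          rw [Lp.norm_def, ENNReal.ofReal_toReal (Lp.eLpNorm_ne_top _)]
        rw [ENNReal.ofReal_pow (norm_nonneg _), h2]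
        simp only [ENNReal.toReal_ofNat] at h1
        rw [h1, ← ENNReal.rpow_natCast, ← ENNReal.rpow_mul]
        norm_num
      rw [e, ← ENNReal.ofReal_mul (hpos n).le]
      refine ENNReal.ofReal_le_ofReal ?_
      calc (1 + (n : ℝ) ^ 2) * ‖v n‖ ^ 2 ≤ (1 + (n : ℝ) ^ 2) * (M * (1 + (n : ℝ) ^ 2)⁻¹) ^ 2 := by
            gcongr; exact hM n
        _ = M ^ 2 * (1 + (n : ℝ) ^ 2)⁻¹ := by
            have := (hpos n).ne'
            field_simp
    refine ne_top_of_le_ne_top ?_ (ENNReal.tsum_le_tsum hterm)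
    rw [← ENNReal.ofReal_tsum_of_nonneg (fun n => mul_nonneg (sq_nonneg _) (inv_nonneg.2 (hpos n).le))
      (summable_inv_one_add_sq.mul_left _)]
    exact ENNReal.ofReal_ne_top
  have hsum : ∀ᵐ z ∂ptMeasure, Summable fun n => v n z := by
    filter_upwards [hfin] with z hz
    have hs : Summable fun n : ℤ => (1 + (n : ℝ) ^ 2) * ‖v n z‖ ^ 2 := by
      have := ENNReal.summable_toReal hz.ne
      refine this.congr fun n => ?_
      rw [ENNReal.toReal_mul, ENNReal.toReal_ofReal (hpos n).le, ← ENNReal.toReal_rpow,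
        toReal_enorm, Real.rpow_two]
    refine Summable.of_norm_bounded (summable_inv_one_add_sq.add hs) fun n => ?_
    have h1 := hpos n
    -- With `w = 1 + n²`, expanding this square gives `2‖v‖ ≤ w⁻¹ + w‖v‖²`, and both terms on the
    -- right are summable.
    have h2 : 0 ≤ (1 + (n : ℝ) ^ 2)⁻¹ * (1 - (1 + (n : ℝ) ^ 2) * ‖v n z‖) ^ 2 := by positivity
    have h3 : (1 + (n : ℝ) ^ 2)⁻¹ * (1 - (1 + (n : ℝ) ^ 2) * ‖v n z‖) ^ 2 =
        (1 + (n : ℝ) ^ 2)⁻¹ - 2 * ‖v n z‖ + (1 + (n : ℝ) ^ 2) * ‖v n z‖ ^ 2 := by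
      field_simp
      ring
    linarith [norm_nonneg (v n z)]
  -- a subsequence of partial sums converges almost everywhere to the sum
  have hpart : Filter.Tendsto (fun N : ℕ => ∑ n ∈ Finset.Icc (-(N : ℤ)) N, v n) Filter.atTop (𝓝 f) :=
    hv.comp Finset.tendsto_Icc_neg
  obtain ⟨k, hk, hk'⟩ := (tendstoInMeasure_of_tendsto_Lp hpart).exists_seq_tendsto_ae
  have hcoe : ∀ᵐ z ∂ptMeasure, ∀ N : ℕ, (∑ n ∈ Finset.Icc (-(N : ℤ)) N, v n : Hil) z =
      ∑ n ∈ Finset.Icc (-(N : ℤ)) N, v n z := by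
    rw [ae_all_iff]
    intro N
    filter_upwards [Lp.coeFn_finsetSum (Finset.Icc (-(N : ℤ)) N) v] with z hz
    rw [hz, Finset.sum_apply]
  filter_upwards [hsum, hk', hcoe] with z h1 h2 h3
  have h4 : Filter.Tendsto (fun j => ∑ n ∈ Finset.Icc (-(k j : ℤ)) (k j), v n z) Filter.atTop
      (𝓝 (∑' n, v n z)) :=
    (h1.hasSum.comp Finset.tendsto_Icc_neg).comp hk.tendsto_atTop
  simp only [h3] at h2
  rw [tendsto_nhds_unique h2 h4]
  exact h1.hasSum

lemma isSection_of_mem_schwartz {c : ℕ} {Φ : ℝ → UnitAddCircle → ℤ → ℂ} (hΦ : Φ ∈ schwartz c)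
    (n : ℤ) : IsSection c n fun x y => Φ x y n :=
  ⟨hΦ.1 n, fun m x y => hΦ.2.1 m x y n⟩

lemma exists_decay_of_mem_schwartz {c : ℕ} {Φ : ℝ → UnitAddCircle → ℤ → ℂ} (hΦ : Φ ∈ schwartz c) :
    ∃ M : ℝ, 0 ≤ M ∧ ∀ n : ℤ, ∀ z ∈ wideDom,
      ‖Φ z.1 (z.2 : UnitAddCircle) n‖ ≤ M * ((1 + (n : ℝ) ^ 2)⁻¹) ^ 2 ∧
      ‖fderiv ℝ (lift Φ n) z (1, 0)‖ ≤ M * ((1 + (n : ℝ) ^ 2)⁻¹) ^ 2 ∧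
      ‖fderiv ℝ (lift Φ n) z (0, 1)‖ ≤ M * ((1 + (n : ℝ) ^ 2)⁻¹) ^ 2 := by
  -- The square provides two factors `(1 + n²)⁻¹`: one absorbs the growth `|n|` of the Hölder
  -- constants, the other makes the series summable.
  obtain ⟨M₁, h₁⟩ := hΦ.2.2 ((1 + Polynomial.X ^ 2) ^ 2) 0 0 _ isCompact_wideDom
  obtain ⟨M₂, h₂⟩ := hΦ.2.2 ((1 + Polynomial.X ^ 2) ^ 2) 1 0 _ isCompact_wideDom
  obtain ⟨M₃, h₃⟩ := hΦ.2.2 ((1 + Polynomial.X ^ 2) ^ 2) 0 1 _ isCompact_wideDom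
  have key : ∀ (n : ℤ) (w : ℂ) (M' : ℝ),
      ‖((1 + Polynomial.X ^ 2) ^ 2 : Polynomial ℂ).eval (n : ℂ) * w‖ ≤ M' →
      M' ≤ max (max M₁ M₂) (max M₃ 0) →
      ‖w‖ ≤ max (max M₁ M₂) (max M₃ 0) * ((1 + (n : ℝ) ^ 2)⁻¹) ^ 2 := by
    intro n w M' h h'
    have e : ‖((1 + Polynomial.X ^ 2) ^ 2 : Polynomial ℂ).eval (n : ℂ)‖ = (1 + (n : ℝ) ^ 2) ^ 2 := by
      have : ((1 + Polynomial.X ^ 2) ^ 2 : Polynomial ℂ).eval (n : ℂ) =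
          (((1 + (n : ℝ) ^ 2) ^ 2 : ℝ) : ℂ) := by simp
      rw [this, Complex.norm_of_nonneg (by positivity)]
    rw [norm_mul, e] at h
    rw [inv_pow, ← div_eq_mul_inv, le_div_iff₀ (by positivity), mul_comm]
    exact h.trans h'
  refine ⟨max (max M₁ M₂) (max M₃ 0), (le_max_right _ _).trans (le_max_right _ _),
    fun n z hz => ⟨key n _ M₁ ?_ ((le_max_left _ _).trans (le_max_left _ _)),
      key n _ M₂ ?_ ((le_max_right _ _).trans (le_max_left _ _)),
      key n _ M₃ ?_ ((le_max_left _ _).trans (le_max_right _ _))⟩⟩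
  · simpa [partialDeriv, lift] using h₁ z hz n
  · simpa [partialDeriv, iteratedFDeriv_one_apply] using h₂ z hz n
  · have e : partialDeriv 0 1 (lift Φ n) z = fderiv ℝ (lift Φ n) z (0, 1) := by
      unfold partialDeriv
      exact iteratedFDeriv_one_apply _
    rw [← e]
    exact h₃ z hz n

/-- The monomials have norm at most `M / (1 + n²)`, so they are summable in operator norm, and the
sum acts pointwise almost everywhere by `ae_hasSum_of_norm_le`. The Hölder constants of the
monomials are summable too, uniformly in the exponent `a`. -/
lemma exists_series_of_mem_schwartz {c : ℕ} (ħ μ ν : ℝ) {Φ : ℝ → UnitAddCircle → ℤ → ℂ}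
    (hΦ : Φ ∈ schwartz c) :
    ∃ (T : BH) (S : ℤ → BH), IsActionOf ħ μ ν Φ T ∧
      (∀ n, IsOp ħ μ ν n (fun x y => Φ x y n) (S n)) ∧ HasSum S T ∧
      ∃ K, 0 ≤ K ∧ ∀ (i : Fin 3) (t a : ℝ), 0 < t → a ∈ Set.Ioc (0 : ℝ) 1 →
        ‖T - act c ħ μ i t T‖ ≤ K * t ^ a := by
  obtain ⟨M, hM0, hM⟩ := exists_decay_of_mem_schwartz hΦ
  have hsec := isSection_of_mem_schwartz hΦ
  choose S hS using fun n => (hsec n).exists_isOp ħ μ ν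
  have hpos : ∀ n : ℤ, (0 : ℝ) < 1 + (n : ℝ) ^ 2 := fun n => by positivity
  have hle1 : ∀ n : ℤ, (1 + (n : ℝ) ^ 2)⁻¹ ≤ 1 := fun n =>
    inv_le_one_of_one_le₀ (by nlinarith [sq_nonneg (n : ℝ)])
  have hSn : ∀ n, ‖S n‖ ≤ M * (1 + (n : ℝ) ^ 2)⁻¹ := fun n =>
    ((hS n).norm_le ((hsec n).norm_le fun z hz => (hM n z (fundDom_subset_wideDom hz)).1)).trans <| by
      rw [sq]
      exact mul_le_mul_of_nonneg_left (mul_le_of_le_one_left (inv_nonneg.2 (hpos n).le) (hle1 n)) hM0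
  have hsum : Summable S :=
    Summable.of_norm_bounded (summable_inv_one_add_sq.mul_left M) hSn
  have hdiff : ∀ (n : ℤ) (i : Fin 3) (t a : ℝ), 0 < t → a ∈ Set.Ioc (0 : ℝ) 1 →
      ‖S n - act c ħ μ i t (S n)‖ ≤ (10 + 7 * c) * M * t ^ a * (1 + (n : ℝ) ^ 2)⁻¹ := by
    intro n i t a ht ha
    have h1 := ((hS n).sub ((hS n).act (c := c) i t)).norm_le
      (fun x y => (hsec n).norm_sub_twist_le (hM n) i ht ha x y)
    refine h1.trans ?_
    have h2 : 3 + (7 * c + 1) * |(n : ℝ)| ≤ (10 + 7 * c) * (1 + (n : ℝ) ^ 2) := by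
      have : |(n : ℝ)| ≤ 1 + (n : ℝ) ^ 2 := by
        nlinarith [sq_abs (n : ℝ), sq_nonneg (|(n : ℝ)| - 1), abs_nonneg (n : ℝ)]
      have h3 : (0 : ℝ) ≤ c := Nat.cast_nonneg c
      nlinarith [mul_le_mul_of_nonneg_left this h3, sq_nonneg (n : ℝ)]
    have hp := Real.rpow_pos_of_pos ht a
    calc _ ≤ ((10 + 7 * c) * (1 + (n : ℝ) ^ 2)) * (M * ((1 + (n : ℝ) ^ 2)⁻¹) ^ 2) * t ^ a := by
          gcongr
      _ = _ := by
          have := (hpos n).ne'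
          field_simp
  refine ⟨∑' n, S n, S, fun ξ => ?_, hS, hsum.hasSum,
    (10 + 7 * c) * M * ∑' n : ℤ, (1 + (n : ℝ) ^ 2)⁻¹, ?_, fun i t a ht ha => ?_⟩
  · have h1 : HasSum (fun n => S n ξ) ((∑' n, S n) ξ) :=
      (ContinuousLinearMap.apply ℂ Hil ξ).hasSum hsum.hasSum
    have h2 := ae_hasSum_of_norm_le h1 (M := M * ‖ξ‖) fun n => by
      refine ((S n).le_of_opNorm_le (hSn n) ξ).trans (le_of_eq (by ring))
    have h3 : ∀ᵐ z ∂ptMeasure, ∀ n, S n ξ z = opWeight ħ μ ν n (fun x y => Φ x y n) z *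
        ξ (opShift n z) := ae_all_iff.2 fun n => hS n ξ
    filter_upwards [h2, h3] with z h4 h5
    simp only [h5] at h4
    exact h4
  · exact mul_nonneg (mul_nonneg (by positivity) hM0)
      (tsum_nonneg fun n => inv_nonneg.2 (hpos n).le)
  · have h1 : HasSum (fun n => S n - act c ħ μ i t (S n))
        (∑' n, S n - act c ħ μ i t (∑' n, S n)) :=
      hsum.hasSum.sub ((actL c ħ μ i t).hasSum hsum.hasSum)
    have h2 := tsum_of_norm_bounded (summable_inv_one_add_sq.hasSum.mul_left
      ((10 + 7 * c) * M * t ^ a)) fun n => hdiff n i t a ht ha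
    rw [h1.tsum_eq] at h2
    exact h2.trans (le_of_eq (by ring))

lemma schwartzOps_le_closure_monomialSpan (c : ℕ) (ħ μ ν : ℝ) :
    schwartzOps c ħ μ ν ≤ (monomialSpan c ħ μ ν).topologicalClosure := by
  rintro T ⟨Φ, hΦ, hT⟩
  obtain ⟨T', S, hT', hS, hsum, -⟩ := exists_series_of_mem_schwartz ħ μ ν hΦ
  rw [hT.unique hT']
  exact mem_closure_of_tendsto hsum (Filter.Eventually.of_forall fun s => sum_mem fun n _ =>
    Submodule.subset_span ⟨n, _, isSection_of_mem_schwartz hΦ n, hS n⟩)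

/-! ### The von Neumann algebra `N_ħ` -/

/-- The matrix coefficients of `S A T` are matrix coefficients of `A`, at `T ξ` and `y ∘ S`. -/
lemma continuous_wot_mul_mul (S T : BH) :
    Continuous fun A : Hil →WOT[ℂ] Hil => ContinuousLinearMapWOT.ofCLM (S * A.toCLM * T) := by
  refine ContinuousLinearMapWOT.continuous_of_dual_apply_continuous fun ξ y => ?_
  exact ContinuousLinearMapWOT.continuous_dual_apply (σ := RingHom.id ℂ) (T ξ) (y.comp S)

lemma schwartzOps_le_N (c : ℕ) (ħ μ ν : ℝ) : schwartzOps c ħ μ ν ≤ N c ħ μ ν := fun _ hT =>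
  Submodule.le_topologicalClosure _ (Submodule.mem_map_of_mem hT)

lemma isClosed_wot_N (c : ℕ) (ħ μ ν : ℝ) :
    IsClosed {A : Hil →WOT[ℂ] Hil | A.toCLM ∈ N c ħ μ ν} :=
  Submodule.isClosed_topologicalClosure _

lemma isClosed_N (c : ℕ) (ħ μ ν : ℝ) : IsClosed (N c ħ μ ν : Set BH) :=
  (isClosed_wot_N c ħ μ ν).preimage
    (ContinuousLinearMap.WOTofCLM : BH →L[ℂ] (Hil →WOT[ℂ] Hil)).continuous

lemma IsOp.mem_N {c : ℕ} {ħ μ ν : ℝ} {n : ℤ} {φ : ℝ → UnitAddCircle → ℂ} {T : BH}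
    (hT : IsOp ħ μ ν n φ T) (h : IsSection c n φ) : T ∈ N c ħ μ ν :=
  schwartzOps_le_N c ħ μ ν (hT.mem_schwartzOps h)

/-- This is the induction principle for `N`. A weakly closed subspace is norm closed, so once it
contains the monomials it contains `S^c`, and then the weak closure. -/
lemma N_le {c : ℕ} {ħ μ ν : ℝ} {V : Submodule ℂ BH}
    (hV : IsClosed {A : Hil →WOT[ℂ] Hil | A.toCLM ∈ V})
    (h : ∀ n φ T, IsSection c n φ → IsOp ħ μ ν n φ T → T ∈ V) : N c ħ μ ν ≤ V := by
  have hV' : IsClosed (V : Set BH) :=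
    hV.preimage (ContinuousLinearMap.WOTofCLM : BH →L[ℂ] (Hil →WOT[ℂ] Hil)).continuous
  have h1 : monomialSpan c ħ μ ν ≤ V :=
    Submodule.span_le.2 fun T ⟨n, φ, hφ, hT⟩ => h n φ T hφ hT
  have h2 : schwartzOps c ħ μ ν ≤ V :=
    (schwartzOps_le_closure_monomialSpan c ħ μ ν).trans
      (Submodule.topologicalClosure_minimal _ h1 hV')
  intro T hT
  refine closure_minimal (t := {A : Hil →WOT[ℂ] Hil | A.toCLM ∈ V}) ?_ hV hT
  rintro _ ⟨S, hS, rfl⟩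
  exact h2 hS

lemma mul_mul_mem_N {c : ℕ} {ħ μ ν : ℝ} {S T : BH}
    (h : ∀ n φ X, IsSection c n φ → IsOp ħ μ ν n φ X → S * X * T ∈ N c ħ μ ν) {X : BH}
    (hX : X ∈ N c ħ μ ν) : S * X * T ∈ N c ħ μ ν := by
  let V : Submodule ℂ BH := (N c ħ μ ν).comap
    ((LinearMap.mulRight ℂ T).comp (LinearMap.mulLeft ℂ S))
  have hV : IsClosed {A : Hil →WOT[ℂ] Hil | A.toCLM ∈ V} :=
    (isClosed_wot_N c ħ μ ν).preimage (continuous_wot_mul_mul S T)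
  exact N_le hV h hX

lemma act_mem_N {c : ℕ} {ħ μ ν : ℝ} {T : BH} (hT : T ∈ N c ħ μ ν) (i : Fin 3) (t : ℝ) :
    act c ħ μ i t T ∈ N c ħ μ ν := by
  rw [act_eq]
  refine mul_mul_mem_N (fun n φ X hφ hX => ?_) hT
  rw [← act_eq]
  exact (hX.act i t).mem_N (hφ.twist i t)

/-- Multiplication is only separately continuous for the weak operator topology, so the closure is
taken in one factor at a time: first `T` with a monomial on its left, then `S` with `T` fixed. -/
lemma mul_mem_N {c : ℕ} {ħ μ ν : ℝ} {S T : BH} (hS : S ∈ N c ħ μ ν) (hT : T ∈ N c ħ μ ν) :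
    S * T ∈ N c ħ μ ν := by
  have h : ∀ n φ X, IsSection c n φ → IsOp ħ μ ν n φ X → X * T ∈ N c ħ μ ν :=
    fun n φ X hφ hX => by
      have := mul_mul_mem_N (S := X) (T := 1) (fun m ψ Y hψ hY => by
        rw [mul_one]
        exact (hX.mul hY).mem_N (hφ.symbolMul hψ ħ μ ν)) hT
      rwa [mul_one] at this
  have := mul_mul_mem_N (S := 1) (T := T) (fun n φ X hφ hX => by
    rw [one_mul]; exact h n φ X hφ hX) hS
  rwa [one_mul] at this

/-- An operator which commutes with the monomial operators commutes with `N_ħ`. -/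
lemma commute_of_mem_N {c : ℕ} {ħ μ ν : ℝ} {R : BH}
    (h : ∀ n φ X, IsSection c n φ → IsOp ħ μ ν n φ X → R * X = X * R) {X : BH}
    (hX : X ∈ N c ħ μ ν) : R * X = X * R := by
  let V : Submodule ℂ BH := LinearMap.ker (LinearMap.mulLeft ℂ R - LinearMap.mulRight ℂ R)
  have hV' : ∀ X, X ∈ V ↔ R * X = X * R := fun X => by
    simp [V, LinearMap.mem_ker, sub_eq_zero]
  have hV : IsClosed {A : Hil →WOT[ℂ] Hil | A.toCLM ∈ V} := by
    have h1 := continuous_wot_mul_mul R 1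
    have h2 := continuous_wot_mul_mul 1 R
    simp only [mul_one, one_mul] at h1 h2
    simp only [hV']
    have := isClosed_eq h1 h2
    convert this using 3
    exact ContinuousLinearMapWOT.ofCLM_injective.eq_iff.symm
  exact (hV' X).1 (N_le hV (fun n φ X hφ hX => (hV' X).2 (h n φ X hφ hX)) hX)

/-! ### Elements of `S^c` are Hölder -/

lemma schwartz_mem_holder {c : ℕ} {ħ μ ν A B C : ℝ} (hA : A ∈ Set.Ioc (0 : ℝ) 1)
    (hB : B ∈ Set.Ioc (0 : ℝ) 1) (hC : C ∈ Set.Ioc (0 : ℝ) 1)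
    {Φ : ℝ → UnitAddCircle → ℤ → ℂ} (hΦ : Φ ∈ schwartz c) :
    ∃ T ∈ holder c ħ μ ν A B C, IsActionOf ħ μ ν Φ T := by
  obtain ⟨T, S, hT, -, -, K, hK0, hK⟩ := exists_series_of_mem_schwartz ħ μ ν hΦ
  refine ⟨T, ⟨schwartzOps_le_N c ħ μ ν ⟨Φ, hΦ, hT⟩, K, (isHolderConst_iff ..).2 ⟨hK0, ?_⟩⟩, hT⟩
  intro i t ht
  refine hK i t _ ht ?_
  fin_cases i <;> assumption

lemma schwartzOps_le_holder {c : ℕ} {ħ μ ν A B C : ℝ} (hA : A ∈ Set.Ioc (0 : ℝ) 1)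
    (hB : B ∈ Set.Ioc (0 : ℝ) 1) (hC : C ∈ Set.Ioc (0 : ℝ) 1) :
    schwartzOps c ħ μ ν ≤ holder c ħ μ ν A B C := by
  rintro T ⟨Φ, hΦ, hT⟩
  obtain ⟨T', hT', h⟩ := schwartz_mem_holder (ħ := ħ) (μ := μ) (ν := ν) hA hB hC hΦ
  rwa [hT.unique h]

/-! ### Multiplication operators -/

instance : SigmaFinite ptMeasure := by unfold ptMeasure; infer_instance

/-- A property holds almost everywhere on `ℝ × 𝕋 × ℤ` iff it does so on every level. -/
lemma ae_pt_iff {Q : Pt → Prop} :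
    (∀ᵐ z ∂ptMeasure, Q z) ↔ ∀ p : ℤ, ∀ᵐ w : ℝ × UnitAddCircle, Q (w.1, w.2, p) := by
  have h : ptMeasure = Measure.sum fun p : ℤ =>
      (volume : Measure (ℝ × UnitAddCircle)).map fun w => (w.1, w.2, p) := by
    unfold ptMeasure
    rw [Measure.count, Measure.prod_sum_right, Measure.prod_sum_right]
    congr 1
    funext p
    rw [Measure.prod_dirac, Measure.volume_eq_prod]
    have := Measure.map_prod_map (volume : Measure ℝ) (volume : Measure UnitAddCircle)
      measurable_id (measurable_prodMk_right (y := p))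
    rw [Measure.map_id] at this
    exact this
  have he : ∀ p : ℤ, MeasurableEmbedding fun w : ℝ × UnitAddCircle => ((w.1, w.2, p) : Pt) :=
    fun p => (MeasurableEquiv.prodAssoc (α := ℝ) (β := UnitAddCircle) (γ := ℤ)).measurableEmbedding.comp
      (measurableEmbedding_prod_mk_right p)
  rw [h, Measure.ae_sum_iff]
  exact forall_congr' fun p => (he p).ae_map_iff

/-- A strictly positive square integrable function. -/
lemma exists_pos_memLp : ∃ f : Pt → ℝ, (∀ z, 0 < f z) ∧ Measurable f ∧
    MemLp (fun z => (f z : ℂ)) 2 ptMeasure := by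
  obtain ⟨g, h0, hm, hlt⟩ := exists_pos_lintegral_lt_of_sigmaFinite ptMeasure one_ne_zero
  refine ⟨fun z => Real.sqrt (g z), fun z => Real.sqrt_pos.2 (h0 z),
    hm.coe_nnreal_real.sqrt, ?_⟩
  have hmeas : Measurable fun z => ((Real.sqrt (g z) : ℝ) : ℂ) :=
    Complex.measurable_ofReal.comp hm.coe_nnreal_real.sqrt
  refine ⟨hmeas.aestronglyMeasurable, ?_⟩
  rw [eLpNorm_lt_top_iff_lintegral_rpow_enorm_lt_top (by norm_num) (by norm_num)]
  refine lt_of_le_of_lt (le_of_eq (lintegral_congr fun z => ?_)) (hlt.trans ENNReal.one_lt_top)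
  have : ‖((Real.sqrt (g z) : ℝ) : ℂ)‖ₑ = ENNReal.ofReal (Real.sqrt (g z)) := by
    rw [← ofReal_norm, Complex.norm_of_nonneg (Real.sqrt_nonneg _)]
  rw [this, ENNReal.toReal_ofNat, ENNReal.rpow_ofNat, ← ENNReal.ofReal_pow (Real.sqrt_nonneg _),
    Real.sq_sqrt (NNReal.coe_nonneg _), ENNReal.ofReal_coe_nnreal]

/-- The weight of a weighted composition operator is determined by the operator. -/
lemma IsWC.weight_unique {w w' : Pt → ℂ} {τ : Pt → Pt} {T : BH} (h : IsWC w τ T)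
    (h' : IsWC w' τ T) (hτ : MeasurePreserving τ ptMeasure ptMeasure) :
    ∀ᵐ z ∂ptMeasure, w z = w' z := by
  obtain ⟨f, hf0, -, hf⟩ := exists_pos_memLp
  filter_upwards [h (hf.toLp _), h' (hf.toLp _), hτ.quasiMeasurePreserving.ae hf.coeFn_toLp]
    with z h1 h2 h3
  rw [h1, h3] at h2
  exact mul_right_cancel₀ (by exact_mod_cast (hf0 (τ z)).ne') h2

/-- If `‖G‖ ≥ b > ‖Z‖` on a set `E`, then `ξ = 1_E f` satisfies `b‖ξ‖ ≤ ‖Z ξ‖ ≤ ‖Z‖‖ξ‖`. So `ξ = 0`,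
and `E` is null because `f > 0`. Only vectors of the form `R f` enter, so the bound is available
before `Z` is known to be a multiplication operator. -/
lemma norm_weight_le_of_apply {Z : BH} {G : Pt → ℂ} (hG : Measurable G) {f : Pt → ℝ}
    (hf0 : ∀ z, 0 < f z) (hf : MemLp (fun z => (f z : ℂ)) 2 ptMeasure)
    (h : ∀ (k : Pt → ℂ) (R : BH), Measurable k → (∀ z, ‖k z‖ ≤ 1) → IsWC k id R →
      ∀ᵐ z ∂ptMeasure, Z (R (hf.toLp _)) z = G z * R (hf.toLp _) z) :
    ∀ᵐ z ∂ptMeasure, ‖G z‖ ≤ ‖Z‖ := by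
  have key : ∀ j : ℕ, ∀ᵐ z ∂ptMeasure, ‖G z‖ < ‖Z‖ + 1 / ((j : ℝ) + 1) := by
    intro j
    set b : ℝ := ‖Z‖ + 1 / ((j : ℝ) + 1) with hb
    have hb0 : 0 < b := by positivity
    let E : Set Pt := {z | b ≤ ‖G z‖}
    have hE : MeasurableSet E := measurableSet_le measurable_const hG.norm
    have hk1 : ∀ z, ‖E.indicator (fun _ => (1 : ℂ)) z‖ ≤ 1 := fun z => by
      by_cases hz : z ∈ E <;> simp [hz]
    have hk : Measurable (E.indicator fun _ => (1 : ℂ)) := measurable_const.indicator hE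
    obtain ⟨R, hR⟩ := exists_isWC hk (MeasurePreserving.id ptMeasure)
      (Filter.Eventually.of_forall hk1)
    have h1 := h _ R hk hk1 hR
    set ξ := R (hf.toLp _) with hξ
    have hξz : ∀ᵐ z ∂ptMeasure, ξ z = E.indicator (fun _ => (1 : ℂ)) z * f z := by
      filter_upwards [hR (hf.toLp _), hf.coeFn_toLp] with z h2 h3
      rw [h2, id, h3]
    have h2 : ‖ξ‖ ≤ b⁻¹ * ‖Z ξ‖ := by
      refine Lp.norm_le_mul_norm_of_ae_le_mul ?_
      filter_upwards [h1, hξz] with z h3 h4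
      rw [h3, norm_mul]
      by_cases hz : z ∈ E
      · rw [← mul_assoc]
        refine le_mul_of_one_le_left (norm_nonneg _) ?_
        rw [inv_mul_eq_div, one_le_div hb0]
        exact hz
      · rw [h4]
        simp [hz]
    have h3 : ξ = 0 := by
      rw [← norm_eq_zero]
      by_contra hne
      have hpos : 0 < ‖ξ‖ := lt_of_le_of_ne (norm_nonneg _) (Ne.symm hne)
      rw [inv_mul_eq_div, le_div_iff₀ hb0] at h2
      have h4 := h2.trans (Z.le_opNorm ξ)
      have h5 : (0 : ℝ) < 1 / ((j : ℝ) + 1) := by positivity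
      nlinarith
    rw [h3] at hξz
    filter_upwards [hξz, Lp.coeFn_zero ℂ 2 ptMeasure] with z h4 h5
    by_contra hz
    have hzE : z ∈ E := not_lt.1 hz
    rw [h5] at h4
    simp [hzE] at h4
    exact (hf0 z).ne (by exact_mod_cast h4)
  filter_upwards [ae_all_iff.2 key] with z hz
  refine le_of_forall_pos_lt_add fun ε hε => ?_
  obtain ⟨j, hj⟩ := exists_nat_one_div_lt hε
  exact (hz j).trans (by linarith)

lemma IsWC.norm_weight_le {Z : BH} {G : Pt → ℂ} (hG : Measurable G) (hZ : IsWC G id Z) :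
    ∀ᵐ z ∂ptMeasure, ‖G z‖ ≤ ‖Z‖ := by
  obtain ⟨f, hf0, -, hf⟩ := exists_pos_memLp
  exact norm_weight_le_of_apply hG hf0 hf fun k R _ _ _ => hZ _

/-- The kernel is closed, and the hypothesis says that its orthogonal complement is trivial. -/
lemma eq_zero_of_forall_mem_ker {X : BH} {S : Set Hil} (hS : ∀ ξ ∈ S, X ξ = 0)
    (h : ∀ η : Hil, (∀ ξ ∈ S, inner ℂ ξ η = 0) → η = 0) : X = 0 := by
  have hc : IsClosed (X.ker : Set Hil) := X.isClosed_ker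
  have : CompleteSpace X.ker := hc.completeSpace_coe
  have h1 : (X.ker : Submodule ℂ Hil)ᗮ = ⊥ := by
    rw [eq_bot_iff]
    intro η hη
    exact h η fun ξ hξ => (Submodule.mem_orthogonal _ _).1 hη ξ (hS ξ hξ)
  have h2 : (X.ker : Submodule ℂ Hil) = ⊤ := (Submodule.orthogonal_eq_bot_iff).1 h1
  ext1 ξ
  have : ξ ∈ (X.ker : Submodule ℂ Hil) := h2 ▸ Submodule.mem_top
  exact this

/-- An operator on `L²` which commutes with all bounded multiplication operators is itself a
multiplication operator. -/
lemma exists_weight_of_commute {Z : BH}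
    (h : ∀ (k : Pt → ℂ) (R : BH), Measurable k → (∀ z, ‖k z‖ ≤ 1) → IsWC k id R →
      Z * R = R * Z) :
    ∃ G : Pt → ℂ, Measurable G ∧ (∀ z, ‖G z‖ ≤ ‖Z‖) ∧ IsWC G id Z := by
  obtain ⟨f, hf0, hfm, hf⟩ := exists_pos_memLp
  -- The weight is read off from the strictly positive vector `f`, whose multiples by bounded
  -- functions span a dense subspace.
  let G₀ : Pt → ℂ := fun z => Z (hf.toLp _) z / f z
  have hG₀ : Measurable G₀ :=
    (Lp.stronglyMeasurable (Z (hf.toLp _))).measurable.div (Complex.measurable_ofReal.comp hfm)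
  have happ : ∀ (k : Pt → ℂ) (R : BH), Measurable k → (∀ z, ‖k z‖ ≤ 1) → IsWC k id R →
      ∀ᵐ z ∂ptMeasure, Z (R (hf.toLp _)) z = G₀ z * R (hf.toLp _) z := by
    intro k R hk hk1 hR
    have h1 : Z (R (hf.toLp _)) = R (Z (hf.toLp _)) := by
      rw [← mul_apply_eq_comp, h k R hk hk1 hR, mul_apply_eq_comp]
    rw [h1]
    filter_upwards [hR (Z (hf.toLp _)), hR (hf.toLp _), hf.coeFn_toLp] with z h2 h3 h4
    rw [h2, h3, id, h4]
    have : (f z : ℂ) ≠ 0 := by exact_mod_cast (hf0 z).ne'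
    simp only [G₀]
    field_simp
  have hbd := norm_weight_le_of_apply hG₀ hf0 hf happ
  -- Truncation turns the almost everywhere bound into one valid at every point.
  let E : Set Pt := {z | ‖G₀ z‖ ≤ ‖Z‖}
  have hE : MeasurableSet E := measurableSet_le hG₀.norm measurable_const
  have hG1 : ∀ z, ‖E.indicator G₀ z‖ ≤ ‖Z‖ := fun z => by
    by_cases hz : z ∈ E
    · rw [Set.indicator_of_mem hz]; exact hz
    · rw [Set.indicator_of_notMem hz, norm_zero]; exact norm_nonneg _
  have hG : Measurable (E.indicator G₀) := hG₀.indicator hE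
  have hGG : ∀ᵐ z ∂ptMeasure, E.indicator G₀ z = G₀ z := by
    filter_upwards [hbd] with z hz
    exact Set.indicator_of_mem (s := E) hz G₀
  refine ⟨_, hG, hG1, ?_⟩
  obtain ⟨Z', hZ'⟩ := exists_isWC hG (MeasurePreserving.id ptMeasure)
    (Filter.Eventually.of_forall hG1)
  suffices hs : Z - Z' = 0 by rwa [sub_eq_zero.1 hs]
  refine eq_zero_of_forall_mem_ker (S := {ξ | ∃ (k : Pt → ℂ) (R : BH), Measurable k ∧
    (∀ z, ‖k z‖ ≤ 1) ∧ IsWC k id R ∧ ξ = R (hf.toLp _)}) ?_ ?_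
  · rintro _ ⟨k, R, hk, hk1, hR, rfl⟩
    rw [_root_.sub_apply, sub_eq_zero]
    apply Lp.ext
    filter_upwards [happ k R hk hk1 hR, hZ' (R (hf.toLp _)), hGG] with z h1 h2 h3
    rw [h1, h2, h3, id]
  · intro η hη
    -- With this phase `⟨k f, η⟩ = ∫ f ‖η‖`, which vanishes only if `η = 0`.
    let k : Pt → ℂ := fun z => η z / (‖η z‖ : ℂ)
    have hηm : Measurable η := (Lp.stronglyMeasurable η).measurable
    have hk : Measurable k := hηm.div (Complex.measurable_ofReal.comp hηm.norm)
    have hk1 : ∀ z, ‖k z‖ ≤ 1 := fun z => by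
      simp only [k, norm_div, Complex.norm_real, norm_norm]
      exact div_self_le_one _
    obtain ⟨R, hR⟩ := exists_isWC hk (MeasurePreserving.id ptMeasure)
      (Filter.Eventually.of_forall hk1)
    have h0 := hη _ ⟨k, R, hk, hk1, hR, rfl⟩
    rw [L2.inner_def] at h0
    have hae : ∀ᵐ z ∂ptMeasure, inner ℂ (R (hf.toLp _) z) (η z) = ((f z * ‖η z‖ : ℝ) : ℂ) := by
      filter_upwards [hR (hf.toLp _), hf.coeFn_toLp] with z h2 h3
      rw [h2, id, h3]
      by_cases hz : η z = 0
      · simp [hz]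
      · have hz' : (‖η z‖ : ℂ) ≠ 0 := by simpa using hz
        simp only [k, RCLike.inner_apply, map_mul, map_div₀, Complex.conj_ofReal]
        have : η z * (starRingEnd ℂ) (η z) = (‖η z‖ : ℂ) ^ 2 := Complex.mul_conj' _
        field_simp
        rw [this]
        push_cast
        ring
    have hint := (L2.integrable_inner (𝕜 := ℂ) (R (hf.toLp _)) η).congr hae
    rw [integral_congr_ae hae, integral_complex_ofReal, Complex.ofReal_eq_zero] at h0
    have hint' : Integrable (fun z => f z * ‖η z‖) ptMeasure := by
      simpa using hint.re
    rw [integral_eq_zero_iff_of_nonneg (fun z => mul_nonneg (hf0 z).le (norm_nonneg _)) hint'] at h0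
    apply Lp.ext
    filter_upwards [h0, Lp.coeFn_zero ℂ 2 ptMeasure] with z h2 h3
    rw [h3]
    have := (mul_eq_zero.1 h2).resolve_left (hf0 z).ne'
    simpa using this

/-! ### Elements of `N_ħ` of a given degree -/

lemma measurable_level {α : Type*} [MeasurableSpace α] (f : ℤ → α) :
    Measurable fun z : Pt => f z.2.2 :=
  (measurable_of_countable f).comp (measurable_snd.comp measurable_snd)

/-- The indicator function of a level. -/
def levelInd (q : ℤ) (z : Pt) : ℂ := if z.2.2 = q then 1 else 0

lemma measurable_levelInd (q : ℤ) : Measurable (levelInd q) :=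
  measurable_level fun p => if p = q then (1 : ℂ) else 0

lemma norm_levelInd_le (q : ℤ) (z : Pt) : ‖levelInd q z‖ ≤ 1 := by
  unfold levelInd
  split_ifs <;> simp

lemma exists_level (q : ℤ) : ∃ P : BH, IsWC (levelInd q) id P :=
  exists_isWC (measurable_levelInd q) (MeasurePreserving.id _)
    (Filter.Eventually.of_forall (norm_levelInd_le q))

/-- The projection onto a level. -/
def level (q : ℤ) : BH := (exists_level q).choose

lemma isWC_level (q : ℤ) : IsWC (levelInd q) id (level q) := (exists_level q).choose_spec

lemma eq_zero_of_level {η : Hil} (h : ∀ q, level q η = 0) : η = 0 := by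
  have h1 : ∀ᵐ z ∂ptMeasure, ∀ q, level q η z = levelInd q z * η z :=
    ae_all_iff.2 fun q => isWC_level q η
  apply Lp.ext
  filter_upwards [h1, Lp.coeFn_zero ℂ 2 ptMeasure] with z h2 h3
  have h4 := h2 z.2.2
  rw [h, h3] at h4
  rw [h3]
  simpa [levelInd] using h4.symm

lemma isWC_mul_id {k l : Pt → ℂ} {R S : BH} (hR : IsWC k id R) (hS : IsWC l id S) :
    IsWC (fun z => k z * l z) id (R * S) :=
  hR.mul hS (MeasurePreserving.id _)

lemma commute_id {k l : Pt → ℂ} {R S : BH} (hR : IsWC k id R) (hS : IsWC l id S) :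
    R * S = S * R :=
  (isWC_mul_id hR hS).unique (by simpa only [mul_comm] using isWC_mul_id hS hR)

lemma level_mul_level (q : ℤ) : level q * level q = level q := by
  refine (isWC_mul_id (isWC_level q) (isWC_level q)).unique ((isWC_level q).congr ?_)
  refine Filter.Eventually.of_forall fun z => ?_
  simp [levelInd]

lemma level_mul_level_of_ne {q r : ℤ} (h : q ≠ r) : level q * level r = 0 := by
  refine (isWC_mul_id (isWC_level q) (isWC_level r)).unique fun ξ => ?_
  filter_upwards [Lp.coeFn_zero ℂ 2 ptMeasure] with z hz
  rw [_root_.zero_apply, hz]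
  by_cases h1 : z.2.2 = q
  · have : z.2.2 ≠ r := fun h2 => h (h1.symm.trans h2)
    simp [levelInd, this]
  · simp [levelInd, h1]

lemma eq_of_level_mul {X Y : BH} (h : ∀ q, level q * X = level q * Y) : X = Y := by
  rw [← sub_eq_zero]
  ext1 ξ
  refine eq_zero_of_level fun q => ?_
  have := congrArg (fun T : BH => T ξ) (h q)
  simpa [sub_eq_zero] using this

lemma eq_zero_of_mul_level {X : BH} (h : ∀ q, X * level q = 0) : X = 0 := by
  refine eq_zero_of_forall_mem_ker (S := {ξ | ∃ q η, ξ = level q η}) ?_ ?_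
  · rintro _ ⟨q, η, rfl⟩
    rw [← mul_apply_eq_comp, h q, _root_.zero_apply]
  · intro η hη
    refine eq_zero_of_level fun q => ?_
    rw [← inner_self_eq_zero (𝕜 := ℂ), ← hη _ ⟨q, η, rfl⟩, L2.inner_def, L2.inner_def]
    refine integral_congr_ae ?_
    filter_upwards [isWC_level q η] with z hz
    rw [hz, id]
    by_cases h1 : z.2.2 = q <;> simp [levelInd, h1]

lemma isWC_central (c : ℕ) (ħ μ t : ℝ) :
    IsWC (fun z => Complex.exp (Complex.I * ((z.2.2 * t : ℝ) : ℂ))) id (oneParam c ħ μ 2 t) := by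
  have h := isWC_oneParam c ħ μ 2 t
  have h1 : oneParamShift 2 t = id := by
    funext z; simp [oneParamShift, shift]
  rw [h1] at h
  refine h.congr (Filter.Eventually.of_forall fun z => ?_)
  simp [oneParamPhase, phase]

lemma central_mul_level (c : ℕ) (ħ μ t : ℝ) (q : ℤ) :
    oneParam c ħ μ 2 t * level q =
      Complex.exp (Complex.I * ((q * t : ℝ) : ℂ)) • level q := by
  refine (isWC_mul_id (isWC_central c ħ μ t) (isWC_level q)).unique
    (((isWC_level q).smul _).congr (Filter.Eventually.of_forall fun z => ?_))
  by_cases h1 : z.2.2 = q <;> simp [levelInd, h1]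

/-- An operator commuting with the central unitary group commutes with the level projections. -/
lemma commute_level {c : ℕ} {ħ μ : ℝ} {Z : BH}
    (hZ : ∀ t, oneParam c ħ μ 2 t * Z = Z * oneParam c ħ μ 2 t) (q : ℤ) :
    Z * level q = level q * Z := by
  have hoff : ∀ q r : ℤ, q ≠ r → level q * (Z * level r) = 0 := by
    intro q r hqr
    have hne : (q : ℝ) - r ≠ 0 := by
      rw [sub_ne_zero]; exact_mod_cast hqr
    -- At this time `e^{iqt} = -e^{irt}`, so the block between the levels `q` and `r` equals its own
    -- negative.
    set t : ℝ := Real.pi / (q - r) with ht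
    have h1 : oneParam c ħ μ 2 t * (level q * (Z * level r)) =
        Complex.exp (Complex.I * ((q * t : ℝ) : ℂ)) • (level q * (Z * level r)) := by
      rw [← mul_assoc, central_mul_level, smul_mul_assoc]
    have h2 : oneParam c ħ μ 2 t * (level q * (Z * level r)) =
        Complex.exp (Complex.I * ((r * t : ℝ) : ℂ)) • (level q * (Z * level r)) := by
      rw [← mul_assoc, commute_id (isWC_central c ħ μ t) (isWC_level q), mul_assoc,
        ← mul_assoc _ Z, hZ, mul_assoc, central_mul_level, mul_smul_comm, mul_smul_comm]
    have h3 : Complex.exp (Complex.I * ((q * t : ℝ) : ℂ)) =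
        -Complex.exp (Complex.I * ((r * t : ℝ) : ℂ)) := by
      have : (q * t : ℝ) = r * t + Real.pi := by
        rw [ht]; field_simp; ring
      rw [this]
      push_cast
      rw [mul_add, Complex.exp_add, mul_comm Complex.I (Real.pi : ℂ), Complex.exp_pi_mul_I]
      ring
    have h4 := h1.symm.trans h2
    rw [h3, neg_smul, eq_comm, eq_neg_iff_add_eq_zero, ← two_smul ℂ, smul_smul] at h4
    exact (smul_eq_zero.1 h4).resolve_left (mul_ne_zero two_ne_zero (Complex.exp_ne_zero _))
  have hdiag : level q * Z = level q * Z * level q := by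
    rw [← sub_eq_zero]
    refine eq_zero_of_mul_level fun r => ?_
    by_cases hr : q = r
    · subst hr
      rw [sub_mul, mul_assoc _ (level q) (level q), level_mul_level, sub_self]
    · rw [sub_mul, mul_assoc _ (level q) (level r), level_mul_level_of_ne hr, mul_zero, sub_zero,
        mul_assoc, hoff q r hr]
  refine eq_of_level_mul fun r => ?_
  by_cases hr : r = q
  · subst hr
    rw [← mul_assoc, ← mul_assoc, level_mul_level, ← hdiag]
  · rw [hoff r q hr, ← mul_assoc, level_mul_level_of_ne hr, zero_mul]

/-! Operators commuting with `N_ħ`. -/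

/-- Monomials move only `p`, so they commute with multiplication by functions of `(x, y)`. -/
lemma commute_baseMul {c : ℕ} {ħ μ ν : ℝ} {k : ℝ → UnitAddCircle → ℂ} {R X : BH}
    (hR : IsWC (fun z => k z.1 z.2.1) id R) (hX : X ∈ N c ħ μ ν) : R * X = X * R := by
  refine commute_of_mem_N (fun n φ Y _ hY => ?_) hX
  refine (hR.mul hY (MeasurePreserving.id _)).unique ?_
  refine (IsWC.mul hY hR (measurePreserving_opShift n)).congr (Filter.Eventually.of_forall fun z => ?_)
  simp [opShift, mul_comm]

/-- The joint translation of the base and the level which leaves all monomial weights invariant. -/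
def stair (ħ μ ν : ℝ) (k : ℤ) (z : Pt) : Pt :=
  (z.1 - 2 * k * ħ * μ, z.2.1 - ((2 * k * ħ * ν : ℝ) : UnitAddCircle), z.2.2 - (-k))

lemma measurePreserving_stair (ħ μ ν : ℝ) (k : ℤ) :
    MeasurePreserving (stair ħ μ ν k) ptMeasure ptMeasure :=
  (measurePreserving_sub_right volume _).prod
    ((measurePreserving_sub_right volume _).prod (measurePreserving_sub_right Measure.count _))

lemma opWeight_stair (ħ μ ν : ℝ) (n k : ℤ) (φ : ℝ → UnitAddCircle → ℂ) (z : Pt) :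
    opWeight ħ μ ν n φ (stair ħ μ ν k z) = opWeight ħ μ ν n φ z := by
  simp only [opWeight, stair]
  congr 1
  · push_cast; ring
  · rw [sub_sub, ← AddCircle.coe_add]; congr 2; push_cast; ring

lemma commute_stair {c : ℕ} {ħ μ ν : ℝ} {k : ℤ} {V X : BH}
    (hV : IsWC (fun _ => 1) (stair ħ μ ν k) V) (hX : X ∈ N c ħ μ ν) : V * X = X * V := by
  refine commute_of_mem_N (fun n φ Y _ hY => ?_) hX
  have h1 := hV.mul hY (measurePreserving_stair ħ μ ν k)
  have h2 := IsWC.mul hY hV (measurePreserving_opShift n)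
  have h3 : (fun z => opShift n (stair ħ μ ν k z)) = fun z => stair ħ μ ν k (opShift n z) := by
    funext z
    simp [opShift, stair, add_sub_right_comm]
  rw [h3] at h1
  refine h1.unique (h2.congr (Filter.Eventually.of_forall fun z => ?_))
  simp [opWeight_stair]

/-- The translation by a period in the first variable. -/
def periodShift (m : ℤ) (z : Pt) : Pt := (z.1 + 2 * Real.pi * m, z.2.1, z.2.2)

lemma measurePreserving_periodShift (m : ℤ) :
    MeasurePreserving (periodShift m) ptMeasure ptMeasure :=
  (measurePreserving_add_right volume _).prod (MeasurePreserving.id _)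

/-- The phase which turns `periodShift` into a symmetry of `N_ħ`. -/
def periodPhase (c : ℕ) (ħ ν : ℝ) (m : ℤ) (z : Pt) : ℂ :=
  fourier (-(m * c * z.2.2)) z.2.1 *
    Complex.exp (Complex.I * ((-(2 * Real.pi * m * c * ħ * ν * z.2.2 ^ 2) : ℝ) : ℂ))

lemma norm_periodPhase (c : ℕ) (ħ ν : ℝ) (m : ℤ) (z : Pt) : ‖periodPhase c ħ ν m z‖ = 1 := by
  rw [periodPhase, norm_mul, norm_exp_I_mul, mul_one, fourier_apply, Circle.norm_coe]

lemma measurable_periodPhase (c : ℕ) (ħ ν : ℝ) (m : ℤ) : Measurable (periodPhase c ħ ν m) := by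
  have h : Measurable fun w : UnitAddCircle × ℤ => (fourier (-(m * c * w.2)) w.1 : ℂ) :=
    measurable_from_prod_countable_left fun p =>
      (fourier (T := (1 : ℝ)) (-(m * c * p))).continuous.measurable
  exact (h.comp measurable_snd).mul (measurable_level fun p : ℤ =>
    Complex.exp (Complex.I * ((-(2 * Real.pi * m * c * ħ * ν * p ^ 2) : ℝ) : ℂ)))

lemma periodPhase_coe (c : ℕ) (ħ ν : ℝ) (m : ℤ) (x y : ℝ) (p : ℤ) :
    periodPhase c ħ ν m (x, (y : UnitAddCircle), p) =
      Complex.exp (Complex.I * ((-(2 * Real.pi * m * c * (p * y + ħ * ν * p ^ 2)) : ℝ) : ℂ)) := by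
  rw [periodPhase]
  simp only
  rw [fourier_coe_apply, ← Complex.exp_add]
  congr 1
  push_cast
  ring

/-- The period multiplies the symbol by `e^{2πimcn(y - ħ(n - 2p)ν)}`. The ratio of the phases at
levels `p` and `p - n` is the inverse of this, since `py + ħνp² - (p - n)y - ħν(p - n)² = n(y - ħ(n
- 2p)ν)`. The quadratic term in `periodPhase` accounts for the displaced base point. -/
lemma commute_period {c : ℕ} {ħ μ ν : ℝ} {m : ℤ} {W X : BH}
    (hW : IsWC (periodPhase c ħ ν m) (periodShift m) W) (hX : X ∈ N c ħ μ ν) :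
    W * X = X * W := by
  refine commute_of_mem_N (fun n φ Y hφ hY => ?_) hX
  have h1 := hW.mul hY (measurePreserving_periodShift m)
  have h2 := IsWC.mul hY hW (measurePreserving_opShift n)
  refine h1.unique (h2.congr (Filter.Eventually.of_forall fun z => ?_))
  obtain ⟨x, y, p⟩ := z
  obtain ⟨y, rfl⟩ := QuotientAddGroup.mk_surjective y
  simp only [opWeight, opShift, periodShift]
  erw [periodPhase_coe, periodPhase_coe]
  rw [add_sub_right_comm, ← AddCircle.coe_sub, hφ.quasi, mul_comm, ← mul_assoc, ← Complex.exp_add]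
  congr 2
  push_cast
  ring

/-- The structure of the elements of `N_ħ` of degree `n`. -/
lemma exists_symbol_of_degree {c : ℕ} {ħ μ ν : ℝ} {n : ℤ} {X : BH} (hX : X ∈ N c ħ μ ν)
    (hn : ∀ t : ℝ, act c ħ μ 2 t X = Complex.exp (Complex.I * ((n * t : ℝ) : ℂ)) • X) :
    ∃ g : ℝ → UnitAddCircle → ℂ, Measurable (Function.uncurry g) ∧ (∀ x y, ‖g x y‖ ≤ ‖X‖) ∧
      IsOp ħ μ ν n g X ∧
      ∀ m : ℤ, ∀ᵐ w : ℝ × UnitAddCircle, g (w.1 + 2 * Real.pi * m) w.2 =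
        fourier (m * c * n) w.2 * g w.1 w.2 := by
  -- Composing with the pure level shift by `-n` brings `X` to degree zero, where it will turn out
  -- to be a multiplication operator.
  have hsh : ∀ k : ℤ, ∃ S : BH, IsWC (fun _ => 1) (opShift k) S := fun k =>
    exists_isWC measurable_const (measurePreserving_opShift k) (M := 1)
      (Filter.Eventually.of_forall fun _ => by simp)
  obtain ⟨S, hS⟩ := hsh n
  obtain ⟨S', hS'⟩ := hsh (-n)
  have hSS : S' * S = 1 := by
    refine (hS'.mul hS (measurePreserving_opShift _)).unique ?_
    have : (fun z => opShift n (opShift (-n) z)) = id := by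
      funext z; simp [opShift]
    rw [this]
    simpa using isWC_one
  have hXE : ∀ t, oneParam c ħ μ 2 t * X =
      Complex.exp (Complex.I * ((n * t : ℝ) : ℂ)) • (X * oneParam c ħ μ 2 t) := fun t => by
    rw [← smul_mul_assoc, ← hn t, act_eq, mul_assoc _ _ (oneParam c ħ μ 2 t), oneParam_neg_mul,
      mul_one]
  have hSE : ∀ t, S' * oneParam c ħ μ 2 t =
      Complex.exp (Complex.I * ((n * t : ℝ) : ℂ)) • (oneParam c ħ μ 2 t * S') := fun t => by
    refine (hS'.mul (isWC_central c ħ μ t) (measurePreserving_opShift _)).unique ?_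
    refine (((isWC_central c ħ μ t).mul hS' (MeasurePreserving.id _)).smul _).congr
      (Filter.Eventually.of_forall fun z => ?_)
    simp only [opShift, one_mul, mul_one, ← Complex.exp_add]
    congr 1
    push_cast
    ring
  set Z : BH := X * S' with hZ
  have hXZ : X = Z * S := by rw [hZ, mul_assoc, hSS, mul_one]
  have hZE : ∀ t, oneParam c ħ μ 2 t * Z = Z * oneParam c ħ μ 2 t := fun t => by
    rw [hZ, mul_assoc, hSE, mul_smul_comm, ← mul_assoc, ← mul_assoc, hXE, smul_mul_assoc]
  have hlev := commute_level hZE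
  have hcomm : ∀ (k : Pt → ℂ) (R : BH), Measurable k → (∀ z, ‖k z‖ ≤ 1) → IsWC k id R →
      Z * R = R * Z := by
    intro k R hk hk1 hR
    -- On a single level any multiplier agrees with a function of `(x, y)` alone, and multiplication
    -- by the latter commutes with `X` because `X` lies in `N`.
    refine eq_of_level_mul fun q => ?_
    have hkq : Measurable fun z : Pt => k (z.1, z.2.1, q) := hk.comp
      (measurable_fst.prodMk ((measurable_fst.comp measurable_snd).prodMk measurable_const))
    obtain ⟨Rq, hRq⟩ := exists_isWC hkq (MeasurePreserving.id _) (M := 1)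
      (Filter.Eventually.of_forall fun _ => hk1 _)
    have h1 : R * level q = Rq * level q := by
      refine (isWC_mul_id hR (isWC_level q)).unique ((isWC_mul_id hRq (isWC_level q)).congr
        (Filter.Eventually.of_forall fun z => ?_))
      obtain ⟨x, y, p⟩ := z
      by_cases h : p = q
      · subst h; rfl
      · simp [levelInd, h]
    have h2 : Rq * Z = Z * Rq := by
      have h3 : Rq * S' = S' * Rq := by
        refine (hRq.mul hS' (MeasurePreserving.id _)).unique
          ((hS'.mul hRq (measurePreserving_opShift _)).congr
            (Filter.Eventually.of_forall fun z => ?_))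
        simp [opShift]
      rw [hZ, ← mul_assoc, commute_baseMul (k := fun x y => k (x, y, q)) hRq hX, mul_assoc, h3,
        mul_assoc]
    calc level q * (Z * R) = Z * (R * level q) := by
          rw [← mul_assoc, ← hlev, mul_assoc, commute_id (isWC_level q) hR]
      _ = Rq * (Z * level q) := by rw [h1, ← mul_assoc, ← h2, mul_assoc]
      _ = level q * (R * Z) := by
          rw [hlev, ← mul_assoc, ← h1, ← commute_id (isWC_level q) hR, mul_assoc]
  obtain ⟨G, hG, hG1, hGZ⟩ := exists_weight_of_commute hcomm
  have hZX : ‖Z‖ ≤ ‖X‖ := by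
    rw [hZ]
    refine (norm_mul_le _ _).trans (mul_le_of_le_one_right (norm_nonneg _) ?_)
    exact hS'.norm_le (measurePreserving_opShift _) zero_le_one
      (Filter.Eventually.of_forall fun _ => by simp)
  have hGX : IsWC G (opShift n) X := by
    rw [hXZ]
    simpa using hGZ.mul hS (MeasurePreserving.id _)
  -- Invariance under the staircase translations ties the weights on all levels to the one on level
  -- `0`.
  have hstair : ∀ᵐ z ∂ptMeasure, ∀ k : ℤ, G (stair ħ μ ν k z) = G z := by
    rw [ae_all_iff]
    intro k
    obtain ⟨V, hV⟩ : ∃ V : BH, IsWC (fun _ => 1) (stair ħ μ ν k) V :=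
      exists_isWC measurable_const (measurePreserving_stair ħ μ ν k) (M := 1)
        (Filter.Eventually.of_forall fun _ => by simp)
    have h1 := hV.mul hGX (measurePreserving_stair ħ μ ν k)
    have h2 := hGX.mul hV (measurePreserving_opShift n)
    rw [commute_stair hV hX] at h1
    have h3 : (fun z => opShift n (stair ħ μ ν k z)) = fun z => stair ħ μ ν k (opShift n z) := by
      funext z
      simp [opShift, stair, add_sub_right_comm]
    rw [h3] at h1
    have h4 := h1.weight_unique h2
      ((measurePreserving_stair ħ μ ν k).comp (measurePreserving_opShift n))
    simpa using h4
  let sh : ℝ × UnitAddCircle → ℝ × UnitAddCircle := fun w =>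
    (w.1 + ħ * n * μ, w.2 + ((ħ * n * ν : ℝ) : UnitAddCircle))
  have hsh : MeasurePreserving sh := (measurePreserving_add_right volume _).prod
    (measurePreserving_add_right volume _)
  -- The symbol is the weight on level `0`, recentred: there the base point is `x - ħnμ`.
  let g : ℝ → UnitAddCircle → ℂ := fun x y =>
    G (x + ħ * n * μ, y + ((ħ * n * ν : ℝ) : UnitAddCircle), 0)
  refine ⟨g, ?_, fun x y => (hG1 _).trans hZX, hGX.congr ?_, fun m => ?_⟩
  · exact hG.comp ((measurable_fst.add_const _).prodMk
      ((measurable_snd.add_const _).prodMk measurable_const))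
  · filter_upwards [hstair] with z hz
    rw [← hz (-z.2.2)]
    simp only [stair, opWeight, g]
    congr 1
    refine Prod.ext ?_ (Prod.ext ?_ ?_)
    · push_cast; ring
    · simp only
      rw [sub_add, ← AddCircle.coe_sub]
      congr 2
      push_cast
      ring
    · simp
  · obtain ⟨W, hW⟩ : ∃ W : BH, IsWC (periodPhase c ħ ν m) (periodShift m) W :=
      exists_isWC (measurable_periodPhase c ħ ν m) (measurePreserving_periodShift m) (M := 1)
        (Filter.Eventually.of_forall fun z => (norm_periodPhase c ħ ν m z).le)
    have h1 := hW.mul hGX (measurePreserving_periodShift m)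
    have h2 := hGX.mul hW (measurePreserving_opShift n)
    rw [commute_period hW hX] at h1
    have h4 := h1.weight_unique h2
      ((measurePreserving_periodShift m).comp (measurePreserving_opShift n))
    -- On level `0` the phase of `W` is `1`. The one on level `-n` is `e^{2πimcny}`, its quadratic
    -- term being cancelled by the recentring of `y` by `ħnν`.
    filter_upwards [hsh.quasiMeasurePreserving.ae (ae_pt_iff.1 h4 0)] with w hw
    obtain ⟨x, y⟩ := w
    obtain ⟨y, rfl⟩ := QuotientAddGroup.mk_surjective y
    simp only [opShift, periodShift, sh, g] at hw ⊢
    erw [← AddCircle.coe_add, periodPhase_coe, periodPhase_coe] at hw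
    erw [fourier_coe_apply]
    rw [add_right_comm]
    simp only [Int.cast_zero, zero_mul, ne_eq, OfNat.ofNat_ne_zero, not_false_eq_true, zero_pow,
      mul_zero, add_zero, neg_zero, Complex.ofReal_zero, Complex.exp_zero, one_mul] at hw
    erw [← AddCircle.coe_add]
    rw [hw, mul_comm]
    congr 2
    push_cast
    ring

/-! ### Components of a given degree -/

/-- The automorphisms form a group of isometries, so the estimate at time zero can be transported
along the orbit. -/
lemma norm_act_sub_act_le {c : ℕ} {ħ μ K a : ℝ} {i : Fin 3} {X : BH}
    (hX : ∀ t > 0, ‖X - act c ħ μ i t X‖ ≤ K * t ^ a) (s t : ℝ) :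
    ‖act c ħ μ i s X - act c ħ μ i t X‖ ≤ K * |s - t| ^ a := by
  have key : ∀ s t : ℝ, s < t → ‖act c ħ μ i s X - act c ħ μ i t X‖ ≤ K * |s - t| ^ a := by
    intro s t hst
    have h1 : act c ħ μ i t X = act c ħ μ i s (act c ħ μ i (t - s) X) := by
      rw [act_act, add_sub_cancel]
    rw [h1, ← act_sub, norm_act, abs_sub_comm, abs_of_pos (sub_pos.2 hst)]
    exact hX _ (sub_pos.2 hst)
  rcases lt_trichotomy s t with h | rfl | h
  · exact key s t h
  · have hK : 0 ≤ K := by simpa using (norm_nonneg _).trans (hX 1 one_pos)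
    rw [sub_self, norm_zero]
    positivity
  · rw [norm_sub_rev, abs_sub_comm]
    exact key t s h

/-- Norm continuity of the orbit allows Fourier components to be defined by norm-convergent
integrals. -/
lemma continuous_act {c : ℕ} {ħ μ K a : ℝ} (ha : 0 < a) {i : Fin 3} {X : BH}
    (hX : ∀ t > 0, ‖X - act c ħ μ i t X‖ ≤ K * t ^ a) :
    Continuous fun t => act c ħ μ i t X := by
  rw [continuous_iff_continuousAt]
  intro t
  rw [ContinuousAt, tendsto_iff_norm_sub_tendsto_zero]
  have h : Filter.Tendsto (fun s : ℝ => K * |s - t| ^ a) (𝓝 t) (𝓝 0) := by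
    have : Continuous fun s : ℝ => K * |s - t| ^ a :=
      continuous_const.mul ((continuous_abs.comp (continuous_id.sub continuous_const)).rpow_const
        fun _ => Or.inr ha.le)
    simpa [Real.zero_rpow ha.ne'] using this.tendsto t
  exact squeeze_zero (fun _ => norm_nonneg _) (fun s => norm_act_sub_act_le hX s t) h

lemma oneParam_central_two_pi (c : ℕ) (ħ μ : ℝ) : oneParam c ħ μ 2 (2 * Real.pi) = 1 := by
  refine (isWC_central c ħ μ _).unique (isWC_one.congr (Filter.Eventually.of_forall fun z => ?_))
  rw [eq_comm, Complex.exp_eq_one_iff]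
  exact ⟨z.2.2, by push_cast; ring⟩

lemma act_central_add_two_pi (c : ℕ) (ħ μ t : ℝ) (X : BH) :
    act c ħ μ 2 (t + 2 * Real.pi) X = act c ħ μ 2 t X := by
  have h : act c ħ μ 2 (2 * Real.pi) X = X := by
    have h1 : oneParam c ħ μ 2 (-(2 * Real.pi)) = 1 := by
      have := oneParam_mul_neg c ħ μ 2 (2 * Real.pi)
      rwa [oneParam_central_two_pi, one_mul] at this
    rw [act_eq, h1, oneParam_central_two_pi, one_mul, mul_one]
  rw [← act_act, h]

/-- The integrand of the component of degree `n`. -/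
def compIntegrand (c : ℕ) (ħ μ : ℝ) (n : ℤ) (X : BH) (t : ℝ) : BH :=
  Complex.exp (Complex.I * ((-(n * t) : ℝ) : ℂ)) • act c ħ μ 2 t X

/-- The component of degree `n`. -/
def component (c : ℕ) (ħ μ : ℝ) (n : ℤ) (X : BH) : BH :=
  (((2 * Real.pi)⁻¹ : ℝ) : ℂ) • ∫ t in (-Real.pi)..Real.pi, compIntegrand c ħ μ n X t

lemma norm_compIntegrand (c : ℕ) (ħ μ : ℝ) (n : ℤ) (X : BH) (t : ℝ) :
    ‖compIntegrand c ħ μ n X t‖ = ‖X‖ := by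
  rw [compIntegrand, norm_smul, norm_exp_I_mul, one_mul, norm_act]

lemma continuous_compIntegrand {c : ℕ} {ħ μ : ℝ} {X : BH}
    (hX : Continuous fun t => act c ħ μ 2 t X) (n : ℤ) :
    Continuous (compIntegrand c ħ μ n X) := by
  have h : Continuous fun t : ℝ => Complex.exp (Complex.I * ((-(n * t) : ℝ) : ℂ)) := by
    fun_prop
  exact h.smul hX

lemma norm_component_le (c : ℕ) (ħ μ : ℝ) (n : ℤ) (X : BH) :
    ‖component c ħ μ n X‖ ≤ ‖X‖ := by
  have h := intervalIntegral.norm_integral_le_of_norm_le_const (a := -Real.pi) (b := Real.pi)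
    (f := compIntegrand c ħ μ n X) (C := ‖X‖) fun t _ => (norm_compIntegrand c ħ μ n X t).le
  have e : |Real.pi - -Real.pi| = 2 * Real.pi := by
    rw [sub_neg_eq_add, ← two_mul, abs_of_pos Real.two_pi_pos]
  rw [e] at h
  rw [component, norm_smul, Complex.norm_of_nonneg (inv_nonneg.2 Real.two_pi_pos.le),
    inv_mul_eq_div, div_le_iff₀ Real.two_pi_pos]
  exact h

/-- `N` is norm closed, hence complete, so the integral can be computed inside it. -/
lemma component_mem_N {c : ℕ} {ħ μ ν : ℝ} {X : BH} (hX : X ∈ N c ħ μ ν)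
    (hc : Continuous fun t => act c ħ μ 2 t X) (n : ℤ) : component c ħ μ n X ∈ N c ħ μ ν := by
  have hcl := isClosed_N c ħ μ ν
  have : CompleteSpace (N c ħ μ ν) := hcl.completeSpace_coe
  have hmem : ∀ t, compIntegrand c ħ μ n X t ∈ N c ħ μ ν := fun t =>
    Submodule.smul_mem _ _ (act_mem_N hX 2 t)
  let f : ℝ → N c ħ μ ν := fun t => ⟨_, hmem t⟩
  have hf : Continuous f := (continuous_compIntegrand hc n).subtype_mk _
  have h := ContinuousLinearMap.intervalIntegral_comp_comm (𝕜 := ℂ) (E := N c ħ μ ν) (F := BH)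
    (N c ħ μ ν).subtypeL (hf.intervalIntegrable (μ := volume) (-Real.pi) Real.pi)
  have h2 : component c ħ μ n X = (((2 * Real.pi)⁻¹ : ℝ) : ℂ) •
      ((∫ t in (-Real.pi)..Real.pi, f t : N c ħ μ ν) : BH) := by
    rw [component]
    congr 1
  rw [h2]
  exact Submodule.smul_mem _ _ (Submodule.coe_mem _)

/-- The action shifts the integration variable by `s`; periodicity removes the shift and the
character comes out as a factor. -/
lemma act_component {c : ℕ} {ħ μ : ℝ} {X : BH}
    (hc : Continuous fun t => act c ħ μ 2 t X) (n : ℤ) (s : ℝ) :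
    act c ħ μ 2 s (component c ħ μ n X) =
      Complex.exp (Complex.I * ((n * s : ℝ) : ℂ)) • component c ħ μ n X := by
  have hci := continuous_compIntegrand hc n
  have h1 := (actL c ħ μ 2 s).intervalIntegral_comp_comm
    (hci.intervalIntegrable (μ := volume) (-Real.pi) Real.pi)
  have h2 : ∀ t, actL c ħ μ 2 s (compIntegrand c ħ μ n X t) =
      Complex.exp (Complex.I * ((n * s : ℝ) : ℂ)) • compIntegrand c ħ μ n X (t + s) := fun t => by
    rw [actL_apply, compIntegrand, compIntegrand, act_smul, act_act, smul_smul, ← Complex.exp_add,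
      add_comm s t]
    congr 2
    push_cast
    ring
  have hper : Function.Periodic (compIntegrand c ħ μ n X) (2 * Real.pi) := fun t => by
    rw [compIntegrand, compIntegrand, act_central_add_two_pi]
    congr 1
    rw [Complex.exp_eq_exp_iff_exists_int]
    exact ⟨-n, by push_cast; ring⟩
  have h3 : ∫ t in (-Real.pi)..Real.pi, compIntegrand c ħ μ n X (t + s) =
      ∫ t in (-Real.pi)..Real.pi, compIntegrand c ħ μ n X t := by
    rw [intervalIntegral.integral_comp_add_right]
    have := hper.intervalIntegral_add_eq (-Real.pi + s) (-Real.pi)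
    rw [show -Real.pi + s + 2 * Real.pi = Real.pi + s by ring,
      show -Real.pi + 2 * Real.pi = Real.pi by ring] at this
    exact this
  simp only [h2, intervalIntegral.integral_smul, h3] at h1
  rw [component, act_smul, ← actL_apply, ← h1, smul_comm]

/-- Taking components commutes with every action by `act_comm_central`. As it is also contractive,
components keep all Hölder constants. -/
lemma component_sub_act {c : ℕ} {ħ μ : ℝ} {X : BH}
    (hc : Continuous fun t => act c ħ μ 2 t X) (n : ℤ) (i : Fin 3) (s : ℝ) :
    component c ħ μ n X - act c ħ μ i s (component c ħ μ n X) =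
      component c ħ μ n (X - act c ħ μ i s X) := by
  have hci := continuous_compIntegrand hc n
  have h1 := (actL c ħ μ i s).intervalIntegral_comp_comm
    (hci.intervalIntegrable (μ := volume) (-Real.pi) Real.pi)
  have h2 : ∀ t, compIntegrand c ħ μ n (X - act c ħ μ i s X) t =
      compIntegrand c ħ μ n X t - actL c ħ μ i s (compIntegrand c ħ μ n X t) := fun t => by
    rw [actL_apply, compIntegrand, compIntegrand, act_smul, act_comm_central, act_sub, smul_sub]
  have h3 : act c ħ μ i s (component c ħ μ n X) = (((2 * Real.pi)⁻¹ : ℝ) : ℂ) •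
      actL c ħ μ i s (∫ t in (-Real.pi)..Real.pi, compIntegrand c ħ μ n X t) := by
    rw [component, act_smul, ← actL_apply]
  have hci' : Continuous fun t => actL c ħ μ i s (compIntegrand c ħ μ n X t) :=
    (actL c ħ μ i s).continuous.comp hci
  rw [h3, ← h1, component, component, ← smul_sub, ← intervalIntegral.integral_sub
    (hci.intervalIntegrable _ _) (hci'.intervalIntegrable _ _)]
  simp only [h2]

lemma norm_component_sub_act_le {c : ℕ} {ħ μ : ℝ} {X : BH}
    (hc : Continuous fun t => act c ħ μ 2 t X) (n : ℤ) (i : Fin 3) (s : ℝ) :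
    ‖component c ħ μ n X - act c ħ μ i s (component c ħ μ n X)‖ ≤ ‖X - act c ħ μ i s X‖ := by
  rw [component_sub_act hc]
  exact norm_component_le _ _ _ _ _

/-! ### Approximation by finitely many components -/

/-- This is the binomial expansion of `1 + cos t = e^{-it}(e^{it} + 1)² / 2`. The characters are
written so that the `k`-th term is the one in the component of degree `j - k`. -/
lemma one_add_cos_pow (j : ℕ) (t : ℝ) :
    (((1 + Real.cos t) ^ j : ℝ) : ℂ) = ∑ k ∈ Finset.range (2 * j + 1),
      ((2 : ℂ)⁻¹ ^ j * (2 * j).choose k) *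
        Complex.exp (Complex.I * ((-(((j : ℤ) - k : ℤ) * t) : ℝ) : ℂ)) := by
  have h0 : ((1 + Real.cos t : ℝ) : ℂ) =
      2⁻¹ * Complex.exp (-(t * Complex.I)) * (Complex.exp (t * Complex.I) + 1) ^ 2 := by
    push_cast
    rw [Complex.cos, show -(t : ℂ) * Complex.I = -(t * Complex.I) by ring, Complex.exp_neg]
    have := Complex.exp_ne_zero (t * Complex.I)
    field_simp
    ring
  rw [Complex.ofReal_pow, h0, mul_pow, mul_pow, ← pow_mul, add_pow, Finset.mul_sum]
  refine Finset.sum_congr rfl fun k _ => ?_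
  rw [one_pow, mul_one, ← Complex.exp_nat_mul, ← Complex.exp_nat_mul]
  have : Complex.exp (Complex.I * ((-(((j : ℤ) - k : ℤ) * t) : ℝ) : ℂ)) =
      Complex.exp (j * -(t * Complex.I)) * Complex.exp (k * (t * Complex.I)) := by
    rw [← Complex.exp_add]
    congr 1
    push_cast
    ring
  rw [this]
  ring

lemma integral_one_add_cos_pow_pos (j : ℕ) :
    0 < ∫ t in Set.Icc (-Real.pi) Real.pi, (1 + Real.cos t) ^ j := by
  have hc : Continuous fun t : ℝ => (1 + Real.cos t) ^ j := by fun_prop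
  rw [integral_Icc_eq_integral_Ioc, ← intervalIntegral.integral_of_le (by linarith [Real.pi_pos])]
  refine intervalIntegral.intervalIntegral_pos_of_pos_on (hc.intervalIntegrable _ _) (fun t ht => ?_)
    (by linarith [Real.pi_pos])
  have : Real.cos t ≠ -1 := by
    intro h
    have h1 : Real.cos (t + Real.pi) = 1 := by rw [Real.cos_add_pi, h, neg_neg]
    rw [Real.cos_eq_one_iff_of_lt_of_lt (by linarith [ht.1, Real.pi_pos])
      (by linarith [ht.2])] at h1
    linarith [ht.1]
  have h2 : -1 < Real.cos t := lt_of_le_of_ne (Real.neg_one_le_cos t) (Ne.symm this)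
  exact pow_pos (by linarith) j

/-- Hölder elements are approximated, uniformly, by combinations of their components. -/
lemma exists_component_approx (c : ℕ) (ħ μ : ℝ) {C : ℝ} (hC : C ∈ Set.Ioc (0 : ℝ) 1) {ε : ℝ}
    (hε : 0 < ε) : ∃ (j m : ℕ) (a : ℕ → ℂ), ∀ X : BH,
      (∀ t > 0, ‖X - act c ħ μ 2 t X‖ ≤ 1 * t ^ C) →
      ‖X - ∑ k ∈ Finset.range m, a k • component c ħ μ ((j : ℤ) - k) X‖ ≤ ε := by
  have hpi := Real.pi_pos
  have hg : Continuous fun t : ℝ => |t| ^ C := continuous_abs.rpow_const fun _ => Or.inr hC.1.le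
  -- The normalised kernels `(1 + cos t)^j` concentrate at `0`, where `|t| ^ C` vanishes. The
  -- resulting `j` depends on `C` and `ε` but not on `X`.
  have htend := tendsto_setIntegral_pow_smul_of_unique_maximum_of_isCompact_of_continuousOn
    (μ := (volume : Measure ℝ)) (s := Set.Icc (-Real.pi) Real.pi) (x₀ := 0)
    (c := fun t => 1 + Real.cos t) (g := fun t : ℝ => |t| ^ C) isCompact_Icc
    (by fun_prop) (fun y hy hy0 => by
      have h1 : Real.cos y ≠ 1 := fun h => hy0
        ((Real.cos_eq_one_iff_of_lt_of_lt (by linarith [hy.1]) (by linarith [hy.2])).1 h)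
      simp only [Real.cos_zero, add_lt_add_iff_left]
      exact lt_of_le_of_ne (Real.cos_le_one y) h1)
    (fun x _ => by linarith [Real.neg_one_le_cos x]) (by simp)
    (by rw [interior_Icc]; exact subset_closure ⟨by linarith, hpi⟩) hg.continuousOn
  simp only [abs_zero, Real.zero_rpow hC.1.ne'] at htend
  obtain ⟨j, hj⟩ := ((tendsto_order.1 htend).2 ε hε).exists
  set I := ∫ t in Set.Icc (-Real.pi) Real.pi, (1 + Real.cos t) ^ j with hI
  have hIpos : 0 < I := integral_one_add_cos_pow_pos j
  -- The factor `2π` undoes the normalisation of `component`, and `I⁻¹` gives the kernel total mass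
  -- one.
  refine ⟨j, 2 * j + 1, fun k => ((2 * Real.pi * I⁻¹ : ℝ) : ℂ) *
    ((2 : ℂ)⁻¹ ^ j * (2 * j).choose k), fun X hX => ?_⟩
  have hc := continuous_act hC.1 hX
  have hpow : Continuous fun t : ℝ => (1 + Real.cos t) ^ j := by fun_prop
  have hpow' : Continuous fun t : ℝ => (((1 + Real.cos t) ^ j : ℝ) : ℂ) :=
    Complex.continuous_ofReal.comp hpow
  -- the sum is an average of the orbit of `X`
  have h1 : ∑ k ∈ Finset.range (2 * j + 1), (((2 * Real.pi * I⁻¹ : ℝ) : ℂ) *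
      ((2 : ℂ)⁻¹ ^ j * (2 * j).choose k)) • component c ħ μ ((j : ℤ) - k) X =
      ((I⁻¹ : ℝ) : ℂ) • ∫ t in (-Real.pi)..Real.pi,
        (((1 + Real.cos t) ^ j : ℝ) : ℂ) • act c ħ μ 2 t X := by
    have h2 : ∀ t : ℝ, (((1 + Real.cos t) ^ j : ℝ) : ℂ) • act c ħ μ 2 t X =
        ∑ k ∈ Finset.range (2 * j + 1), ((2 : ℂ)⁻¹ ^ j * (2 * j).choose k) •
          compIntegrand c ħ μ ((j : ℤ) - k) X t := fun t => by
      rw [one_add_cos_pow, Finset.sum_smul]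
      refine Finset.sum_congr rfl fun k _ => ?_
      rw [compIntegrand, smul_smul]
    have hint : ∀ k : ℕ, Continuous fun t => ((2 : ℂ)⁻¹ ^ j * (2 * j).choose k) •
        compIntegrand c ħ μ ((j : ℤ) - k) X t := fun k => by
      have := continuous_compIntegrand hc ((j : ℤ) - k)
      fun_prop
    simp only [h2]
    rw [intervalIntegral.integral_finsetSum fun k _ => (hint k).intervalIntegrable _ _,
      Finset.smul_sum]
    refine Finset.sum_congr rfl fun k _ => ?_
    rw [intervalIntegral.integral_smul, component, smul_smul, smul_smul]
    congr 1
    push_cast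
    have : (Real.pi : ℂ) ≠ 0 := by exact_mod_cast hpi.ne'
    field_simp
  rw [h1]
  have h3 : X = ((I⁻¹ : ℝ) : ℂ) • ∫ t in (-Real.pi)..Real.pi,
      (((1 + Real.cos t) ^ j : ℝ) : ℂ) • X := by
    rw [intervalIntegral.integral_smul_const, intervalIntegral.integral_ofReal,
      intervalIntegral.integral_of_le (by linarith), ← integral_Icc_eq_integral_Ioc, ← hI,
      smul_smul, ← Complex.ofReal_mul, inv_mul_cancel₀ hIpos.ne', Complex.ofReal_one, one_smul]
  have hi1 : Continuous fun t : ℝ => (((1 + Real.cos t) ^ j : ℝ) : ℂ) • X :=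
    hpow'.smul continuous_const
  have hi2 : Continuous fun t : ℝ => (((1 + Real.cos t) ^ j : ℝ) : ℂ) • act c ħ μ 2 t X :=
    hpow'.smul hc
  have h8 : X - ((I⁻¹ : ℝ) : ℂ) • ∫ t in (-Real.pi)..Real.pi,
      (((1 + Real.cos t) ^ j : ℝ) : ℂ) • act c ħ μ 2 t X =
      ((I⁻¹ : ℝ) : ℂ) • ((∫ t in (-Real.pi)..Real.pi, (((1 + Real.cos t) ^ j : ℝ) : ℂ) • X) -
        ∫ t in (-Real.pi)..Real.pi, (((1 + Real.cos t) ^ j : ℝ) : ℂ) • act c ħ μ 2 t X) := by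
    rw [smul_sub, ← h3]
  rw [h8, ← intervalIntegral.integral_sub (hi1.intervalIntegrable _ _) (hi2.intervalIntegrable _ _),
    norm_smul, Complex.norm_of_nonneg (inv_nonneg.2 hIpos.le)]
  have h4 : ‖∫ t in (-Real.pi)..Real.pi, ((((1 + Real.cos t) ^ j : ℝ) : ℂ) • X -
      (((1 + Real.cos t) ^ j : ℝ) : ℂ) • act c ħ μ 2 t X)‖ ≤
      ∫ t in (-Real.pi)..Real.pi, (1 + Real.cos t) ^ j * |t| ^ C := by
    refine intervalIntegral.norm_integral_le_of_norm_le (by linarith)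
      (Filter.Eventually.of_forall fun t _ => ?_) ((hpow.mul hg).intervalIntegrable _ _)
    have h5 : 0 ≤ (1 + Real.cos t) ^ j := pow_nonneg (by linarith [Real.neg_one_le_cos t]) _
    rw [← smul_sub, norm_smul, Complex.norm_of_nonneg h5]
    refine mul_le_mul_of_nonneg_left ?_ h5
    have h6 := norm_act_sub_act_le hX 0 t
    rwa [act_zero_time, zero_sub, abs_neg, one_mul] at h6
  have h7 : ∫ t in (-Real.pi)..Real.pi, (1 + Real.cos t) ^ j * |t| ^ C =
      ∫ t in Set.Icc (-Real.pi) Real.pi, (1 + Real.cos t) ^ j * |t| ^ C := by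
    rw [intervalIntegral.integral_of_le (by linarith), ← integral_Icc_eq_integral_Ioc]
  rw [h7] at h4
  exact (mul_le_mul_of_nonneg_left h4 (inv_nonneg.2 hIpos.le)).trans hj.le

/-! ### Mollification of symbols -/

/-- The preimage of a null set is a countable union of pieces over the intervals `(n, n + 1]`, each
null since the projection preserves measure there. -/
lemma quasiMeasurePreserving_coe :
    Measure.QuasiMeasurePreserving ((↑) : ℝ → UnitAddCircle) volume volume := by
  refine ⟨AddCircle.measurable_mk', Measure.AbsolutelyContinuous.mk fun s hs h0 => ?_⟩
  rw [Measure.map_apply AddCircle.measurable_mk' hs]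
  have h : ((↑) : ℝ → UnitAddCircle) ⁻¹' s =
      ⋃ n : ℤ, (((↑) : ℝ → UnitAddCircle) ⁻¹' s ∩ Set.Ioc (n : ℝ) (n + 1)) := by
    rw [← Set.inter_iUnion, iUnion_Ioc_intCast, Set.inter_univ]
  rw [h, measure_iUnion_null_iff]
  intro n
  have h1 := (UnitAddCircle.measurePreserving_mk (n : ℝ)).measure_preimage hs.nullMeasurableSet
  rwa [Measure.restrict_apply (AddCircle.measurable_mk' hs), h0] at h1

lemma quasiMeasurePreserving_sub_coe (x b : ℝ) :
    Measure.QuasiMeasurePreserving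
      (fun w : ℝ × ℝ => (x - w.1, ((b - w.2 : ℝ) : UnitAddCircle))) volume volume :=
  QuasiMeasurePreserving.prodMap (Measure.measurePreserving_sub_left volume x).quasiMeasurePreserving
    (quasiMeasurePreserving_coe.comp (Measure.measurePreserving_sub_left volume b).quasiMeasurePreserving)

/-- A monomial operator dominates its symbol. -/
lemma IsOp.norm_symbol_le {ħ μ ν : ℝ} {n : ℤ} {h : ℝ → UnitAddCircle → ℂ} {T : BH}
    (hT : IsOp ħ μ ν n h T) (hm : Measurable (Function.uncurry h)) :
    ∀ᵐ w : ℝ × UnitAddCircle, ‖h w.1 w.2‖ ≤ ‖T‖ := by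
  -- Shifting back by a contraction leaves a multiplication operator, whose norm bounds its weight.
  obtain ⟨S, hS⟩ : ∃ S : BH, IsWC (fun _ => 1) (opShift (-n)) S :=
    exists_isWC measurable_const (measurePreserving_opShift (-n)) (M := 1)
      (Filter.Eventually.of_forall fun _ => by simp)
  have h1 : IsWC (opWeight ħ μ ν n h) id (T * S) := by
    have h2 := IsWC.mul hT hS (measurePreserving_opShift n)
    have h3 : (fun z => opShift (-n) (opShift n z)) = id := by
      funext z; simp [opShift]
    rw [h3] at h2
    simpa using h2
  have h4 : ‖T * S‖ ≤ ‖T‖ :=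
    (norm_mul_le _ _).trans (mul_le_of_le_one_right (norm_nonneg _)
      (hS.norm_le (measurePreserving_opShift _) zero_le_one
        (Filter.Eventually.of_forall fun _ => by simp)))
  have h5 := ae_pt_iff.1 (h1.norm_weight_le (measurable_opWeight hm)) 0
  have hsh : MeasurePreserving fun w : ℝ × UnitAddCircle =>
      (w.1 + ħ * n * μ, w.2 + ((ħ * n * ν : ℝ) : UnitAddCircle)) :=
    (measurePreserving_add_right volume _).prod (measurePreserving_add_right volume _)
  filter_upwards [hsh.quasiMeasurePreserving.ae h5] with w hw
  simp only [opWeight, Int.cast_zero, mul_zero, sub_zero, add_sub_cancel_right] at hw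
  exact hw.trans h4

/-- A symbol which is small almost everywhere gives a small operator. -/
lemma IsOp.norm_le_of_ae {ħ μ ν : ℝ} {n : ℤ} {h : ℝ → UnitAddCircle → ℂ} {T : BH}
    (hT : IsOp ħ μ ν n h T) {M : ℝ} (h0 : 0 ≤ M)
    (hM : ∀ᵐ w : ℝ × UnitAddCircle, ‖h w.1 w.2‖ ≤ M) : ‖T‖ ≤ M := by
  refine IsWC.norm_le hT (measurePreserving_opShift n) h0 (ae_pt_iff.2 fun p => ?_)
  have hsh : MeasurePreserving fun w : ℝ × UnitAddCircle =>
      (w.1 - ħ * (n - 2 * p) * μ, w.2 - ((ħ * (n - 2 * p) * ν : ℝ) : UnitAddCircle)) :=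
    (measurePreserving_sub_right volume _).prod (measurePreserving_sub_right volume _)
  exact hsh.quasiMeasurePreserving.ae hM

/-- The twist by `(r, s)` which the actions induce on symbols of degree `n`. -/
def twistPhase (c : ℕ) (n : ℤ) (s x : ℝ) : ℂ := Complex.exp (Complex.I * ((c * s * n * x : ℝ) : ℂ))

lemma norm_twistPhase (c : ℕ) (n : ℤ) (s x : ℝ) : ‖twistPhase c n s x‖ = 1 := norm_exp_I_mul _

lemma contDiff_twistPhase (c : ℕ) (n : ℤ) : ContDiff ℝ ∞ fun z : ℝ × ℝ => twistPhase c n z.1 z.2 :=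
  (contDiff_const.mul (Complex.ofRealCLM.contDiff.comp (f := fun z : ℝ × ℝ =>
    (c : ℝ) * z.1 * n * z.2)
    (((contDiff_const.mul contDiff_fst).mul contDiff_const).mul contDiff_snd))).cexp

/-- The average of the twists of the symbol `g` with the weight `f`. -/
def mollify (c : ℕ) (n : ℤ) (f : ℝ × ℝ → ℝ) (g : ℝ → UnitAddCircle → ℂ) :
    ℝ → UnitAddCircle → ℂ :=
  fun x y => ∫ w : ℝ × ℝ, (f w : ℂ) * (twistPhase c n w.2 x *
    g (x - w.1) (y - (w.2 : UnitAddCircle)))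

/-- The substitution `v = z - w` moves all dependence on `z` into the kernel, so no regularity of
`g` is needed. -/
lemma mollify_coe (c : ℕ) (n : ℤ) (f : ℝ × ℝ → ℝ) (g : ℝ → UnitAddCircle → ℂ) (z : ℝ × ℝ) :
    mollify c n f g z.1 (z.2 : UnitAddCircle) =
      ∫ v : ℝ × ℝ, g v.1 (v.2 : UnitAddCircle) *
        ((f (z - v) : ℂ) * twistPhase c n (z - v).2 z.1) := by
  rw [mollify, ← integral_sub_left_eq_self _ volume z]
  refine integral_congr_ae (Filter.Eventually.of_forall fun v => ?_)
  simp only [Prod.fst_sub, Prod.snd_sub, sub_sub_cancel, ← AddCircle.coe_sub]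
  ring

lemma measurable_lift_symbol {g : ℝ → UnitAddCircle → ℂ} (hg : Measurable (Function.uncurry g)) :
    Measurable fun v : ℝ × ℝ => g v.1 (v.2 : UnitAddCircle) :=
  hg.comp (measurable_fst.prodMk (AddCircle.measurable_mk'.comp measurable_snd))

section

variable {c : ℕ} {n : ℤ} {f : ℝ × ℝ → ℝ} {g : ℝ → UnitAddCircle → ℂ}

lemma integrable_mollify_kernel (hf : Integrable f) (hg : Measurable (Function.uncurry g)) {M : ℝ}
    (hM : ∀ x y, ‖g x y‖ ≤ M) (x : ℝ) (y : UnitAddCircle) :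
    Integrable fun w : ℝ × ℝ => (f w : ℂ) * (twistPhase c n w.2 x *
      g (x - w.1) (y - (w.2 : UnitAddCircle))) := by
  refine hf.ofReal.mul_bdd (c := M) ?_ (Filter.Eventually.of_forall fun w => ?_)
  · have h1 : Measurable fun w : ℝ × ℝ => twistPhase c n w.2 x :=
      (contDiff_twistPhase c n).continuous.measurable.comp (measurable_snd.prodMk measurable_const)
    have h2 : Measurable fun w : ℝ × ℝ => g (x - w.1) (y - (w.2 : UnitAddCircle)) :=
      hg.comp ((measurable_const.sub measurable_fst).prodMk
        (measurable_const.sub (AddCircle.measurable_mk'.comp measurable_snd)))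
    exact (h1.mul h2).aestronglyMeasurable
  · rw [norm_mul, norm_twistPhase, one_mul]
    exact hM _ _

/-- Smoothness is that of a convolution with a smooth compactly supported kernel depending on a
parameter. The symbol `g` is quasi-periodic only almost everywhere, but under the integral this
gives the exact relation at every point. -/
lemma isSection_mollify (hf : ContDiff ℝ ∞ f) (hfc : HasCompactSupport f)
    (hg : Measurable (Function.uncurry g)) {M : ℝ} (hM : ∀ x y, ‖g x y‖ ≤ M)
    (hq : ∀ m : ℤ, ∀ᵐ w : ℝ × UnitAddCircle, g (w.1 + 2 * Real.pi * m) w.2 =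
        fourier (m * c * n) w.2 * g w.1 w.2) : IsSection c n (mollify c n f g) where
  smooth := by
    have hloc : LocallyIntegrable (fun v : ℝ × ℝ => g v.1 (v.2 : UnitAddCircle)) := by
      refine (locallyIntegrable_const M).mono (measurable_lift_symbol hg).aestronglyMeasurable
        (Filter.Eventually.of_forall fun v => ?_)
      exact (hM _ _).trans (le_abs_self M)
    have h := contDiffOn_convolution_right_with_param_comp (𝕜 := ℝ) (n := ⊤) (μ := volume)
      (ContinuousLinearMap.mul ℝ ℂ) (s := Set.univ) (v := fun z : ℝ × ℝ => z)
      contDiffOn_id (g := fun z w : ℝ × ℝ => (f w : ℂ) * twistPhase c n w.2 z.1)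
      (k := tsupport f) isOpen_univ hfc
      (fun z w _ hw => by simp [image_eq_zero_of_notMem_tsupport hw]) hloc (by
        refine ContDiff.contDiffOn (ContDiff.mul ?_ ?_)
        · exact Complex.ofRealCLM.contDiff.comp (hf.comp contDiff_snd)
        · exact (contDiff_twistPhase c n).comp
            ((contDiff_snd.comp contDiff_snd).prodMk (contDiff_fst.comp contDiff_fst)))
    rw [contDiffOn_univ] at h
    convert h using 1
    funext z
    rw [mollify_coe]
    rfl
  quasi := fun m x b => by
    rw [mollify, mollify, ← integral_const_mul]
    refine integral_congr_ae ?_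
    filter_upwards [(quasiMeasurePreserving_sub_coe x b).ae (hq m)] with w hw
    rw [add_sub_right_comm, ← AddCircle.coe_sub, hw, fourier_coe_apply]
    -- The period of the twist contributes `e^{2πimcn w₂}`, which cancels the displacement `b - w₂`;
    -- what remains is independent of `w`.
    have : twistPhase c n w.2 (x + 2 * Real.pi * m) *
        Complex.exp (2 * Real.pi * Complex.I * ((m * c * n : ℤ) : ℂ) * ((b - w.2 : ℝ) : ℂ) /
          ((1 : ℝ) : ℂ)) =
        Complex.exp (Complex.I * ((c * (2 * Real.pi * m) * n * b : ℝ) : ℂ)) *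
          twistPhase c n w.2 x := by
      rw [twistPhase, twistPhase, ← Complex.exp_add, ← Complex.exp_add]
      congr 1
      push_cast
      ring
    rw [← mul_assoc (twistPhase c n w.2 _), this]
    ring

/-- The average is close to `g` if the relevant twists of `g` are. -/
lemma ae_norm_sub_mollify_le (hf : Integrable f) (hf0 : ∀ w, 0 ≤ f w) (hf1 : ∫ w, f w = 1)
    (hfm : Measurable f)
    (hg : Measurable (Function.uncurry g)) {M : ℝ} (hM : ∀ x y, ‖g x y‖ ≤ M) {ε : ℝ}
    (h : ∀ w : ℝ × ℝ, f w ≠ 0 → ∀ᵐ q : ℝ × UnitAddCircle,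
      ‖g q.1 q.2 - twistPhase c n w.2 q.1 * g (q.1 - w.1) (q.2 - (w.2 : UnitAddCircle))‖ ≤ ε) :
    ∀ᵐ q : ℝ × UnitAddCircle, ‖g q.1 q.2 - mollify c n f g q.1 q.2‖ ≤ ε := by
  have hmeas : Measurable fun x : (ℝ × ℝ) × (ℝ × UnitAddCircle) => f x.1 * ‖g x.2.1 x.2.2 -
      twistPhase c n x.1.2 x.2.1 * g (x.2.1 - x.1.1) (x.2.2 - (x.1.2 : UnitAddCircle))‖ := by
    have h1 : Measurable fun x : (ℝ × ℝ) × (ℝ × UnitAddCircle) => twistPhase c n x.1.2 x.2.1 :=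
      (contDiff_twistPhase c n).continuous.measurable.comp
        ((measurable_snd.comp measurable_fst).prodMk (measurable_fst.comp measurable_snd))
    have h2 : Measurable fun x : (ℝ × ℝ) × (ℝ × UnitAddCircle) =>
        g (x.2.1 - x.1.1) (x.2.2 - (x.1.2 : UnitAddCircle)) :=
      hg.comp (((measurable_fst.comp measurable_snd).sub (measurable_fst.comp measurable_fst)).prodMk
        ((measurable_snd.comp measurable_snd).sub
          (AddCircle.measurable_mk'.comp (measurable_snd.comp measurable_fst))))
    exact (hfm.comp measurable_fst).mul
      (((hg.comp measurable_snd).sub (h1.mul h2)).norm)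
  have h' : ∀ᵐ w : ℝ × ℝ, ∀ᵐ q : ℝ × UnitAddCircle,
      f w * ‖g q.1 q.2 - twistPhase c n w.2 q.1 * g (q.1 - w.1) (q.2 - (w.2 : UnitAddCircle))‖ ≤
        f w * ε := by
    refine Filter.Eventually.of_forall fun w => ?_
    by_cases hw : f w = 0
    · simp [hw]
    · filter_upwards [h w hw] with q hq
      exact mul_le_mul_of_nonneg_left hq (hf0 w)
  -- The null set of points `q` depends on `w`; Fubini exchanges the two quantifiers.
  have h'' := (Measure.ae_ae_comm (p := fun (w : ℝ × ℝ) (q : ℝ × UnitAddCircle) =>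
    f w * ‖g q.1 q.2 - twistPhase c n w.2 q.1 * g (q.1 - w.1) (q.2 - (w.2 : UnitAddCircle))‖ ≤
      f w * ε) (measurableSet_le hmeas ((hfm.comp measurable_fst).mul_const ε))).1 h'
  filter_upwards [h''] with q hq
  have hk := integrable_mollify_kernel (c := c) (n := n) hf hg hM q.1 q.2
  have hfC : Integrable fun w => (f w : ℂ) := hf.ofReal
  have e : g q.1 q.2 - mollify c n f g q.1 q.2 = ∫ w : ℝ × ℝ, (f w : ℂ) * (g q.1 q.2 -
      twistPhase c n w.2 q.1 * g (q.1 - w.1) (q.2 - (w.2 : UnitAddCircle))) := by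
    simp only [mul_sub]
    rw [integral_sub (hfC.mul_const _) hk, integral_mul_const, integral_complex_ofReal, hf1,
      Complex.ofReal_one, one_mul, mollify]
  rw [e]
  refine (norm_integral_le_of_norm_le (hf.mul_const ε) ?_).trans (le_of_eq ?_)
  · filter_upwards [hq] with w hw
    rwa [norm_mul, Complex.norm_of_nonneg (hf0 w)]
  · rw [integral_mul_const, hf1, one_mul]

lemma norm_mollify_le (hf : Integrable f) (hf0 : ∀ w, 0 ≤ f w) (hf1 : ∫ w, f w = 1) {M : ℝ}
    (hM : ∀ x y, ‖g x y‖ ≤ M) (x : ℝ) (y : UnitAddCircle) : ‖mollify c n f g x y‖ ≤ M := by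
  refine (norm_integral_le_of_norm_le (hf.mul_const M)
    (Filter.Eventually.of_forall fun w => ?_)).trans (le_of_eq ?_)
  · rw [norm_mul, norm_mul, norm_twistPhase, one_mul, Complex.norm_of_nonneg (hf0 w)]
    exact mul_le_mul_of_nonneg_left (hM _ _) (hf0 w)
  · rw [integral_mul_const, hf1, one_mul]

/-- The averages of the bounded symbols are equicontinuous. -/
lemma exists_modulus_mollify (c : ℕ) (n : ℤ) (hf : Continuous f) (hfc : HasCompactSupport f)
    (z₀ : ℝ × ℝ) {ε : ℝ} (hε : 0 < ε) :
    ∀ᶠ z in 𝓝 z₀, ∀ g : ℝ → UnitAddCircle → ℂ, Measurable (Function.uncurry g) →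
      (∀ x y, ‖g x y‖ ≤ 1) →
      ‖mollify c n f g z.1 (z.2 : UnitAddCircle) - mollify c n f g z₀.1 (z₀.2 : UnitAddCircle)‖ ≤
        ε := by
  let k : ℝ × ℝ → ℝ × ℝ → ℂ := fun z v => (f (z - v) : ℂ) * twistPhase c n (z - v).2 z.1
  have hk : Continuous (Function.uncurry k) := by
    refine Continuous.mul ?_ ?_
    · exact Complex.continuous_ofReal.comp (hf.comp (continuous_fst.sub continuous_snd))
    · exact (contDiff_twistPhase c n).continuous.comp
        ((continuous_snd.comp (continuous_fst.sub continuous_snd)).prodMk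
          (continuous_fst.comp continuous_fst))
  -- This compact set contains the supports of all kernels `k z` with `z` in the unit ball around
  -- `z₀`.
  let s : Set (ℝ × ℝ) := (fun x : (ℝ × ℝ) × (ℝ × ℝ) => x.1 - x.2) ''
    (Metric.closedBall z₀ 1 ×ˢ tsupport f)
  have hs : IsCompact s := ((isCompact_closedBall z₀ 1).prod hfc).image
    (continuous_fst.sub continuous_snd)
  have hks : ∀ z ∈ Metric.closedBall z₀ 1, ∀ v, v ∉ s → k z v = 0 := by
    intro z hz v hv
    have : z - v ∉ tsupport f := fun h => hv ⟨(z, z - v), ⟨hz, h⟩, by simp⟩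
    simp [k, image_eq_zero_of_notMem_tsupport this]
  -- This integral bounds the oscillation for all `g` with `‖g‖ ≤ 1` simultaneously.
  have hF : Continuous fun z => ∫ v in s, ‖k z v - k z₀ v‖ := by
    refine continuous_parametric_integral_of_continuous (f := fun z v => ‖k z v - k z₀ v‖) ?_ hs
    have h2 : Continuous fun x : (ℝ × ℝ) × (ℝ × ℝ) => k z₀ x.2 :=
      hk.comp (continuous_const.prodMk continuous_snd)
    exact (hk.sub h2).norm
  have hF0 : (∫ v in s, ‖k z₀ v - k z₀ v‖) < ε := by simpa using hε
  filter_upwards [hF.continuousAt.eventually (gt_mem_nhds hF0),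
    Metric.closedBall_mem_nhds z₀ one_pos] with z hz hz1 g hg hg1
  have hint : ∀ z ∈ Metric.closedBall z₀ 1, Integrable fun v : ℝ × ℝ =>
      g v.1 (v.2 : UnitAddCircle) * k z v := by
    intro z hz
    have h1 : Integrable (k z) := by
      refine (hk.comp (continuous_const.prodMk continuous_id)).integrable_of_hasCompactSupport ?_
      exact HasCompactSupport.intro hs (hks z hz)
    exact h1.bdd_mul (c := 1) (measurable_lift_symbol hg).aestronglyMeasurable
      (Filter.Eventually.of_forall fun v => hg1 _ _)
  have hz0 : z₀ ∈ Metric.closedBall z₀ 1 := Metric.mem_closedBall_self zero_le_one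
  rw [mollify_coe, mollify_coe]
  have e := integral_sub (hint z hz1) (hint z₀ hz0)
  simp only [k] at e
  rw [← e]
  simp only [← mul_sub]
  change ‖∫ v : ℝ × ℝ, g v.1 (v.2 : UnitAddCircle) * (k z v - k z₀ v)‖ ≤ ε
  rw [← setIntegral_eq_integral_of_forall_compl_eq_zero (s := s) fun v hv => by
    rw [hks z hz1 v hv, hks z₀ hz0 v hv, sub_zero, mul_zero]]
  refine (norm_integral_le_of_norm_le ?_ (Filter.Eventually.of_forall fun v => ?_)).trans hz.le
  · have h2 : Continuous fun v => ‖k z v - k z₀ v‖ :=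
      ((hk.comp (continuous_const.prodMk continuous_id)).sub
        (hk.comp (continuous_const.prodMk continuous_id))).norm
    exact h2.continuousOn.integrableOn_compact hs
  · rw [norm_mul]
    exact mul_le_of_le_one_left (norm_nonneg _) (hg1 _ _)

end

/-! ### Total boundedness -/

/-- A finite net of `A` yields one of `S` by picking one related point for each ball that is met.
The relation will link an operator to the restriction of its symbol to `fundDom`. -/
lemma totallyBounded_of_dist_le {E F : Type*} [PseudoMetricSpace E] [PseudoMetricSpace F]
    {S : Set E} {A : Set F} (hA : TotallyBounded A) (R : E → F → Prop)
    (h : ∀ Y ∈ S, ∃ a ∈ A, R Y a)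
    (hd : ∀ Y ∈ S, ∀ Y' ∈ S, ∀ a a', R Y a → R Y' a' → dist Y Y' ≤ dist a a') :
    TotallyBounded S := by
  rw [Metric.totallyBounded_iff] at hA ⊢
  intro ε hε
  obtain ⟨t, ht, hAt⟩ := hA (ε / 2) (half_pos hε)
  let t' : Set F := {y ∈ t | ∃ Y ∈ S, ∃ a, R Y a ∧ a ∈ Metric.ball y (ε / 2)}
  have hpick : ∀ y : t', ∃ Y ∈ S, ∃ a, R Y a ∧ a ∈ Metric.ball (y : F) (ε / 2) := fun y => y.2.2
  choose pick hpS a haR hab using hpick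
  have : Finite t' := (ht.subset (Set.sep_subset _ _)).to_subtype
  refine ⟨Set.range pick, Set.finite_range pick, fun Y hY => ?_⟩
  obtain ⟨b, hbA, hbR⟩ := h Y hY
  obtain ⟨y, hyt, hby⟩ := Set.mem_iUnion₂.1 (hAt hbA)
  have hy' : y ∈ t' := ⟨hyt, Y, hY, b, hbR, hby⟩
  refine Set.mem_iUnion₂.2 ⟨pick ⟨y, hy'⟩, ⟨_, rfl⟩, ?_⟩
  rw [Metric.mem_ball]
  have h1 := hd Y hY _ (hpS ⟨y, hy'⟩) b _ hbR (haR ⟨y, hy'⟩)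
  have h2 := dist_triangle_right b (a ⟨y, hy'⟩) y
  have h3 : dist b y < ε / 2 := hby
  have h4 : dist (a ⟨y, hy'⟩) y < ε / 2 := hab ⟨y, hy'⟩
  linarith

lemma totallyBounded_of_approx {E : Type*} [PseudoMetricSpace E] {S : Set E}
    (h : ∀ ε > 0, ∃ T : Set E, TotallyBounded T ∧ ∀ x ∈ S, ∃ y ∈ T, dist x y ≤ ε) :
    TotallyBounded S := by
  rw [Metric.totallyBounded_iff]
  intro ε hε
  obtain ⟨T, hT, hST⟩ := h (ε / 2) (half_pos hε)
  obtain ⟨t, ht, hTt⟩ := Metric.totallyBounded_iff.1 hT (ε / 2) (half_pos hε)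
  refine ⟨t, ht, fun x hx => ?_⟩
  obtain ⟨y, hy, hxy⟩ := hST x hx
  obtain ⟨z, hz, hyz⟩ := Set.mem_iUnion₂.1 (hTt hy)
  refine Set.mem_iUnion₂.2 ⟨z, hz, ?_⟩
  rw [Metric.mem_ball] at hyz ⊢
  linarith [dist_triangle x y z]

/-- Total boundedness comes from the compactness of the product of the closures. The set itself is
built without closures, so that it stays in `V`, which need not be closed. -/
lemma exists_totallyBounded_sum (S : ℕ → Set BH) (hS : ∀ k, TotallyBounded (S k)) (V : Submodule ℂ BH)
    (hV : ∀ k, S k ⊆ V) (a : ℕ → ℂ) (m : ℕ) : ∃ T : Set BH, TotallyBounded T ∧ T ⊆ V ∧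
      ∀ Y : ℕ → BH, (∀ k, Y k ∈ S k) → ∑ k ∈ Finset.range m, a k • Y k ∈ T := by
  induction m with
  | zero =>
    exact ⟨{0}, isCompact_singleton.totallyBounded, by simp, fun Y _ => by simp⟩
  | succ m ih =>
    obtain ⟨T, hT, hTV, h⟩ := ih
    have hu : Continuous fun x : BH × BH => x.1 + a m • x.2 :=
      continuous_fst.add (continuous_snd.const_smul (a m))
    have hT' := hT.closure.isCompact_of_isClosed isClosed_closure
    have hS' := (hS m).closure.isCompact_of_isClosed isClosed_closure
    refine ⟨(fun x : BH × BH => x.1 + a m • x.2) '' (T ×ˢ S m),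
      ((hT'.prod hS').image hu).totallyBounded.subset
        (Set.image_mono (Set.prod_mono subset_closure subset_closure)), ?_, fun Y hY => ?_⟩
    · rintro _ ⟨⟨x, y⟩, ⟨hx, hy⟩, rfl⟩
      exact add_mem (hTV hx) (Submodule.smul_mem _ _ (hV m hy))
    · rw [Finset.sum_range_succ]
      exact ⟨(_, Y m), ⟨h Y hY, hY m⟩, rfl⟩

lemma exists_small_rpow {A B ε : ℝ} (hA : 0 < A) (hB : 0 < B) (hε : 0 < ε) :
    ∃ δ > 0, δ ^ A + δ ^ B ≤ ε := by
  have h : Filter.Tendsto (fun d : ℝ => d ^ A + d ^ B) (𝓝[>] 0) (𝓝 0) := by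
    have h1 : Continuous fun d : ℝ => d ^ A + d ^ B :=
      (continuous_id.rpow_const fun _ => Or.inr hA.le).add
        (continuous_id.rpow_const fun _ => Or.inr hB.le)
    have h2 := h1.tendsto 0
    simp only [Real.zero_rpow hA.ne', Real.zero_rpow hB.ne', add_zero] at h2
    exact h2.mono_left nhdsWithin_le_nhds
  obtain ⟨δ, hδ, hδ0⟩ := ((h.eventually (gt_mem_nhds hε)).and self_mem_nhdsWithin).exists
  exact ⟨δ, hδ0, hδ.le⟩

/-- Arzelà–Ascoli applies to the restrictions of the symbols to `fundDom`. By quasi-periodicity the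
sup distance there dominates the operator norm of the difference. -/
lemma totallyBounded_mollify (c : ℕ) (n : ℤ) {f : ℝ × ℝ → ℝ} (hf : Continuous f)
    (hfc : HasCompactSupport f) (hf0 : ∀ w, 0 ≤ f w) (hf1 : ∫ w, f w = 1) (ħ μ ν : ℝ) :
    TotallyBounded {Y : BH | ∃ g : ℝ → UnitAddCircle → ℂ, Measurable (Function.uncurry g) ∧
      (∀ x y, ‖g x y‖ ≤ 1) ∧ IsSection c n (mollify c n f g) ∧
      IsOp ħ μ ν n (mollify c n f g) Y} := by
  have : CompactSpace fundDom := isCompact_iff_compactSpace.1 isCompact_fundDom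
  let A : Set (BoundedContinuousFunction fundDom ℂ) := {h | ∃ g : ℝ → UnitAddCircle → ℂ,
    Measurable (Function.uncurry g) ∧ (∀ x y, ‖g x y‖ ≤ 1) ∧
    ∀ z : fundDom, h z = mollify c n f g z.1.1 (z.1.2 : UnitAddCircle)}
  have hfi : Integrable f := hf.integrable_of_hasCompactSupport hfc
  have hA : TotallyBounded A := by
    refine (BoundedContinuousFunction.arzela_ascoli (Metric.closedBall (0 : ℂ) 1)
      (isCompact_closedBall _ _) A ?_ ?_).totallyBounded.subset subset_closure
    · rintro h z ⟨g, hg, hg1, hh⟩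
      rw [hh, mem_closedBall_zero_iff]
      exact norm_mollify_le hfi hf0 hf1 hg1 _ _
    · intro z₀
      rw [Metric.equicontinuousAt_iff_right]
      intro ε hε
      have h1 := exists_modulus_mollify c n hf hfc (z₀ : ℝ × ℝ) (half_pos hε)
      have h2 := (continuous_subtype_val.tendsto z₀).eventually h1
      filter_upwards [h2] with z hz
      rintro ⟨h, g, hg, hg1, hh⟩
      simp only
      rw [hh, hh, dist_comm, dist_eq_norm]
      exact (hz g hg hg1).trans_lt (half_lt_self hε)
  refine totallyBounded_of_dist_le hA (fun Y h => ∃ φ : ℝ → UnitAddCircle → ℂ, IsSection c n φ ∧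
    IsOp ħ μ ν n φ Y ∧ ∀ z : fundDom, h z = φ z.1.1 (z.1.2 : UnitAddCircle)) ?_ ?_
  · rintro Y ⟨g, hg, hg1, hsec, hY⟩
    have hc : Continuous fun z : fundDom => mollify c n f g z.1.1 (z.1.2 : UnitAddCircle) :=
      hsec.smooth.continuous.comp continuous_subtype_val
    exact ⟨BoundedContinuousFunction.mkOfCompact ⟨_, hc⟩, ⟨g, hg, hg1, fun z => rfl⟩,
      _, hsec, hY, fun z => rfl⟩
  · rintro Y - Y' - h h' ⟨φ, hφ, hY, hh⟩ ⟨φ', hφ', hY', hh'⟩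
    rw [dist_eq_norm]
    refine (hY.sub hY').norm_le ((hφ.sub hφ').norm_le fun z hz => ?_)
    have := h.dist_coe_le_dist (g := h') (⟨z, hz⟩ : fundDom)
    rwa [hh, hh', dist_eq_norm] at this

/-- Elements of a given degree are approximated, uniformly, by smooth monomial operators from a
totally bounded set. -/
lemma exists_degree_approx (c : ℕ) (ħ μ ν : ℝ) (n : ℤ) {A B ε : ℝ} (hA : 0 < A) (hB : 0 < B)
    (hε : 0 < ε) : ∃ S : Set BH, TotallyBounded S ∧ S ⊆ monomialSpan c ħ μ ν ∧
      ∀ X ∈ N c ħ μ ν,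
        (∀ t : ℝ, act c ħ μ 2 t X = Complex.exp (Complex.I * ((n * t : ℝ) : ℂ)) • X) →
        ‖X‖ ≤ 1 → (∀ r > 0, ‖X - act c ħ μ 0 r X‖ ≤ 1 * r ^ A) →
        (∀ s > 0, ‖X - act c ħ μ 1 s X‖ ≤ 1 * s ^ B) → ∃ Y ∈ S, ‖X - Y‖ ≤ ε := by
  obtain ⟨δ, hδ, hδε⟩ := exists_small_rpow hA hB hε
  -- The kernel is supported in the square `[0, δ]²`, since the Hölder bounds concern positive
  -- translations.
  let b : ContDiffBump ((δ / 2, δ / 2) : ℝ × ℝ) := ⟨δ / 4, δ / 2, by positivity, by linarith⟩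
  set f : ℝ × ℝ → ℝ := b.normed volume with hf
  have hf0 : ∀ w, 0 ≤ f w := b.nonneg_normed
  have hf1 : ∫ w, f w = 1 := b.integral_normed
  have hfs : ContDiff ℝ ∞ f := b.contDiff_normed
  have hfc : HasCompactSupport f := b.hasCompactSupport_normed
  have hfi : Integrable f := b.integrable_normed
  refine ⟨_, totallyBounded_mollify c n hfs.continuous hfc hf0 hf1 ħ μ ν, ?_, ?_⟩
  · rintro Y ⟨g, -, -, hsec, hY⟩
    exact Submodule.subset_span ⟨n, _, hsec, hY⟩
  · intro X hX hn hX1 hXA hXB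
    obtain ⟨g, hg, hgX, hgop, hq⟩ := exists_symbol_of_degree hX hn
    have hg1 : ∀ x y, ‖g x y‖ ≤ 1 := fun x y => (hgX x y).trans hX1
    have hsec := isSection_mollify hfs hfc hg hg1 hq
    obtain ⟨Y, hY⟩ := hsec.exists_isOp ħ μ ν
    refine ⟨Y, ⟨g, hg, hg1, hsec, hY⟩, ?_⟩
    refine (hgop.sub hY).norm_le_of_ae hε.le ?_
    refine ae_norm_sub_mollify_le hfi hf0 hf1 hfs.continuous.measurable hg hg1 fun w hw => ?_
    have hwb : w ∈ Metric.ball ((δ / 2, δ / 2) : ℝ × ℝ) (δ / 2) := by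
      have : w ∈ Function.support f := hw
      rwa [hf, b.support_normed_eq] at this
    rw [Metric.mem_ball, Prod.dist_eq, max_lt_iff, Real.dist_eq, Real.dist_eq, abs_lt, abs_lt] at hwb
    obtain ⟨⟨h1, h2⟩, h3, h4⟩ := hwb
    have hw1 : 0 < w.1 ∧ w.1 ≤ δ := ⟨by linarith, by linarith⟩
    have hw2 : 0 < w.2 ∧ w.2 ≤ δ := ⟨by linarith, by linarith⟩
    -- Translating in one variable after the other costs at most `δ ^ A + δ ^ B`; the bound passes
    -- to symbols by `IsOp.norm_symbol_le`.
    have h5 : ‖X - act c ħ μ 1 w.2 (act c ħ μ 0 w.1 X)‖ ≤ ε := by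
      calc _ = ‖(X - act c ħ μ 1 w.2 X) + act c ħ μ 1 w.2 (X - act c ħ μ 0 w.1 X)‖ := by
            rw [act_sub, sub_add_sub_cancel]
        _ ≤ w.2 ^ B + w.1 ^ A := by
            refine (norm_add_le _ _).trans (add_le_add ?_ ?_)
            · simpa using hXB _ hw2.1
            · rw [norm_act]; simpa using hXA _ hw1.1
        _ ≤ δ ^ B + δ ^ A := add_le_add (Real.rpow_le_rpow hw2.1.le hw2.2 hB.le)
            (Real.rpow_le_rpow hw1.1.le hw1.2 hA.le)
        _ ≤ ε := by linarith
    have h6 := hgop.sub ((hgop.act (c := c) 0 w.1).act (c := c) 1 w.2)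
    have hm : Measurable (Function.uncurry fun x y => g x y -
        twist c n 1 w.2 (twist c n 0 w.1 g) x y) := by
      have h7 : Measurable fun q : ℝ × UnitAddCircle => twistPhase c n w.2 q.1 :=
        (contDiff_twistPhase c n).continuous.measurable.comp
          (measurable_const.prodMk measurable_fst)
      exact hg.sub (h7.mul (hg.comp ((measurable_fst.sub measurable_const).prodMk
        (measurable_snd.sub measurable_const))))
    filter_upwards [h6.norm_symbol_le hm] with q hq
    exact hq.trans h5

/-! ### Compactness of the unit ball of the Hölder algebra -/

/-- The operators in the unit ball of the Hölder algebra. -/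
def holderBall (c : ℕ) (ħ μ ν A B C : ℝ) : Set BH :=
  {X | X ∈ N c ħ μ ν ∧ ‖X‖ ≤ 1 ∧ ∀ i : Fin 3, ∀ t > 0,
    ‖X - act c ħ μ i t X‖ ≤ 1 * t ^ (![A, B, C] i)}

lemma exists_holderBall_approx (c : ℕ) (ħ μ ν : ℝ) {A B C ε : ℝ} (hA : 0 < A) (hB : 0 < B)
    (hC : C ∈ Set.Ioc (0 : ℝ) 1) (hε : 0 < ε) :
    ∃ S : Set BH, TotallyBounded S ∧ S ⊆ monomialSpan c ħ μ ν ∧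
      ∀ X ∈ holderBall c ħ μ ν A B C, ∃ Y ∈ S, ‖X - Y‖ ≤ ε := by
  obtain ⟨j, m, a, ha⟩ := exists_component_approx c ħ μ hC (half_pos hε)
  set M := ∑ k ∈ Finset.range m, ‖a k‖ with hM
  have hM0 : 0 ≤ M := Finset.sum_nonneg fun _ _ => norm_nonneg _
  -- The components enter with total weight `M`; the added `1` covers the case `M = 0`.
  have hη : 0 < ε / 2 / (M + 1) := by positivity
  choose S hS hSV hSX using fun k : ℕ => exists_degree_approx c ħ μ ν ((j : ℤ) - k) hA hB hη
  obtain ⟨T, hT, hTV, hTY⟩ := exists_totallyBounded_sum S hS _ hSV a m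
  refine ⟨T, hT, hTV, fun X ⟨hX, hX1, hXh⟩ => ?_⟩
  have hc := continuous_act hC.1 (hXh 2)
  have hY : ∀ k : ℕ, ∃ Y ∈ S k, ‖component c ħ μ ((j : ℤ) - k) X - Y‖ ≤ ε / 2 / (M + 1) := fun k => by
    refine hSX k _ (component_mem_N hX hc _) (fun t => ?_) ((norm_component_le _ _ _ _ _).trans hX1)
      (fun r hr => (norm_component_sub_act_le hc _ _ _).trans (hXh 0 r hr))
      (fun s hs => (norm_component_sub_act_le hc _ _ _).trans (hXh 1 s hs))
    exact act_component hc _ t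
  choose Y hYS hYX using hY
  refine ⟨_, hTY Y hYS, ?_⟩
  have h1 : ‖∑ k ∈ Finset.range m, a k • component c ħ μ ((j : ℤ) - k) X -
      ∑ k ∈ Finset.range m, a k • Y k‖ ≤ ε / 2 := by
    rw [← Finset.sum_sub_distrib]
    calc _ ≤ ∑ k ∈ Finset.range m, ‖a k‖ * (ε / 2 / (M + 1)) := by
          refine norm_sum_le_of_le _ fun k _ => ?_
          rw [← smul_sub, norm_smul]
          exact mul_le_mul_of_nonneg_left (hYX k) (norm_nonneg _)
      _ = M * (ε / 2 / (M + 1)) := by rw [← Finset.sum_mul]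
      _ ≤ (M + 1) * (ε / 2 / (M + 1)) := mul_le_mul_of_nonneg_right (by linarith) hη.le
      _ = ε / 2 := mul_div_cancel₀ _ (by positivity)
  have h2 := norm_sub_le_norm_sub_add_norm_sub X
    (∑ k ∈ Finset.range m, a k • component c ħ μ ((j : ℤ) - k) X)
    (∑ k ∈ Finset.range m, a k • Y k)
  linarith [ha X (hXh 2)]

lemma isClosed_holderBall (c : ℕ) (ħ μ ν A B C : ℝ) : IsClosed (holderBall c ħ μ ν A B C) := by
  have h : holderBall c ħ μ ν A B C = (N c ħ μ ν : Set BH) ∩ ({X | ‖X‖ ≤ 1} ∩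
      ⋂ (i : Fin 3) (t : ℝ) (_ : t > 0), {X | ‖X - act c ħ μ i t X‖ ≤ 1 * t ^ (![A, B, C] i)}) := by
    ext X
    simp [holderBall]
  rw [h]
  refine (isClosed_N c ħ μ ν).inter ((isClosed_le continuous_norm continuous_const).inter
    (isClosed_iInter fun i => isClosed_iInter fun t => isClosed_iInter fun _ =>
      isClosed_le ?_ continuous_const))
  exact (continuous_id.sub (actL c ħ μ i t).continuous).norm

lemma isCompact_holderBall (c : ℕ) (ħ μ ν : ℝ) {A B C : ℝ} (hA : 0 < A) (hB : 0 < B)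
    (hC : C ∈ Set.Ioc (0 : ℝ) 1) : IsCompact (holderBall c ħ μ ν A B C) := by
  refine (totallyBounded_of_approx fun ε hε => ?_).isCompact_of_isClosed
    (isClosed_holderBall c ħ μ ν A B C)
  obtain ⟨S, hS, -, h⟩ := exists_holderBall_approx c ħ μ ν hA hB hC hε
  exact ⟨S, hS, fun X hX => by simpa only [dist_eq_norm] using h X hX⟩

lemma holderBall_subset_D (c : ℕ) (ħ μ ν : ℝ) {A B C : ℝ} (hA : 0 < A) (hB : 0 < B)
    (hC : C ∈ Set.Ioc (0 : ℝ) 1) : holderBall c ħ μ ν A B C ⊆ D c ħ μ ν := fun X hX => by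
  refine Metric.mem_closure_iff.2 fun ε hε => ?_
  obtain ⟨S, -, hS, h⟩ := exists_holderBall_approx c ħ μ ν hA hB hC (half_pos hε)
  obtain ⟨Y, hY, hXY⟩ := h X hX
  exact ⟨Y, monomialSpan_le_schwartzOps c ħ μ ν (hS hY), by
    rw [dist_eq_norm]; exact hXY.trans_lt (half_lt_self hε)⟩

lemma holder_le_D (c : ℕ) (ħ μ ν : ℝ) {A B C : ℝ} (hA : 0 < A) (hB : 0 < B)
    (hC : C ∈ Set.Ioc (0 : ℝ) 1) : holder c ħ μ ν A B C ≤ D c ħ μ ν := by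
  rintro X ⟨hX, K, hK⟩
  rw [isHolderConst_iff] at hK
  set r : ℝ := ‖X‖ + K + 1 with hr
  have hr0 : 0 < r := by have := hK.1; positivity
  have hrC : (r : ℂ) ≠ 0 := by exact_mod_cast hr0.ne'
  have hmem : ((r : ℂ)⁻¹) • X ∈ holderBall c ħ μ ν A B C := by
    have hn : ‖(r : ℂ)⁻¹‖ = r⁻¹ := by
      rw [norm_inv, Complex.norm_of_nonneg hr0.le]
    refine ⟨Submodule.smul_mem _ _ hX, ?_, fun i t ht => ?_⟩
    · rw [norm_smul, hn, inv_mul_le_iff₀ hr0]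
      linarith [hK.1]
    · rw [act_smul, ← smul_sub, norm_smul, hn, inv_mul_le_iff₀ hr0, one_mul]
      refine (hK.2 i t ht).trans (mul_le_mul_of_nonneg_right ?_ (Real.rpow_nonneg ht.le _))
      linarith [norm_nonneg X]
  have := Submodule.smul_mem (D c ħ μ ν) (r : ℂ) (holderBall_subset_D c ħ μ ν hA hB hC hmem)
  rwa [smul_inv_smul₀ hrC] at this

/-! ### Spaces whose unit ball is compact in a weaker norm are dual spaces -/

section Predual

variable {X E : Type*} [NormedAddCommGroup X] [NormedSpace ℂ X] [NormedAddCommGroup E]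
  [NormedSpace ℂ E]

/-- The functionals on `X` that are continuous on the unit ball for the norm of `E`. -/
def predual (j : X →ₗ[ℂ] E) : Submodule ℂ (StrongDual ℂ X) where
  carrier := {f | ∀ ε > 0, ∃ K : ℝ, ∀ x, ‖f x‖ ≤ ε * ‖x‖ + K * ‖j x‖}
  add_mem' := by
    intro f g hf hg ε hε
    obtain ⟨K, hK⟩ := hf (ε / 2) (half_pos hε)
    obtain ⟨M, hM⟩ := hg (ε / 2) (half_pos hε)
    refine ⟨K + M, fun x => ?_⟩
    have h1 : ‖(f + g) x‖ ≤ ‖f x‖ + ‖g x‖ := norm_add_le _ _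
    linarith [hK x, hM x]
  zero_mem' := fun ε hε => ⟨0, fun x => by simp; positivity⟩
  smul_mem' := by
    intro a f hf ε hε
    obtain ⟨K, hK⟩ := hf (ε / (‖a‖ + 1)) (by positivity)
    refine ⟨‖a‖ * K, fun x => ?_⟩
    have h1 : ‖(a • f) x‖ = ‖a‖ * ‖f x‖ := norm_smul a (f x)
    have h2 : ‖a‖ * (ε / (‖a‖ + 1)) ≤ ε := by
      rw [mul_div_assoc', div_le_iff₀ (by positivity)]
      nlinarith [norm_nonneg a]
    rw [h1]
    calc ‖a‖ * ‖f x‖ ≤ ‖a‖ * (ε / (‖a‖ + 1) * ‖x‖ + K * ‖j x‖) :=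
          mul_le_mul_of_nonneg_left (hK x) (norm_nonneg a)
      _ = ‖a‖ * (ε / (‖a‖ + 1)) * ‖x‖ + ‖a‖ * K * ‖j x‖ := by ring
      _ ≤ _ := by gcongr

/-- The free term `ε‖x‖` in the definition absorbs a perturbation of small norm; a bound by `K‖j x‖`
alone would not survive limits. -/
lemma isClosed_predual (j : X →ₗ[ℂ] E) : IsClosed (predual j : Set (StrongDual ℂ X)) := by
  refine isClosed_of_closure_subset fun f hf ε hε => ?_
  obtain ⟨g, hg, hfg⟩ := Metric.mem_closure_iff.1 hf (ε / 2) (half_pos hε)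
  obtain ⟨K, hK⟩ := hg (ε / 2) (half_pos hε)
  refine ⟨K, fun x => ?_⟩
  have h1 : ‖f x - g x‖ ≤ ‖f - g‖ * ‖x‖ := (f - g).le_opNorm x
  have h2 : ‖f x‖ ≤ ‖f x - g x‖ + ‖g x‖ := by
    simpa using norm_add_le (f x - g x) (g x)
  rw [dist_eq_norm] at hfg
  nlinarith [hK x, norm_nonneg x]

/-- The closed subspace `predual j` as a Banach space. -/
def Predual (j : X →ₗ[ℂ] E) : Type _ := predual j

instance (j : X →ₗ[ℂ] E) : NormedAddCommGroup (Predual j) :=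
  inferInstanceAs (NormedAddCommGroup (predual j))

instance (j : X →ₗ[ℂ] E) : NormedSpace ℂ (Predual j) :=
  inferInstanceAs (NormedSpace ℂ (predual j))

instance (j : X →ₗ[ℂ] E) : CompleteSpace (Predual j) :=
  (isClosed_predual j).completeSpace_coe

/-- The inclusion of `Predual j` in the dual of `X`. -/
def Predual.incl (j : X →ₗ[ℂ] E) : Predual j →L[ℂ] StrongDual ℂ X := (predual j).subtypeL

lemma Predual.exists_norm_le {j : X →ₗ[ℂ] E} (f : Predual j) {ε : ℝ} (hε : 0 < ε) :
    ∃ K : ℝ, ∀ x, ‖Predual.incl j f x‖ ≤ ε * ‖x‖ + K * ‖j x‖ := f.2 ε hε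

/-- An element of `predual j` as a point of `Predual j`. -/
def Predual.mk {j : X →ₗ[ℂ] E} (f : StrongDual ℂ X) (hf : f ∈ predual j) : Predual j := ⟨f, hf⟩

/-- The canonical map from `X` to the dual of `predual j`. -/
def toBidual (j : X →ₗ[ℂ] E) : X →ₗ[ℂ] StrongDual ℂ (Predual j) where
  toFun x := (ContinuousLinearMap.apply ℂ ℂ x).comp (Predual.incl j)
  map_add' x y := by ext f; exact map_add (Predual.incl j f) x y
  map_smul' a x := by ext f; exact map_smul (Predual.incl j f) a x

lemma toBidual_apply (j : X →ₗ[ℂ] E) (x : X) (f : Predual j) :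
    toBidual j x f = (Predual.incl j f) x := rfl

lemma norm_toBidual_le (j : X →ₗ[ℂ] E) (x : X) : ‖toBidual j x‖ ≤ ‖x‖ := by
  refine ContinuousLinearMap.opNorm_le_bound _ (norm_nonneg x) fun f => ?_
  rw [toBidual_apply, mul_comm]
  exact (Predual.incl j f).le_opNorm x

/-- These functionals already separate the points of `X`, because `j` is injective. -/
lemma comp_mem_predual {j : X →ₗ[ℂ] E} {M : ℝ} (hj : ∀ x, ‖j x‖ ≤ M * ‖x‖) (φ : StrongDual ℂ E) :
    φ.comp (j.mkContinuous M hj) ∈ predual j := fun ε hε => by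
  refine ⟨‖φ‖, fun x => ?_⟩
  have h : ‖φ (j x)‖ ≤ ‖φ‖ * ‖j x‖ := φ.le_opNorm _
  have : 0 ≤ ε * ‖x‖ := by positivity
  change ‖φ (j x)‖ ≤ _
  linarith

lemma toBidual_injective {j : X →ₗ[ℂ] E} (hinj : Function.Injective j) {M : ℝ}
    (hj : ∀ x, ‖j x‖ ≤ M * ‖x‖) : Function.Injective (toBidual j) := by
  refine (injective_iff_map_eq_zero (toBidual j)).2 fun x hx => ?_
  have h : j x = 0 := by
    rw [SeparatingDual.eq_zero_iff_forall_dual_eq_zero (R := ℂ)]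
    intro φ
    exact congrArg (fun L : StrongDual ℂ (Predual j) => L (.mk _ (comp_mem_predual hj φ))) hx
  exact hinj (h.trans (map_zero j).symm)

/-- Elements of the predual are continuous on the ball for the norm of `E`. So the ball in the weak*
topology is a continuous image of the compact set `j '' closedBall 0 1`. -/
lemma isCompact_toBidual_image {j : X →ₗ[ℂ] E} (hinj : Function.Injective j)
    (hc : IsCompact (j '' Metric.closedBall 0 1)) :
    IsCompact ((fun x => StrongDual.toWeakDual (toBidual j x)) '' Metric.closedBall 0 1) := by
  have hS : CompactSpace (j '' Metric.closedBall 0 1) := isCompact_iff_compactSpace.1 hc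
  choose s hs1 hs2 using fun e : j '' Metric.closedBall 0 1 => e.2
  have hcont : Continuous fun e => StrongDual.toWeakDual (toBidual j (s e)) := by
    refine WeakDual.continuous_of_continuous_eval fun f => ?_
    change Continuous fun e => (Predual.incl j f) (s e)
    rw [Metric.continuous_iff]
    intro e ε hε
    -- Two points of the ball are at distance at most `2`, so this term contributes at most `ε / 2`.
    obtain ⟨K, hK⟩ := f.exists_norm_le (ε := ε / 4) (by positivity)
    refine ⟨ε / 2 / (|K| + 1), by positivity, fun e' he' => ?_⟩
    have h1 := hK (s e' - s e)
    have h2 : ‖s e' - s e‖ ≤ 2 := by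
      have h3 := mem_closedBall_zero_iff.1 (hs1 e)
      have h4 := mem_closedBall_zero_iff.1 (hs1 e')
      linarith [norm_sub_le (s e') (s e)]
    have h5 : ‖j (s e' - s e)‖ = dist e' e := by
      rw [map_sub, hs2, hs2, ← dist_eq_norm]; rfl
    rw [h5] at h1
    rw [lt_div_iff₀ (by positivity)] at he'
    rw [dist_eq_norm, ← map_sub]
    have h6 : K * dist e' e ≤ dist e' e * (|K| + 1) := by
      nlinarith [le_abs_self K, dist_nonneg (x := e') (y := e)]
    have h7 : ε / 4 * ‖s e' - s e‖ ≤ ε / 4 * 2 := by gcongr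
    linarith
  have heq : (fun x => StrongDual.toWeakDual (toBidual j x)) '' Metric.closedBall 0 1 =
      Set.range fun e => StrongDual.toWeakDual (toBidual j (s e)) := by
    ext Λ
    constructor
    · rintro ⟨x, hx, rfl⟩
      refine ⟨⟨j x, x, hx, rfl⟩, ?_⟩
      have : s ⟨j x, x, hx, rfl⟩ = x := hinj (hs2 _)
      simp only [this]
    · rintro ⟨e, rfl⟩
      exact ⟨s e, hs1 e, rfl⟩
  rw [heq]
  exact isCompact_range hcont

lemma norm_le_of_forall_re_le (f : StrongDual ℂ X) {u : ℝ}
    (h : ∀ x ∈ Metric.closedBall (0 : X) 1, (f x).re ≤ u) : ‖f‖ ≤ u := by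
  have h0 : 0 ≤ u := by simpa using h 0 (by simp)
  refine ContinuousLinearMap.opNorm_le_bound _ h0 fun x => ?_
  by_cases h1 : f x = 0
  · rw [h1, norm_zero]; positivity
  have hx : 0 < ‖x‖ := norm_pos_iff.2 fun h2 => h1 (by rw [h2, map_zero])
  have hf : 0 < ‖f x‖ := norm_pos_iff.2 h1
  -- The scalar normalises `x` and rotates `f x` onto the positive real axis.
  have h2 := h (((‖x‖⁻¹ : ℝ) * ((starRingEnd ℂ (f x)) * (‖f x‖⁻¹ : ℝ)) : ℂ) • x) (by
    rw [mem_closedBall_zero_iff, norm_smul, norm_mul, norm_mul, RCLike.norm_conj,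
      Complex.norm_real, Complex.norm_real, norm_inv, norm_inv, norm_norm, norm_norm,
      mul_inv_cancel₀ hf.ne', mul_one, inv_mul_cancel₀ hx.ne'])
  have h3 : f (((‖x‖⁻¹ : ℝ) * ((starRingEnd ℂ (f x)) * (‖f x‖⁻¹ : ℝ)) : ℂ) • x) =
      ((‖x‖⁻¹ * ‖f x‖ : ℝ) : ℂ) := by
    rw [map_smul, smul_eq_mul]
    have : starRingEnd ℂ (f x) * f x = ((‖f x‖ ^ 2 : ℝ) : ℂ) := by
      rw [Complex.conj_mul']; push_cast; rfl
    calc _ = ((‖x‖⁻¹ : ℝ) : ℂ) * (‖f x‖⁻¹ : ℝ) * (starRingEnd ℂ (f x) * f x) := by ring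
      _ = _ := by
        rw [this, ← Complex.ofReal_mul, ← Complex.ofReal_mul]
        congr 1
        field_simp
  rwa [h3, Complex.ofReal_re, inv_mul_le_iff₀ hx, mul_comm] at h2

/-- The image of the ball is convex and weak*-compact. A functional `Λ` outside it would be
separated from it by evaluation at some `f` in the predual, giving `‖f‖ ≤ u < Re (Λ f) ≤ ‖f‖`. -/
lemma exists_toBidual_eq {j : X →ₗ[ℂ] E} (hinj : Function.Injective j)
    (hc : IsCompact (j '' Metric.closedBall 0 1)) (Λ : StrongDual ℂ (Predual j)) (hΛ : ‖Λ‖ ≤ 1) :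
    ∃ x, ‖x‖ ≤ 1 ∧ toBidual j x = Λ := by
  by_contra! hne
  have hmem : StrongDual.toWeakDual Λ ∉
      (fun x => StrongDual.toWeakDual (toBidual j x)) '' Metric.closedBall 0 1 := by
    rintro ⟨x, hx, h⟩
    exact hne x (mem_closedBall_zero_iff.1 hx) (StrongDual.toWeakDual.injective h)
  let T : X → WeakBilin (topDualPairing ℂ (Predual j)) := fun x => toBidual j x
  let Λ' : WeakBilin (topDualPairing ℂ (Predual j)) := Λ
  have hconv : Convex ℝ (T '' Metric.closedBall 0 1) :=
    (convex_closedBall (0 : X) 1).is_linear_image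
      ⟨fun x y => map_add (toBidual j) x y, fun a x => (toBidual j).map_smul (a : ℂ) x⟩
  have hclosed : IsClosed (T '' Metric.closedBall 0 1) :=
    (isCompact_toBidual_image hinj hc).isClosed
  have hmem' : Λ' ∉ T '' Metric.closedBall 0 1 := hmem
  obtain ⟨g, u, hg, hu⟩ := RCLike.geometric_hahn_banach_closed_point (𝕜 := ℂ) hconv hclosed hmem'
  obtain ⟨f, rfl⟩ := LinearMap.dualEmbedding_surjective _ g
  have h1 : ‖(Predual.incl j f)‖ ≤ u :=
    norm_le_of_forall_re_le _ fun x hx => (hg (T x) ⟨x, hx, rfl⟩).le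
  have h2 : u < (Λ f).re := hu
  have h3 : (Λ f).re ≤ ‖Λ f‖ := Complex.re_le_norm _
  have h4 : ‖Λ f‖ ≤ ‖Λ‖ * ‖f‖ := Λ.le_opNorm f
  have h5 : ‖f‖ = ‖(Predual.incl j f)‖ := rfl
  nlinarith [norm_nonneg f]

/-- The identification of `X` with the dual of `predual j`. -/
def dualEquiv {j : X →ₗ[ℂ] E} (hinj : Function.Injective j) {M : ℝ}
    (hj : ∀ x, ‖j x‖ ≤ M * ‖x‖) (hc : IsCompact (j '' Metric.closedBall 0 1)) :
    X ≃ₗᵢ[ℂ] StrongDual ℂ (Predual j) :=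
  LinearIsometryEquiv.ofSurjective
    { toLinearMap := toBidual j
      norm_map' := fun x => by
        refine le_antisymm (norm_toBidual_le j x) ?_
        by_cases h0 : toBidual j x = 0
        · have : x = 0 := toBidual_injective hinj hj (h0.trans (map_zero _).symm)
          simp [this]
        · have hpos : 0 < ‖toBidual j x‖ := norm_pos_iff.2 h0
          have hn : ‖((‖toBidual j x‖⁻¹ : ℝ) : ℂ)‖ = ‖toBidual j x‖⁻¹ := by
            rw [Complex.norm_real, norm_inv, norm_norm]
          -- A preimage of norm at most one of the normalised image of `x` must, by injectivity, be
          -- the rescaled `x`; this bounds `‖x‖` from above.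
          obtain ⟨y, hy, hyx⟩ := exists_toBidual_eq hinj hc
            (((‖toBidual j x‖⁻¹ : ℝ) : ℂ) • toBidual j x)
            (by rw [norm_smul, hn, inv_mul_cancel₀ hpos.ne'])
          rw [← map_smul] at hyx
          have hy' := toBidual_injective hinj hj hyx
          rw [hy', norm_smul, hn, inv_mul_le_iff₀ hpos, mul_one] at hy
          exact hy }
    (fun Λ => by
      by_cases h0 : Λ = 0
      · exact ⟨0, by rw [h0]; exact map_zero _⟩
      · have hpos : 0 < ‖Λ‖ := norm_pos_iff.2 h0
        obtain ⟨y, -, hy⟩ := exists_toBidual_eq hinj hc (((‖Λ‖⁻¹ : ℝ) : ℂ) • Λ) (by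
          rw [norm_smul, Complex.norm_real, norm_inv, norm_norm, inv_mul_cancel₀ hpos.ne'])
        refine ⟨((‖Λ‖ : ℝ) : ℂ) • y, ?_⟩
        change toBidual j _ = _
        rw [map_smul, hy, smul_smul, ← Complex.ofReal_mul, mul_inv_cancel₀ hpos.ne',
          Complex.ofReal_one, one_smul])

/-- A bounded operator on `X` that is also bounded for the norm of `E` is weak*-continuous. -/
lemma continuous_dualEquiv_conj {j : X →ₗ[ℂ] E} (hinj : Function.Injective j) {M : ℝ}
    (hj : ∀ x, ‖j x‖ ≤ M * ‖x‖) (hc : IsCompact (j '' Metric.closedBall 0 1)) (R : X →ₗ[ℂ] X)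
    {a b : ℝ} (ha : ∀ x, ‖R x‖ ≤ a * ‖x‖) (hb : ∀ x, ‖j (R x)‖ ≤ b * ‖j x‖) :
    Continuous fun φ : WeakDual ℂ (Predual j) => StrongDual.toWeakDual
      (dualEquiv hinj hj hc (R ((dualEquiv hinj hj hc).symm (WeakDual.toStrongDual φ)))) := by
  refine WeakDual.continuous_of_continuous_eval fun f => ?_
  -- Precomposition with `R` preserves the predual, so evaluating at `f` after `R` is evaluation at
  -- the fixed element `f ∘ R`.
  have hf : (Predual.incl j f).comp (R.mkContinuous a ha) ∈ predual j := fun ε hε => by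
    obtain ⟨K, hK⟩ := f.exists_norm_le (ε := ε / (|a| + 1)) (by positivity)
    refine ⟨|K| * |b|, fun x => ?_⟩
    change ‖(Predual.incl j f) (R x)‖ ≤ _
    have h1 : ‖R x‖ ≤ (|a| + 1) * ‖x‖ :=
      (ha x).trans (by gcongr; linarith [le_abs_self a])
    have h2 : ‖j (R x)‖ ≤ |b| * ‖j x‖ := (hb x).trans (by gcongr; exact le_abs_self b)
    calc _ ≤ ε / (|a| + 1) * ‖R x‖ + K * ‖j (R x)‖ := hK _
      _ ≤ ε / (|a| + 1) * ((|a| + 1) * ‖x‖) + |K| * (|b| * ‖j x‖) := by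
        gcongr
        exact le_abs_self K
      _ = _ := by field_simp
  refine (WeakDual.eval_continuous (𝕜 := ℂ) (Predual.mk _ hf)).congr fun φ => ?_
  change φ (Predual.mk _ hf) = (Predual.incl j f) (R _)
  conv_lhs => rw [← WeakDual.toStrongDual_apply,
    ← (dualEquiv hinj hj hc).apply_symm_apply (WeakDual.toStrongDual φ)]
  rfl

end Predual

/-! ### The Hölder algebra as a dual Banach algebra -/

section Algebra

variable {c : ℕ} {ħ μ ν A B C : ℝ}

/-- This twisted Leibniz rule underlies both the derivation property and the submultiplicativity up
to a factor `2`, one for each term. -/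
lemma mul_sub_act_mul (c : ℕ) (ħ μ : ℝ) (i : Fin 3) (t : ℝ) (x y : BH) :
    x * y - act c ħ μ i t (x * y) =
      x * (y - act c ħ μ i t y) + (x - act c ħ μ i t x) * act c ħ μ i t y := by
  rw [act_mul]
  noncomm_ring

lemma IsHolderConst.mul {x y : BH} {K M : ℝ} (hx : IsHolderConst c ħ μ A B C x K)
    (hy : IsHolderConst c ħ μ A B C y M) :
    IsHolderConst c ħ μ A B C (x * y) (‖x‖ * M + K * ‖y‖) := by
  rw [isHolderConst_iff] at *
  have := hx.1
  have := hy.1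
  refine ⟨by positivity, fun i t ht => ?_⟩
  rw [mul_sub_act_mul]
  calc _ ≤ ‖x‖ * ‖y - act c ħ μ i t y‖ + ‖x - act c ħ μ i t x‖ * ‖act c ħ μ i t y‖ :=
        (norm_add_le _ _).trans (add_le_add (norm_mul_le _ _) (norm_mul_le _ _))
    _ ≤ ‖x‖ * (M * t ^ (![A, B, C] i)) + K * t ^ (![A, B, C] i) * ‖y‖ := by
        rw [norm_act]
        gcongr
        exacts [hy.2 i t ht, hx.2 i t ht]
    _ = _ := by ring

lemma mul_mem_holder {x y : BH} (hx : x ∈ holder c ħ μ ν A B C) (hy : y ∈ holder c ħ μ ν A B C) :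
    x * y ∈ holder c ħ μ ν A B C := by
  obtain ⟨hx, K, hK⟩ := hx
  obtain ⟨hy, M, hM⟩ := hy
  exact ⟨mul_mem_N hx hy, _, hK.mul hM⟩

lemma Holder.incl_injective : Function.Injective (Holder.incl c ħ μ ν A B C) :=
  Subtype.val_injective

/-- The operator product on the Hölder algebra. -/
def Holder.mul (c : ℕ) (ħ μ ν A B C : ℝ) :
    Holder c ħ μ ν A B C →ₗ[ℂ] Holder c ħ μ ν A B C →ₗ[ℂ] Holder c ħ μ ν A B C :=
  LinearMap.mk₂ ℂ (fun x y => ⟨_, mul_mem_holder x.2 y.2⟩)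
    (fun _ _ _ => Subtype.ext (add_mul _ _ _)) (fun _ _ _ => Subtype.ext (smul_mul_assoc _ _ _))
    (fun _ _ _ => Subtype.ext (mul_add _ _ _)) (fun _ _ _ => Subtype.ext (mul_smul_comm _ _ _))

lemma Holder.incl_mul (x y : Holder c ħ μ ν A B C) :
    Holder.incl c ħ μ ν A B C (Holder.mul c ħ μ ν A B C x y) =
      Holder.incl c ħ μ ν A B C x * Holder.incl c ħ μ ν A B C y := rfl

lemma Holder.norm_incl_le (x : Holder c ħ μ ν A B C) : ‖Holder.incl c ħ μ ν A B C x‖ ≤ ‖x‖ :=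
  le_max_left _ _

lemma Holder.norm_mul_le (x y : Holder c ħ μ ν A B C) :
    ‖Holder.mul c ħ μ ν A B C x y‖ ≤ 2 * ‖x‖ * ‖y‖ := by
  have hx := Holder.norm_incl_le x
  have hy := Holder.norm_incl_le y
  have hx' : holderConst c ħ μ A B C (Holder.incl c ħ μ ν A B C x) ≤ ‖x‖ := le_max_right _ _
  have hy' : holderConst c ħ μ A B C (Holder.incl c ħ μ ν A B C y) ≤ ‖y‖ := le_max_right _ _
  have h1 : ‖Holder.incl c ħ μ ν A B C x‖ * ‖Holder.incl c ħ μ ν A B C y‖ ≤ ‖x‖ * ‖y‖ := by gcongr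
  have h2 : ‖Holder.incl c ħ μ ν A B C x‖ * holderConst c ħ μ A B C (Holder.incl c ħ μ ν A B C y) ≤
      ‖x‖ * ‖y‖ := by
    gcongr
    exact y.isHolderConst.1
  have h3 : holderConst c ħ μ A B C (Holder.incl c ħ μ ν A B C x) * ‖Holder.incl c ħ μ ν A B C y‖ ≤
      ‖x‖ * ‖y‖ := by gcongr
  have h4 : 0 ≤ ‖x‖ * ‖y‖ := by positivity
  rw [Holder.norm_def (Holder.mul c ħ μ ν A B C x y), Holder.incl_mul]
  refine max_le ((_root_.norm_mul_le _ _).trans (by linarith)) ?_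
  exact (holderConst_le (x.isHolderConst.mul y.isHolderConst)).trans (by linarith)

/-- The smallest Hölder constant is attained, so `‖x‖ ≤ 1` means exactly that `1` is a Hölder
constant and that the operator norm is at most `1`. -/
lemma incl_image_closedBall :
    Holder.incl c ħ μ ν A B C '' Metric.closedBall 0 1 = holderBall c ħ μ ν A B C := by
  ext X
  constructor
  · rintro ⟨x, hx, rfl⟩
    rw [mem_closedBall_zero_iff, Holder.norm_def, max_le_iff] at hx
    refine ⟨x.2.1, hx.1, fun i t ht => ?_⟩
    have h := ((isHolderConst_iff ..).1 x.isHolderConst).2 i t ht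
    exact h.trans (mul_le_mul_of_nonneg_right hx.2 (Real.rpow_nonneg ht.le _))
  · rintro ⟨hX, hX1, hX2⟩
    have h : IsHolderConst c ħ μ A B C X 1 := (isHolderConst_iff ..).2 ⟨zero_le_one, hX2⟩
    let x : Holder c ħ μ ν A B C := ⟨X, hX, 1, h⟩
    refine ⟨x, ?_, rfl⟩
    rw [mem_closedBall_zero_iff, Holder.norm_def]
    exact max_le hX1 (holderConst_le h)

lemma exists_predual (hA : 0 < A) (hB : 0 < B) (hC : C ∈ Set.Ioc (0 : ℝ) 1) :
    ∃ (P : Type) (_ : NormedAddCommGroup P) (_ : NormedSpace ℂ P) (_ : CompleteSpace P)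
      (Ψ : Holder c ħ μ ν A B C ≃ₗᵢ[ℂ] StrongDual ℂ P), ∀ y,
      (Continuous fun φ : WeakDual ℂ P => StrongDual.toWeakDual
        (Ψ (Holder.mul c ħ μ ν A B C (Ψ.symm (WeakDual.toStrongDual φ)) y))) ∧
      (Continuous fun φ : WeakDual ℂ P => StrongDual.toWeakDual
        (Ψ (Holder.mul c ħ μ ν A B C y (Ψ.symm (WeakDual.toStrongDual φ))))) := by
  have hc : IsCompact (Holder.incl c ħ μ ν A B C '' Metric.closedBall 0 1) := by
    rw [incl_image_closedBall]
    exact isCompact_holderBall c ħ μ ν hA hB hC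
  have hj : ∀ x, ‖Holder.incl c ħ μ ν A B C x‖ ≤ 1 * ‖x‖ := fun x => by
    rw [one_mul]; exact Holder.norm_incl_le x
  refine ⟨Predual (Holder.incl c ħ μ ν A B C), inferInstance, inferInstance, inferInstance,
    dualEquiv Holder.incl_injective hj hc, fun y => ⟨?_, ?_⟩⟩
  · refine continuous_dualEquiv_conj Holder.incl_injective hj hc
      ((Holder.mul c ħ μ ν A B C).flip y) (a := 2 * ‖y‖) (b := ‖Holder.incl c ħ μ ν A B C y‖)
      (fun x => ?_) fun x => ?_
    · exact (Holder.norm_mul_le x y).trans_eq (by ring)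
    · rw [mul_comm]
      exact _root_.norm_mul_le (Holder.incl c ħ μ ν A B C x) _
  · exact continuous_dualEquiv_conj Holder.incl_injective hj hc (Holder.mul c ħ μ ν A B C y)
      (a := 2 * ‖y‖) (b := ‖Holder.incl c ħ μ ν A B C y‖) (fun x => Holder.norm_mul_le y x)
      fun x => _root_.norm_mul_le _ (Holder.incl c ħ μ ν A B C x)

lemma closure_holder (hA : A ∈ Set.Ioc (0 : ℝ) 1) (hB : B ∈ Set.Ioc (0 : ℝ) 1)
    (hC : C ∈ Set.Ioc (0 : ℝ) 1) :
    closure (holder c ħ μ ν A B C : Set BH) = (D c ħ μ ν : Set BH) :=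
  (closure_minimal (holder_le_D c ħ μ ν hA.1 hB.1 hC)
    (Submodule.isClosed_topologicalClosure _)).antisymm
    (closure_mono (schwartzOps_le_holder hA hB hC))

end Algebra

/-! ### The bimodule and the derivation -/

section Bimodule

variable {c : ℕ} {ħ μ ν A B C : ℝ}

lemma norm_F_apply_le (f : F c ħ μ ν) (t : {t : ℝ // 0 < t}) (i : Fin 3) :
    ‖(f t i : BH)‖ ≤ ‖f‖ :=
  (norm_le_pi_norm (f t) i).trans (lp.norm_apply_le_norm ENNReal.top_ne_zero f t)

lemma F_ext {f g : F c ħ μ ν} (h : ∀ t i, (f t i : BH) = g t i) : f = g :=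
  lp.ext (funext fun t => funext fun i => Subtype.ext (h t i))

/-- The element of `F` with prescribed bounded components. -/
def F.mk (g : {t : ℝ // 0 < t} → Fin 3 → N c ħ μ ν) {K : ℝ} (hg : ∀ t i, ‖(g t i : BH)‖ ≤ K) :
    F c ħ μ ν :=
  ⟨g, memℓp_infty_iff.2 ⟨K, by
    rintro _ ⟨t, rfl⟩
    exact (pi_norm_le_iff_of_nonneg ((norm_nonneg _).trans (hg t 0))).2 (hg t)⟩⟩

/-- The diagonal left action of `N_ħ` on `F`. -/
def leftAct (c : ℕ) (ħ μ ν : ℝ) : N c ħ μ ν →ₗ[ℂ] F c ħ μ ν →ₗ[ℂ] F c ħ μ ν :=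
  LinearMap.mk₂ ℂ
    (fun x f => F.mk (K := ‖(x : BH)‖ * ‖f‖)
      (fun t i => ⟨(x : BH) * (f t i : BH), mul_mem_N x.2 (f t i).2⟩) fun t i =>
        (norm_mul_le _ _).trans (mul_le_mul_of_nonneg_left (norm_F_apply_le f t i) (norm_nonneg _)))
    (fun _ _ _ => F_ext fun _ _ => add_mul _ _ _)
    (fun _ _ _ => F_ext fun _ _ => smul_mul_assoc _ _ _)
    (fun _ _ _ => F_ext fun _ _ => mul_add _ _ _)
    (fun _ _ _ => F_ext fun _ _ => mul_smul_comm _ _ _)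

lemma leftAct_apply (x : N c ħ μ ν) (f : F c ħ μ ν) (t : {t : ℝ // 0 < t}) (i : Fin 3) :
    (leftAct c ħ μ ν x f t i : BH) = (x : BH) * (f t i : BH) := rfl

/-- The right action of `N_ħ` on `F`, through the three actions. -/
def rightAct (c : ℕ) (ħ μ ν : ℝ) : N c ħ μ ν →ₗ[ℂ] F c ħ μ ν →ₗ[ℂ] F c ħ μ ν :=
  LinearMap.mk₂ ℂ
    (fun x f => F.mk (K := ‖f‖ * ‖(x : BH)‖)
      (fun t i => ⟨(f t i : BH) * act c ħ μ i (t : ℝ) (x : BH),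
        mul_mem_N (f t i).2 (act_mem_N x.2 i t)⟩) fun t i =>
        (norm_mul_le _ _).trans (by
          rw [norm_act]
          exact mul_le_mul_of_nonneg_right (norm_F_apply_le f t i) (norm_nonneg _)))
    (fun x y f => F_ext fun t i =>
      (congrArg ((f t i : BH) * ·) (act_add c ħ μ i t (x : BH) (y : BH))).trans (mul_add _ _ _))
    (fun a x f => F_ext fun t i =>
      (congrArg ((f t i : BH) * ·) (act_smul c ħ μ i t a (x : BH))).trans (mul_smul_comm _ _ _))
    (fun _ _ _ => F_ext fun _ _ => add_mul _ _ _)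
    (fun _ _ _ => F_ext fun _ _ => smul_mul_assoc _ _ _)

lemma rightAct_apply (x : N c ħ μ ν) (f : F c ħ μ ν) (t : {t : ℝ // 0 < t}) (i : Fin 3) :
    (rightAct c ħ μ ν x f t i : BH) = (f t i : BH) * act c ħ μ i (t : ℝ) (x : BH) := rfl

lemma norm_inv_rpow_smul_le {t a K : ℝ} (ht : 0 < t) {X : BH} (h : ‖X‖ ≤ K * t ^ a) :
    ‖(((t ^ a)⁻¹ : ℝ) : ℂ) • X‖ ≤ K := by
  have hpos : 0 < t ^ a := Real.rpow_pos_of_pos ht a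
  rwa [norm_smul, Complex.norm_real, Real.norm_of_nonneg (inv_nonneg.2 hpos.le),
    inv_mul_le_iff₀ hpos, mul_comm]

/-- The difference quotient derivation. -/
def diffQuot (c : ℕ) (ħ μ ν A B C : ℝ) : Holder c ħ μ ν A B C →ₗ[ℂ] F c ħ μ ν where
  toFun x := F.mk (K := holderConst c ħ μ A B C (Holder.incl c ħ μ ν A B C x))
    (fun t i => ⟨((((t : ℝ) ^ (![A, B, C] i))⁻¹ : ℝ) : ℂ) • (Holder.incl c ħ μ ν A B C x -
        act c ħ μ i (t : ℝ) (Holder.incl c ħ μ ν A B C x)),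
      Submodule.smul_mem _ _ (Submodule.sub_mem _ x.2.1 (act_mem_N x.2.1 i t))⟩)
    fun t i => norm_inv_rpow_smul_le t.2
      (((isHolderConst_iff ..).1 x.isHolderConst).2 i t t.2)
  map_add' x y := F_ext fun t i => by
    change _ • (Holder.incl c ħ μ ν A B C (x + y) - act c ħ μ i t (Holder.incl c ħ μ ν A B C (x + y)))
      = _ • (Holder.incl c ħ μ ν A B C x - _) + _ • (Holder.incl c ħ μ ν A B C y - _)
    rw [map_add, act_add, ← smul_add]
    congr 1
    abel
  map_smul' a x := F_ext fun t i => by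
    change _ • (Holder.incl c ħ μ ν A B C (a • x) - act c ħ μ i t (Holder.incl c ħ μ ν A B C (a • x)))
      = a • (_ • (Holder.incl c ħ μ ν A B C x - _))
    rw [map_smul, act_smul, ← smul_sub, smul_comm]

lemma diffQuot_apply (x : Holder c ħ μ ν A B C) (t : {t : ℝ // 0 < t}) (i : Fin 3) :
    (diffQuot c ħ μ ν A B C x t i : BH) = ((((t : ℝ) ^ (![A, B, C] i))⁻¹ : ℝ) : ℂ) •
      (Holder.incl c ħ μ ν A B C x - act c ħ μ i (t : ℝ) (Holder.incl c ħ μ ν A B C x)) := rfl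

lemma diffQuot_mul (x y : Holder c ħ μ ν A B C) :
    diffQuot c ħ μ ν A B C (Holder.mul c ħ μ ν A B C x y) =
      leftAct c ħ μ ν (Holder.toN c ħ μ ν A B C x) (diffQuot c ħ μ ν A B C y) +
        rightAct c ħ μ ν (Holder.toN c ħ μ ν A B C y) (diffQuot c ħ μ ν A B C x) := by
  refine F_ext fun t i => ?_
  change _ = (leftAct c ħ μ ν _ _ t i : BH) + (rightAct c ħ μ ν _ _ t i : BH)
  rw [leftAct_apply, rightAct_apply, diffQuot_apply, diffQuot_apply, diffQuot_apply,
    Holder.incl_mul, mul_sub_act_mul, smul_add, mul_smul_comm, smul_mul_assoc]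
  rfl

/-! ### Unboundedness of the derivation -/

lemma isSection_exp (c : ℕ) (n : ℕ) :
    IsSection c 0 fun x _ => Complex.exp (Complex.I * ((n * x : ℝ) : ℂ)) where
  smooth := (contDiff_const.mul (Complex.ofRealCLM.contDiff.comp (f := fun z : ℝ × ℝ => n * z.1)
    (contDiff_const.mul contDiff_fst))).cexp
  quasi m x y := by
    rw [← Complex.exp_add, Complex.exp_eq_exp_iff_exists_int]
    refine ⟨n * m, ?_⟩
    push_cast
    ring

/-- The degree zero operator with symbol `e^{inx}` changes sign under `α_{π/n}`, so its difference
quotient at `t = π/n` has norm `2(n/π)^A` times its own, which is unbounded in `n`. -/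
lemma isEmpty_bound_diffQuot (hA : A ∈ Set.Ioc (0 : ℝ) 1) (hB : B ∈ Set.Ioc (0 : ℝ) 1)
    (hC : C ∈ Set.Ioc (0 : ℝ) 1) :
    ¬ ∃ M : ℝ, ∀ x, ‖diffQuot c ħ μ ν A B C x‖ ≤ M * ‖Holder.incl c ħ μ ν A B C x‖ := by
  rintro ⟨M, hM⟩
  have key : ∀ n : ℕ, 0 < n → 2 * ((n : ℝ) / Real.pi) ^ A ≤ M := fun n hn => by
    have hn' : (0 : ℝ) < n := by exact_mod_cast hn
    have hs := isSection_exp c n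
    obtain ⟨T, hT⟩ := hs.exists_isOp ħ μ ν
    let x : Holder c ħ μ ν A B C := ⟨T, schwartzOps_le_holder hA hB hC (hT.mem_schwartzOps hs)⟩
    have hxT : Holder.incl c ħ μ ν A B C x = T := rfl
    have hpos : 0 < ‖T‖ := by
      obtain ⟨w, hw⟩ := (hT.norm_symbol_le hs.measurable).exists
      rw [norm_exp_I_mul] at hw
      linarith
    let t : {t : ℝ // 0 < t} := ⟨Real.pi / n, by positivity⟩
    have hact : act c ħ μ 0 t T = -T := by
      refine (hT.act 0 t).unique (T := -T) ?_
      have h1 := IsOp.smul hT (-1)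
      rw [neg_one_smul] at h1
      refine h1.congr (Filter.Eventually.of_forall fun z => ?_)
      change -1 * Complex.exp _ = Complex.exp _
      rw [← Complex.exp_pi_mul_I, ← Complex.exp_add, Complex.exp_eq_exp_iff_exists_int]
      refine ⟨1, ?_⟩
      have : (n : ℂ) ≠ 0 := by exact_mod_cast hn.ne'
      simp only [t]
      push_cast
      field_simp
      ring
    have h1 := (norm_F_apply_le (diffQuot c ħ μ ν A B C x) t 0).trans (hM x)
    rw [diffQuot_apply, hxT, hact, sub_neg_eq_add, ← two_smul ℂ, norm_smul, norm_smul,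
      Complex.norm_real, ← mul_assoc] at h1
    have h2 := le_of_mul_le_mul_right h1 hpos
    have h3 : ((n : ℝ) / Real.pi) ^ A = ((t : ℝ) ^ A)⁻¹ := by
      rw [← Real.inv_rpow t.2.le, inv_div]
    rw [h3, mul_comm]
    have h4 : 0 ≤ ((t : ℝ) ^ A)⁻¹ := inv_nonneg.2 (Real.rpow_nonneg t.2.le _)
    change ‖((t : ℝ) ^ A)⁻¹‖ * ‖(2 : ℂ)‖ ≤ M at h2
    rwa [Real.norm_of_nonneg h4, Complex.norm_ofNat] at h2
  have hlim : Filter.Tendsto (fun n : ℕ => ((n : ℝ) / Real.pi) ^ A) Filter.atTop Filter.atTop :=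
    (tendsto_rpow_atTop hA.1).comp (tendsto_natCast_atTop_atTop.atTop_div_const Real.pi_pos)
  obtain ⟨n, h1, h2⟩ := ((hlim.eventually_gt_atTop (M / 2)).and
    (Filter.eventually_gt_atTop 0)).exists
  have := key n h2
  linarith

/-! ### Weak*-closedness of the graph -/

/-- The element of `ℓ²(ℕ, H)` with a single nonzero entry. -/
def firstEntry (ξ : Hil) : lp (fun _ : ℕ => Hil) 2 := lp.single 2 0 ξ

lemma tsum_inner_firstEntry (ξ η : Hil) (T : ℕ → BH) :
    ∑' n, inner ℂ (firstEntry η n) (T n (firstEntry ξ n)) = inner ℂ η (T 0 ξ) := by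
  rw [tsum_eq_single 0 fun n hn => ?_]
  · simp [firstEntry]
  · have : firstEntry η n = 0 := lp.single_apply_ne (E := fun _ : ℕ => Hil) 2 0 η hn
    rw [this, inner_zero_left]

lemma continuous_weakStarN (ξ η : Hil) :
    @Continuous _ _ (weakStarN c ħ μ ν) _ fun x => inner ℂ η ((x : BH) ξ) := by
  refine continuous_iInf_dom (i := firstEntry ξ) (continuous_iInf_dom (i := firstEntry η) ?_)
  convert continuous_induced_dom using 2 with x
  exact (tsum_inner_firstEntry ξ η fun _ => (x : BH)).symm

lemma continuous_weakStarF (t : {t : ℝ // 0 < t}) (i : Fin 3) (ξ η : Hil) :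
    @Continuous _ _ (weakStarF c ħ μ ν) _ fun f => inner ℂ η ((f t i : BH) ξ) := by
  refine continuous_iInf_dom (i := fun _ => t) (continuous_iInf_dom (i := fun _ => i)
    (continuous_iInf_dom (i := firstEntry ξ) (continuous_iInf_dom (i := firstEntry η) ?_)))
  convert continuous_induced_dom using 2 with f
  exact (tsum_inner_firstEntry ξ η fun _ => (f t i : BH)).symm

lemma continuous_weakStarNF_fst (ξ η : Hil) :
    @Continuous _ _ (weakStarNF c ħ μ ν) _ fun z => inner ℂ η ((z.1 : BH) ξ) := by
  have h := @Continuous.comp _ _ _ ((weakStarN c ħ μ ν).induced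
    (Prod.fst : N c ħ μ ν × F c ħ μ ν → _)) (weakStarN c ħ μ ν) _ _ _
    (continuous_weakStarN ξ η) continuous_induced_dom
  exact continuous_le_dom inf_le_left h

lemma continuous_weakStarNF_snd (t : {t : ℝ // 0 < t}) (i : Fin 3) (ξ η : Hil) :
    @Continuous _ _ (weakStarNF c ħ μ ν) _ fun z => inner ℂ η ((z.2 t i : BH) ξ) := by
  have h := @Continuous.comp _ _ _ ((weakStarF c ħ μ ν).induced
    (Prod.snd : N c ħ μ ν × F c ħ μ ν → _)) (weakStarF c ħ μ ν) _ _ _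
    (continuous_weakStarF t i ξ η) continuous_induced_dom
  exact continuous_le_dom inf_le_right h

lemma isClosed_of_forall_eq {Z ι : Type*} [TopologicalSpace Z] {S : Set Z} (s : ι → ℂ)
    {a p q : ι → Z → ℂ} (ha : ∀ k, Continuous (a k)) (hp : ∀ k, Continuous (p k))
    (hq : ∀ k, Continuous (q k)) (hS : S = {z | ∀ k, a k z = s k * (p k z - q k z)}) :
    IsClosed S := by
  rw [hS, Set.ofPred_forall]
  exact isClosed_iInter fun k => isClosed_eq (ha k) (continuous_const.mul ((hp k).sub (hq k)))

/-- The graph is the solution set of the equations that express the coefficients of `f` through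
those of `x`. Membership in the Hölder algebra needs no further condition: the boundedness of `f` is
the Hölder estimate, with constant `‖f‖`. -/
lemma isClosed_graph_diffQuot :
    IsClosed[weakStarNF c ħ μ ν]
      (Set.range fun x => (Holder.toN c ħ μ ν A B C x, diffQuot c ħ μ ν A B C x)) := by
  let ι : Type := {t : ℝ // 0 < t} × Fin 3 × Hil × Hil
  refine @isClosed_of_forall_eq _ ι (weakStarNF c ħ μ ν) _
    (fun k => ((((k.1 : ℝ) ^ (![A, B, C] k.2.1))⁻¹ : ℝ) : ℂ))
    (fun k z => inner ℂ k.2.2.2 ((z.2 k.1 k.2.1 : BH) k.2.2.1))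
    (fun k z => inner ℂ k.2.2.2 ((z.1 : BH) k.2.2.1))
    -- Moving the unitaries onto the vectors makes a coefficient of the translated operator a
    -- coefficient of `x` itself, hence weak*-continuous.
    (fun k z => inner ℂ (ContinuousLinearMap.adjoint (oneParam c ħ μ k.2.1 k.1) k.2.2.2)
      ((z.1 : BH) (oneParam c ħ μ k.2.1 (-k.1) k.2.2.1))) ?_ ?_ ?_ ?_
  · exact fun k => continuous_weakStarNF_snd k.1 k.2.1 k.2.2.1 k.2.2.2
  · exact fun k => continuous_weakStarNF_fst k.2.2.1 k.2.2.2
  · exact fun k => continuous_weakStarNF_fst _ _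
  have hinner : ∀ (t : {t : ℝ // 0 < t}) (i : Fin 3) (ξ η : Hil) (T : BH),
      inner ℂ (ContinuousLinearMap.adjoint (oneParam c ħ μ i t) η) (T (oneParam c ħ μ i (-t) ξ)) =
        inner ℂ η (act c ħ μ i t T ξ) := fun t i ξ η T => by
    rw [ContinuousLinearMap.adjoint_inner_left, act_eq]
    rfl
  ext ⟨x, f⟩
  simp only [Set.mem_range, Set.mem_ofPred_eq, Prod.mk.injEq, hinner]
  constructor
  · rintro ⟨y, rfl, rfl⟩ ⟨t, i, ξ, η⟩
    rw [diffQuot_apply, ← inner_sub_right, ← inner_smul_right]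
    rfl
  · intro h
    have hf : ∀ (t : {t : ℝ // 0 < t}) (i : Fin 3), (f t i : BH) =
        ((((t : ℝ) ^ (![A, B, C] i))⁻¹ : ℝ) : ℂ) • ((x : BH) - act c ħ μ i (t : ℝ) (x : BH)) :=
      fun t i => by
        ext1 ξ
        refine ext_inner_left ℂ fun η => ?_
        have h1 := h (t, i, ξ, η)
        rw [← inner_sub_right, ← inner_smul_right] at h1
        exact h1
    have hx : IsHolderConst c ħ μ A B C x ‖f‖ :=
      (isHolderConst_iff ..).2 ⟨norm_nonneg f, fun i t ht => by
        have h1 := norm_F_apply_le f ⟨t, ht⟩ i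
        have hpos : 0 < t ^ (![A, B, C] i) := Real.rpow_pos_of_pos ht _
        rwa [hf, norm_smul, Complex.norm_real, Real.norm_of_nonneg (inv_nonneg.2 hpos.le),
          inv_mul_le_iff₀ hpos, mul_comm] at h1⟩
    let y : Holder c ħ μ ν A B C := ⟨x, x.2, _, hx⟩
    exact ⟨y, rfl, F_ext fun t i => (hf t i).symm⟩

end Bimodule

end QHM

end

theorem theorem18 (c : ℕ) (hc : 0 < c) (ħ μ ν : ℝ) (A B C : ℝ)
    (hA : A ∈ Set.Ioc (0 : ℝ) 1) (hB : B ∈ Set.Ioc (0 : ℝ) 1) (hC : C ∈ Set.Ioc (0 : ℝ) 1) :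
    ∃ (mul : QHM.Holder c ħ μ ν A B C →ₗ[ℂ] QHM.Holder c ħ μ ν A B C →ₗ[ℂ]
        QHM.Holder c ħ μ ν A B C)
      (lact : QHM.N c ħ μ ν →ₗ[ℂ] QHM.F c ħ μ ν →ₗ[ℂ] QHM.F c ħ μ ν)
      (ract : QHM.N c ħ μ ν →ₗ[ℂ] QHM.F c ħ μ ν →ₗ[ℂ] QHM.F c ħ μ ν)
      (d : QHM.Holder c ħ μ ν A B C →ₗ[ℂ] QHM.F c ħ μ ν),
      -- `mul` is the operator product, `lact` and `ract` are the left and right action of `N_ħ`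
      -- on `F`, and `d` is the difference quotient map
      (∀ x y, QHM.Holder.incl c ħ μ ν A B C (mul x y) =
        QHM.Holder.incl c ħ μ ν A B C x * QHM.Holder.incl c ħ μ ν A B C y) ∧
      (∀ x f t i, (lact x f t i : QHM.BH) = (x : QHM.BH) * (f t i : QHM.BH)) ∧
      (∀ x f t i, (ract x f t i : QHM.BH) =
        (f t i : QHM.BH) * QHM.act c ħ μ i (t : ℝ) (x : QHM.BH)) ∧
      (∀ x t i, (d x t i : QHM.BH) =
        ((((t : ℝ) ^ (![A, B, C] i))⁻¹ : ℝ) : ℂ) •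
          (QHM.Holder.incl c ħ μ ν A B C x -
            QHM.act c ħ μ i (t : ℝ) (QHM.Holder.incl c ħ μ ν A B C x))) ∧
      -- (a) `d` is an unbounded derivation whose graph is weak*-closed
      (∀ x y, d (mul x y) =
        lact (QHM.Holder.toN c ħ μ ν A B C x) (d y) +
          ract (QHM.Holder.toN c ħ μ ν A B C y) (d x)) ∧
      (¬ ∃ M : ℝ, ∀ x, ‖d x‖ ≤ M * ‖QHM.Holder.incl c ħ μ ν A B C x‖) ∧
      IsClosed[QHM.weakStarNF c ħ μ ν]
        (Set.range fun x => (QHM.Holder.toN c ħ μ ν A B C x, d x)) ∧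
      -- (b) dual Banach algebra
      CompleteSpace (QHM.Holder c ħ μ ν A B C) ∧
      (∀ x y, ‖mul x y‖ ≤ 2 * ‖x‖ * ‖y‖) ∧
      (∃ (P : Type) (_ : NormedAddCommGroup P) (_ : NormedSpace ℂ P) (_ : CompleteSpace P)
        (Ψ : QHM.Holder c ħ μ ν A B C ≃ₗᵢ[ℂ] StrongDual ℂ P), ∀ y,
        (Continuous fun φ : WeakDual ℂ P =>
          StrongDual.toWeakDual (Ψ (mul (Ψ.symm (WeakDual.toStrongDual φ)) y))) ∧
        (Continuous fun φ : WeakDual ℂ P =>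
          StrongDual.toWeakDual (Ψ (mul y (Ψ.symm (WeakDual.toStrongDual φ)))))) ∧
      -- densely contained in `D_ħ`
      QHM.holder c ħ μ ν A B C ≤ QHM.D c ħ μ ν ∧
      closure (QHM.holder c ħ μ ν A B C : Set QHM.BH) = (QHM.D c ħ μ ν : Set QHM.BH) ∧
      -- contains `S^c` if `C < 1`
      (C < 1 → ∀ Φ ∈ QHM.schwartz c, ∃ T ∈ QHM.holder c ħ μ ν A B C,
        QHM.IsActionOf ħ μ ν Φ T) ∧
      -- (c) the unit ball is compact for the operator norm
      IsCompact (QHM.Holder.incl c ħ μ ν A B C '' Metric.closedBall 0 1) := by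
  have hc' := QHM.isCompact_holderBall c ħ μ ν hA.1 hB.1 hC
  have hP := QHM.exists_predual (c := c) (ħ := ħ) (μ := μ) (ν := ν) hA.1 hB.1 hC
  refine ⟨QHM.Holder.mul c ħ μ ν A B C, QHM.leftAct c ħ μ ν, QHM.rightAct c ħ μ ν,
    QHM.diffQuot c ħ μ ν A B C, QHM.Holder.incl_mul, QHM.leftAct_apply, QHM.rightAct_apply,
    QHM.diffQuot_apply, QHM.diffQuot_mul, QHM.isEmpty_bound_diffQuot hA hB hC,
    QHM.isClosed_graph_diffQuot, ?_, QHM.Holder.norm_mul_le, hP,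
    QHM.holder_le_D c ħ μ ν hA.1 hB.1 hC, QHM.closure_holder hA hB hC,
    fun _ Φ hΦ => QHM.schwartz_mem_holder hA hB hC hΦ, ?_⟩
  · obtain ⟨P, _, _, _, Ψ, -⟩ := hP
    -- Completeness is inherited from the dual space.
    exact Ψ.toIsometryEquiv.completeSpace
  · rwa [QHM.incl_image_closedBall]
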